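/- Let $F$ be a field and $R$ a commutative ring. For $n\ge 0$ let $G_n$ be one of the groups $\mathrm{GL}_n(F)$, $\mathrm{SL}_n(F)$, $\mathrm{Sp}_{2n}(F)$, $\mathrm{SO}_{n,n}(F)$, $\mathrm{SO}_{n,n+1}(F)$, acting on the vector space $V_n$ with standard basis * $a_1,\dots,a_n$ for $\mathrm{GL}_n$ and $\mathrm{SL}_n$; * $a_1,\dots,a_n,b_1,\dots,b_n$ for $\mathrm{Sp}_{2n}$, the linear automorphisms preserving the alternating form $\omega$ with $\omega(a_j,b_k)=\delta_{jk}$ and $\omega(a_j,a_k)=\omega(b_j,b_k)=0$; * $a_1,\dots,a_n,b_1,\dots,b_n$ for $\mathrm{SO}_{n,n}$, and $a_1,\dots,a_n,b_1,\dots,b_n,e$ for $\mathrm{SO}_{n,n+1}$; these are the groups of linear automorphisms of determinant $1$ preserving the quadratic form $q\bigl(\sum_j (c_ja_j+d_jb_j)\bigr)=\sum_j c_jd_j$, respectively $q\bigl(\lambda e+\sum_j (c_ja_j+d_jb_j)\bigr)=\lambda^2+\sum_j c_jd_j$ (in every characteristic). The Steinberg representation $\mathrm{St}_{G_n}=\mathrm{St}_{G_n}(F;R)$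 is the reduced simplicial homology with coefficients in $R$, in top degree, of the complex of flags of nonzero proper subspaces of $V_n$ (for $\mathrm{GL}_n$ and $\mathrm{SL}_n$; top degree $n-2$), respectively of nonzero isotropic subspaces of $V_n$, that is, those on which $\omega$, respectively $q$, vanishes identically (for the other families; top degree $n-1$). If this complex is empty, then $\mathrm{St}_{G_n}=R$ with the trivial action. Let $1\le \ell\le n$ and put $\mathrm{Stab}_n^\ell=\{g\in G_n : g(a_j)=a_j \text{ for } 1\le j\le \ell\}$. Let $1\times G_{n-\ell}\subset \mathrm{Stab}_n^\ell$ be the copy of $G_{n-\ell}$ that acts on the span of the $a_j$, $b_j$ with $j>\ell$ and $e$ (those that exist) and fixes the $a_j$, $b_j$ with $j\le \ell$. The Reeder product map $$\mathrm{St}_{\mathrm{GL}_\ell}\otimes_R \mathrm{St}_{G_{n-\ell}}\longrightarrow \mathrm{St}_{G_n}$$ is the linear map that takes $[v_1,\dots,v_\ell]\otimes[w]$ to the apartment class of $V_n$ obtained by placing $v_1,\dots,v_\ell$ (for the last three families: with the dual basis in $\langle b_1,\dots,b_\ell\rangle$ of the basis $v_1,\dots,v_\ell$ of $\langle a_1,\dots,a_\ell\rangle$)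 before $w$. Here $[v_1,\dots,v_\ell]$ is the apartment class of a basis of $F^\ell=\langle a_1,\dots,a_\ell\rangle$, and $[w]$ is the apartment class of a basis, respectively of a hyperbolic basis, of the space of $G_{n-\ell}$. Apartment classes are oriented so that the flag $\langle v_1\rangle\subset\langle v_1,v_2\rangle\subset\cdots$ has coefficient $+1$. The group $1\times G_{n-\ell}$ acts on $\mathrm{St}_{\mathrm{GL}_\ell}\otimes_R\mathrm{St}_{G_{n-\ell}}$ through the second factor. Then for every $i\ge 0$ the map $$H_i(1\times G_{n-\ell};\,\mathrm{St}_{\mathrm{GL}_\ell}\otimes_R \mathrm{St}_{G_{n-\ell}})\longrightarrow H_i(\mathrm{Stab}_n^\ell;\,\mathrm{Res}^{G_n}_{\mathrm{Stab}_n^\ell}\mathrm{St}_{G_n})$$ induced by the inclusion $1\times G_{n-\ell}\hookrightarrow \mathrm{Stab}_n^\ell$ and the Reeder product map is an isomorphism. Moreover there is an isomorphism of $R$-modules $$\mathrm{St}_{\mathrm{GL}_\ell}\otimes_R H_i(G_{n-\ell};\mathrm{St}_{G_{n-\ell}})\;\cong\; H_i(\mathrm{Stab}_n^\ell;\,\mathrm{Res}^{G_n}_{\mathrm{Stab}_n^\ell}\mathrm{St}_{G_n}).$$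 -/

import Mathlib

universe u

open scoped TensorProduct

namespace SteinbergStability

section Flags

variable {F V : Type u} [Field F] [AddCommGroup V] [Module F V]

/-- Strictly increasing sequences of `k` subspaces satisfying `p`: the `(k-1)`-simplices of the
order complex of the poset of all subspaces satisfying `p`.  There is exactly one for `k = 0`, the
empty simplex. -/
def FlagOf (p : Submodule F V → Prop) (k : ℕ) : Type u :=
  {f : Fin k → Submodule F V // StrictMono f ∧ ∀ i, p (f i)}

/-- Omit the `j`-th vertex of a simplex. -/
def FlagOf.face {p : Submodule F V → Prop} {k : ℕ} (j : Fin (k + 1)) (f : FlagOf p (k + 1)) :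
    FlagOf p k :=
  ⟨fun i => f.1 (j.succAbove i), f.2.1.comp (Fin.strictMono_succAbove j), fun _ => f.2.2 _⟩

/-- Simplicial chains of degree `k - 1` on the order complex. -/
abbrev Chain (R : Type u) [CommRing R] (p : Submodule F V → Prop) (k : ℕ) : Type u :=
  FlagOf p k →₀ R

/-- The simplicial boundary; for `k = 0` it is the augmentation. -/
noncomputable def boundary (R : Type u) [CommRing R] (p : Submodule F V → Prop) (k : ℕ) :
    Chain R p (k + 1) →ₗ[R] Chain R p k :=
  ∑ j : Fin (k + 1), (-1 : R) ^ (j : ℕ) • Finsupp.lmapDomain R R (FlagOf.face j)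

/-- Reduced simplicial cycles of degree `k - 1`; in degree `-1` everything is a cycle.  If the
complex has no simplices of dimension `k`, this is its reduced homology in degree `k - 1`. -/
noncomputable def cycles (R : Type u) [CommRing R] (p : Submodule F V → Prop) :
    (k : ℕ) → Submodule R (Chain R p k)
  | 0 => ⊤
  | k + 1 => LinearMap.ker (boundary R p k)

noncomputable instance (R : Type u) [CommRing R] (p : Submodule F V → Prop) (k : ℕ) :
    AddCommGroup (cycles R p k) :=
  Submodule.addCommGroup _

/-- The group of linear automorphisms that permute the subspaces satisfying `p`. -/
def preserving (p : Submodule F V → Prop) : Subgroup (V ≃ₗ[F] V) where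
  carrier := {g | ∀ W, p (W.map (g : V →ₗ[F] V)) ↔ p W}
  one_mem' W := by
    have : W.map ((1 : V ≃ₗ[F] V) : V →ₗ[F] V) = W := Submodule.map_id W
    rw [this]
  mul_mem' {g h} hg hh W := by
    have : W.map ((g * h : V ≃ₗ[F] V) : V →ₗ[F] V)
        = (W.map (h : V →ₗ[F] V)).map (g : V →ₗ[F] V) := Submodule.map_comp _ _ W
    rw [this, hg, hh]
  inv_mem' {g} hg W := by
    have : (W.map ((g⁻¹ : V ≃ₗ[F] V) : V →ₗ[F] V)).map (g : V →ₗ[F] V) = W := by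
      rw [← Submodule.map_comp]
      have h2 : (g : V →ₗ[F] V) ∘ₗ ((g⁻¹ : V ≃ₗ[F] V) : V →ₗ[F] V) = LinearMap.id := by
        ext x; exact g.apply_symm_apply x
      rw [h2, Submodule.map_id]
    rw [← hg, this]

variable {p : Submodule F V → Prop} {k : ℕ}

/-- The action of linear automorphisms on simplices. -/
def FlagOf.map (g : preserving p) (f : FlagOf p k) : FlagOf p k :=
  ⟨fun i => (f.1 i).map (g.1 : V →ₗ[F] V),
    fun _ _ h => Submodule.map_strictMono_of_injective g.1.injective (f.2.1 h),
    fun i => (g.2 _).2 (f.2.2 i)⟩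

theorem FlagOf.map_one (f : FlagOf p k) : FlagOf.map 1 f = f :=
  Subtype.ext (funext fun _ => Submodule.map_id _)

theorem FlagOf.map_mul (g h : preserving p) (f : FlagOf p k) :
    FlagOf.map (g * h) f = FlagOf.map g (FlagOf.map h f) :=
  Subtype.ext (funext fun _ => Submodule.map_comp _ _ _)

/-- The permutation action on chains. -/
noncomputable def chainRep (R : Type u) [CommRing R] (p : Submodule F V → Prop) (k : ℕ) :
    Representation R (preserving p) (Chain R p k) where
  toFun g := Finsupp.lmapDomain R R (FlagOf.map g)
  map_one' := by
    have : (FlagOf.map (1 : preserving p) : FlagOf p k → FlagOf p k) = id :=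
      funext FlagOf.map_one
    rw [this]; exact Finsupp.lmapDomain_id R R
  map_mul' g h := by
    have : (FlagOf.map (g * h) : FlagOf p k → FlagOf p k) = FlagOf.map g ∘ FlagOf.map h :=
      funext (FlagOf.map_mul g h)
    rw [this]; exact Finsupp.lmapDomain_comp R R _ _

theorem boundary_chainRep (R : Type u) [CommRing R] (g : preserving p) (z : Chain R p (k + 1)) :
    boundary R p k (chainRep R p (k + 1) g z) = chainRep R p k g (boundary R p k z) := by
  simp only [boundary, LinearMap.sum_apply, LinearMap.smul_apply, map_sum, map_smul]
  refine Finset.sum_congr rfl fun j _ => ?_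
  congr 1
  change Finsupp.mapDomain _ (Finsupp.mapDomain _ z) = Finsupp.mapDomain _ (Finsupp.mapDomain _ z)
  rw [← Finsupp.mapDomain_comp, ← Finsupp.mapDomain_comp]
  rfl

theorem chainRep_mem_cycles (R : Type u) [CommRing R] (g : preserving p) {z : Chain R p k}
    (hz : z ∈ cycles R p k) : chainRep R p k g z ∈ cycles R p k := by
  cases k with
  | zero => trivial
  | succ k =>
    have h : boundary R p k z = 0 := hz
    change boundary R p k _ = 0
    rw [boundary_chainRep, h, map_zero]

/-- The action on reduced cycles. -/
noncomputable def cycleRep (R : Type u) [CommRing R] (p : Submodule F V → Prop) (k : ℕ) :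
    Representation R (preserving p) (cycles R p k) where
  toFun g := (chainRep R p k g).restrict fun _ hz => chainRep_mem_cycles R g hz
  map_one' := by ext1 z; apply Subtype.ext; simp
  map_mul' g h := by ext1 z; apply Subtype.ext; simp

end Flags

section Cycles

variable {F V : Type u} [Field F] [AddCommGroup V] [Module F V]
variable {p : Submodule F V → Prop} {k : ℕ} {R : Type u} [CommRing R]

/-- All the individual faces of the chain vanish.  (Vertices are blanked out, not deleted.) -/
def FacesVanish (z : Chain R p k) : Prop :=
  ∀ j : Fin k, Finsupp.mapDomain (fun f : FlagOf p k => Function.update f.1 j ⊥) z = 0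

theorem mem_cycles_of_facesVanish {z : Chain R p k} (hz : FacesVanish z) : z ∈ cycles R p k := by
  cases k with
  | zero => trivial
  | succ k =>
    change boundary R p k z = 0
    rw [boundary, LinearMap.sum_apply]
    refine Finset.sum_eq_zero fun j _ => ?_
    rw [LinearMap.smul_apply]
    have h2 : Finsupp.mapDomain (FlagOf.face j) z = 0 := by
      apply Finsupp.mapDomain_injective (f := fun f : FlagOf p k => f.1) Subtype.val_injective
      rw [← Finsupp.mapDomain_comp, Finsupp.mapDomain_zero]
      have h3 : (fun f : FlagOf p k => f.1) ∘ FlagOf.face j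
          = (fun f : Fin (k + 1) → Submodule F V => fun i => f (j.succAbove i)) ∘
            (fun f : FlagOf p (k + 1) => Function.update f.1 j ⊥) := by
        funext f; funext i
        simp [FlagOf.face]
      rw [h3, Finsupp.mapDomain_comp, hz j, Finsupp.mapDomain_zero]
    change _ • Finsupp.mapDomain (FlagOf.face j) z = 0
    rw [h2, smul_zero]

theorem strictMono_fin_eq {k : ℕ} (r : Fin k → ℕ) (hr : StrictMono r) (h1 : ∀ i, 1 ≤ r i)
    (h2 : ∀ i, r i ≤ k) (i : Fin k) : r i = i + 1 := by
  have lo : ∀ n (h : n < k), n + 1 ≤ r ⟨n, h⟩ := by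
    intro n
    induction n with
    | zero => intro h; exact h1 _
    | succ n ih =>
      intro h
      have := ih (by omega)
      have h3 : r ⟨n, by omega⟩ < r ⟨n + 1, h⟩ := hr (by simp [Fin.lt_def])
      omega
  have hi : ∀ d n (h : n < k), n + 1 + d = k → r ⟨n, h⟩ ≤ n + 1 := by
    intro d
    induction d with
    | zero => intro n h e; have := h2 ⟨n, h⟩; omega
    | succ d ih =>
      intro n h e
      have := ih (n + 1) (by omega) (by omega)
      have h3 : r ⟨n, h⟩ < r ⟨n + 1, by omega⟩ := hr (by simp [Fin.lt_def])
      omega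
  have a := lo i.1 i.2
  have b := hi (k - (i.1 + 1)) i.1 i.2 (by have := i.2; omega)
  exact le_antisymm b a

variable [FiniteDimensional F V]

theorem FlagOf.finrank_eq (h1 : ∀ W, p W → W ≠ ⊥) (h2 : ∀ W, p W → Module.finrank F W ≤ k)
    (f : FlagOf p k) (i : Fin k) : Module.finrank F (f.1 i) = i + 1 := by
  refine strictMono_fin_eq (fun i => Module.finrank F (f.1 i)) ?_ ?_ ?_ i
  · intro a b h; exact Submodule.finrank_lt_finrank_of_lt (f.2.1 h)
  · intro i; exact Submodule.one_le_finrank_iff.2 (h1 _ (f.2.2 i))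
  · intro i; exact h2 _ (f.2.2 i)

theorem facesVanish_of_mem_cycles (h1 : ∀ W, p W → W ≠ ⊥)
    (h2 : ∀ W, p W → Module.finrank F W ≤ k) {z : Chain R p k} (hz : z ∈ cycles R p k) :
    FacesVanish z := by
  cases k with
  | zero => exact fun j => j.elim0
  | succ k =>
    have hz' : boundary R p k z = 0 := hz
    intro j
    have key : Finsupp.mapDomain (FlagOf.face j) z = 0 := by
      ext g
      by_cases hg : g ∈ Set.range (FlagOf.face (p := p) j)
      · have h0 := DFunLike.congr_fun hz' g
        rw [boundary, LinearMap.sum_apply, Finsupp.finsetSum_apply, Finset.sum_eq_single j] at h0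
        · rw [LinearMap.smul_apply, Finsupp.smul_apply, Finsupp.zero_apply, smul_eq_mul] at h0
          have hu : IsUnit ((-1 : R) ^ (j : ℕ)) := (isUnit_one.neg).pow _
          exact (hu.mul_right_eq_zero).1 h0
        · intro j' _ hj'
          rw [LinearMap.smul_apply, Finsupp.smul_apply]
          have : Finsupp.mapDomain (FlagOf.face j') z g = 0 := by
            apply Finsupp.mapDomain_of_notMem_range
            rintro ⟨f', hf'⟩
            obtain ⟨f, hf⟩ := hg
            obtain ⟨i, hi⟩ := Fin.exists_succAbove_eq hj'
            have e1 : f.1 (j.succAbove i) = f'.1 (j'.succAbove i) :=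
              congrFun (congrArg Subtype.val (hf.trans hf'.symm)) i
            have e2 := FlagOf.finrank_eq h1 h2 f (j.succAbove i)
            rw [e1, FlagOf.finrank_eq h1 h2 f' (j'.succAbove i)] at e2
            have e3 : j'.succAbove i = j.succAbove i := Fin.ext (by omega)
            rw [hi] at e3
            exact Fin.succAbove_ne j' i e3
          change _ • Finsupp.mapDomain (FlagOf.face j') z g = 0
          rw [this, smul_zero]
        · simp
      · rw [Finsupp.mapDomain_of_notMem_range _ _ hg, Finsupp.zero_apply]
    have h3 : (fun f : FlagOf p (k + 1) => Function.update f.1 j ⊥)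
        = (fun g : FlagOf p k => j.insertNth (α := fun _ => Submodule F V) ⊥ g.1) ∘
            FlagOf.face j := by
      funext f
      symm
      apply Fin.insertNth_eq_iff.2
      refine ⟨by simp, ?_⟩
      funext i
      simp [FlagOf.face, Fin.removeNth]
    rw [h3, Finsupp.mapDomain_comp, key, Finsupp.mapDomain_zero]

/-- If all subspaces satisfying `p` are nonzero of dimension at most `k`, the order complex has no
simplices of dimension `k`, so its reduced homology in degree `k - 1` is `cycles R p k`. -/
theorem isEmpty_flagOf_succ (h1 : ∀ W, p W → W ≠ ⊥) (h2 : ∀ W, p W → Module.finrank F W ≤ k) :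
    IsEmpty (FlagOf p (k + 1)) := by
  refine ⟨fun f => ?_⟩
  have := FlagOf.finrank_eq (k := k + 1) h1 (fun W hW => (h2 W hW).trans (Nat.le_succ k)) f
    (Fin.last k)
  have h3 := h2 _ (f.2.2 (Fin.last k))
  rw [this] at h3
  simp at h3

end Cycles

section Words

/-- The number of letters `b` among the first `t` letters of the word `w`. -/
def letterCount {n : ℕ} (w : Fin n → Bool) (b : Bool) (t : ℕ) : ℕ :=
  (Finset.univ.filter fun i : Fin n => (i : ℕ) < t ∧ w i = b).card

variable {n : ℕ} (w : Fin n → Bool)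

theorem letterCount_zero (b : Bool) : letterCount w b 0 = 0 := by
  simp [letterCount]

theorem letterCount_succ (b : Bool) {t : ℕ} (ht : t < n) :
    letterCount w b (t + 1) = letterCount w b t + if w ⟨t, ht⟩ = b then 1 else 0 := by
  unfold letterCount
  have h : (Finset.univ.filter fun i : Fin n => (i : ℕ) < t + 1 ∧ w i = b)
      = (Finset.univ.filter fun i : Fin n => (i : ℕ) < t ∧ w i = b) ∪
        (if w ⟨t, ht⟩ = b then {⟨t, ht⟩} else ∅) := by
    ext i
    simp only [Finset.mem_filter, Finset.mem_univ, true_and, Finset.mem_union]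
    by_cases hi : i = ⟨t, ht⟩
    · subst hi
      by_cases hw : w ⟨t, ht⟩ = b <;> simp [hw]
    · have hne : (i : ℕ) ≠ t := fun h => hi (Fin.ext h)
      have : (i : ℕ) < t + 1 ↔ (i : ℕ) < t := by omega
      rw [this]
      by_cases hw : w ⟨t, ht⟩ = b <;> simp [hw, hi]
  rw [h, Finset.card_union_of_disjoint]
  · by_cases hw : w ⟨t, ht⟩ = b <;> simp [hw]
  · by_cases hw : w ⟨t, ht⟩ = b <;> simp [hw]

theorem letterCount_mono (b : Bool) : Monotone (letterCount w b) := by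
  intro s t hst
  apply Finset.card_le_card
  intro i
  simp only [Finset.mem_filter, Finset.mem_univ, true_and]
  rintro ⟨h1, h2⟩
  exact ⟨by omega, h2⟩

theorem letterCount_add {t : ℕ} (ht : t ≤ n) :
    letterCount w true t + letterCount w false t = t := by
  induction t with
  | zero => simp [letterCount_zero]
  | succ t ih =>
    rw [letterCount_succ w true ht, letterCount_succ w false ht]
    have := ih (by omega)
    cases w ⟨t, ht⟩ <;> simp <;> omega

theorem letterCount_congr {w w' : Fin n → Bool} {t : ℕ} (h : ∀ i : Fin n, (i : ℕ) < t → w i = w' i)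
    (b : Bool) : letterCount w b t = letterCount w' b t := by
  unfold letterCount
  congr 1
  ext i
  simp only [Finset.mem_filter, Finset.mem_univ, true_and]
  constructor
  · rintro ⟨h1, h2⟩; exact ⟨h1, (h i h1) ▸ h2⟩
  · rintro ⟨h1, h2⟩; exact ⟨h1, (h i h1).symm ▸ h2⟩

/-- Exchange the letters at the positions `t` and `t + 1`. -/
def swapLetters {t : ℕ} (ht : t + 1 < n) (w : Fin n → Bool) : Fin n → Bool :=
  w ∘ Equiv.swap ⟨t, by omega⟩ ⟨t + 1, ht⟩

theorem swapLetters_swapLetters {t : ℕ} (ht : t + 1 < n) :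
    swapLetters ht (swapLetters ht w) = w := by
  funext i; simp [swapLetters]

theorem swapLetters_eq_self {t : ℕ} (ht : t + 1 < n)
    (h : w ⟨t, by omega⟩ = w ⟨t + 1, ht⟩) : swapLetters ht w = w := by
  funext i
  simp only [swapLetters, Function.comp, Equiv.swap_apply_def]
  split_ifs with h1 h2
  · rw [h1, h]
  · rw [h2, h]
  · rfl

theorem swapLetters_ne_self {t : ℕ} (ht : t + 1 < n)
    (h : w ⟨t, by omega⟩ ≠ w ⟨t + 1, ht⟩) : swapLetters ht w ≠ w := by
  intro h2
  apply h
  have := congrFun h2 ⟨t + 1, ht⟩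
  simpa [swapLetters] using this

theorem letterCount_swapLetters {t : ℕ} (ht : t + 1 < n) (b : Bool) {s : ℕ} (hs : s ≠ t + 1)
    (hsn : s ≤ n) : letterCount (swapLetters ht w) b s = letterCount w b s := by
  have low : ∀ s ≤ t, letterCount (swapLetters ht w) b s = letterCount w b s := by
    intro s hs
    apply letterCount_congr
    intro i hi
    simp only [swapLetters, Function.comp]
    rw [Equiv.swap_apply_of_ne_of_ne]
    · intro h; rw [h] at hi; simp at hi; omega
    · intro h; rw [h] at hi; simp at hi; omega
  have high : ∀ d, t + 2 + d ≤ n →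
      letterCount (swapLetters ht w) b (t + 2 + d) = letterCount w b (t + 2 + d) := by
    intro d
    induction d with
    | zero =>
      intro h
      have e1 := low t le_rfl
      change letterCount _ b (t + 1 + 1) = letterCount _ b (t + 1 + 1)
      rw [letterCount_succ _ b ht, letterCount_succ _ b (show t < n by omega),
        letterCount_succ _ b ht, letterCount_succ _ b (show t < n by omega), e1]
      simp only [swapLetters, Function.comp, Equiv.swap_apply_left, Equiv.swap_apply_right]
      omega
    | succ d ih =>
      intro h
      change letterCount _ b (t + 2 + d + 1) = letterCount _ b (t + 2 + d + 1)
      rw [letterCount_succ _ b (show t + 2 + d < n by omega), ih (by omega),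
        letterCount_succ _ b (show t + 2 + d < n by omega)]
      congr 2
      simp only [swapLetters, Function.comp]
      rw [Equiv.swap_apply_of_ne_of_ne]
      · intro h; simp [Fin.ext_iff] at h; omega
      · intro h; simp [Fin.ext_iff] at h; omega
  by_cases h : s ≤ t
  · exact low s h
  · obtain ⟨d, rfl⟩ : ∃ d, s = t + 2 + d := ⟨s - (t + 2), by omega⟩
    exact high d hsn

theorem prod_swapLetters {R : Type u} [CommRing R] {t : ℕ} (ht : t + 1 < n) (c : Fin n → R)
    (hc : c ⟨t + 1, ht⟩ = - c ⟨t, by omega⟩) (b : Bool)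
    (h : w ⟨t, by omega⟩ ≠ w ⟨t + 1, ht⟩) :
    (∏ i, if swapLetters ht w i = b then c i else 1) = -∏ i, if w i = b then c i else 1 := by
  classical
  set x : Fin n := ⟨t, by omega⟩ with hx
  set y : Fin n := ⟨t + 1, ht⟩ with hy
  have hxy : x ≠ y := by simp [hx, hy]
  have e1 : (∏ i, if swapLetters ht w i = b then c i else 1)
      = ∏ i, if w i = b then c (Equiv.swap x y i) else 1 := by
    rw [← Equiv.prod_comp (Equiv.swap x y)]
    refine Finset.prod_congr rfl fun i _ => ?_
    simp [swapLetters, ← hx, ← hy]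
  have hz : ∃ z, (z = x ∨ z = y) ∧ w z = b ∧ ∀ i, (i = x ∨ i = y) → w i = b → i = z := by
    by_cases hb : w x = b
    · refine ⟨x, Or.inl rfl, hb, ?_⟩
      rintro i (rfl | rfl) hi
      · rfl
      · exact absurd (hb.trans hi.symm) h
    · refine ⟨y, Or.inr rfl, ?_, ?_⟩
      · revert hb h; cases w x <;> cases w y <;> cases b <;> simp
      · rintro i (rfl | rfl) hi
        · exact absurd hi hb
        · rfl
  obtain ⟨z, hz1, hz2, hz3⟩ := hz
  have e2 : ∀ i, (if w i = b then c (Equiv.swap x y i) else 1)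
      = (if i = z then -1 else 1) * (if w i = b then c i else 1) := by
    intro i
    by_cases hi : w i = b
    · simp only [hi, if_true]
      by_cases hixy : i = x ∨ i = y
      · rw [if_pos (hz3 i hixy hi)]
        rcases hixy with rfl | rfl
        · rw [Equiv.swap_apply_left, hc]; ring
        · rw [Equiv.swap_apply_right, hc]; ring
      · rw [not_or] at hixy
        rw [Equiv.swap_apply_of_ne_of_ne hixy.1 hixy.2, if_neg, one_mul]
        rintro rfl
        rcases hz1 with h | h
        · exact hixy.1 h
        · exact hixy.2 h
    · simp only [hi, if_false, mul_one]
      rw [if_neg]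
      rintro rfl
      exact hi hz2
  rw [e1, Finset.prod_congr rfl fun i _ => e2 i, Finset.prod_mul_distrib]
  simp

end Words

section Vertices

variable {F V : Type u} [Field F] [AddCommGroup V] [Module F V]

/-- The flag `0 = f₀ < f₁ < ⋯ < f_k` attached to a sequence of `k` subspaces, continued by the
whole space in the positions beyond `k`. -/
def vertex {k : ℕ} (f : Fin k → Submodule F V) (i : ℕ) : Submodule F V :=
  if i = 0 then ⊥ else if h : i - 1 < k then f ⟨i - 1, h⟩ else ⊤

theorem vertex_update {k : ℕ} (f : Fin k → Submodule F V) (j : Fin k) {i : ℕ} (hi : i ≠ j + 1) :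
    vertex (Function.update f j ⊥) i = vertex f i := by
  unfold vertex
  split_ifs with h1 h2
  · rfl
  · rw [Function.update_of_ne]
    intro h
    apply hi
    rw [← h]; simp; omega
  · rfl

theorem vertex_map {W : Type u} [AddCommGroup W] [Module F W] (g : V ≃ₗ[F] W) {k : ℕ}
    (f : Fin k → Submodule F V) (i : ℕ) :
    vertex (fun j => (f j).map (g : V →ₗ[F] W)) i = (vertex f i).map (g : V →ₗ[F] W) := by
  unfold vertex
  split_ifs with h1 h2
  · simp
  · rfl
  · rw [Submodule.map_top]; exact (LinearEquiv.range g).symm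

/-- Nonzero proper subspaces. -/
def IsProper (W : Submodule F V) : Prop := W ≠ ⊥ ∧ W ≠ ⊤

theorem vertex_strict_of_ne_bot {p : Submodule F V → Prop} (hp : ∀ W, p W → W ≠ ⊥) {k : ℕ}
    (f : FlagOf p k) {i j : ℕ} (hij : i < j) (hj : j ≤ k) : vertex f.1 i < vertex f.1 j := by
  unfold vertex
  rw [if_neg (show j ≠ 0 by omega), dif_pos (show j - 1 < k by omega)]
  split_ifs with h1 h2
  · exact bot_lt_iff_ne_bot.2 (hp _ (f.2.2 _))
  · apply f.2.1; simp [Fin.lt_def]; omega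
  · omega

theorem vertex_strict_of_proper {ℓ : ℕ} (f : FlagOf (IsProper : Submodule F (Fin ℓ → F) → Prop)
    (ℓ - 1)) {i j : ℕ} (hij : i < j) (hj : j ≤ ℓ) : vertex f.1 i < vertex f.1 j := by
  by_cases hj2 : j ≤ ℓ - 1
  · exact vertex_strict_of_ne_bot (fun _ h => h.1) f hij hj2
  · unfold vertex
    rw [if_neg (show j ≠ 0 by omega), dif_neg (show ¬ j - 1 < ℓ - 1 by omega)]
    split_ifs with h1 h2
    · have : NeZero ℓ := ⟨by omega⟩
      exact bot_lt_top
    · exact lt_top_iff_ne_top.2 (f.2.2 _).2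
    · omega

end Vertices

section Join

variable {F A B V : Type u} [Field F] [AddCommGroup A] [Module F A] [AddCommGroup B] [Module F B]
  [AddCommGroup V] [Module F V]

/-- Words in two letters with `ℓ` letters `true` and `m` letters `false`. -/
abbrev Shuffle (ℓ m : ℕ) : Type :=
  {w : Fin (ℓ + m) → Bool // letterCount w true (ℓ + m) = ℓ}

/-- The sign of the permutation which moves all letters `true` in front of all letters `false`:
the `true` letters at the positions `s₀ < s₁ < ⋯` contribute `∑ (sᵢ - i)` inversions. -/
def Shuffle.sign (R : Type u) [CommRing R] {ℓ m : ℕ} (w : Shuffle ℓ m) : R :=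
  (-1) ^ (ℓ * (ℓ - 1) / 2) * ∏ i : Fin (ℓ + m), if w.1 i = true then (-1) ^ (i : ℕ) else 1

/-- Position `t` of the flag in `V = A ⊕ B` obtained by shuffling a flag in `A` and a flag in `B`:
the letter `true` means a step in `A`, the letter `false` a step in `B`. -/
def joinVertex (e : (A × B) ≃ₗ[F] V) {n a b : ℕ} (w : Fin n → Bool) (f : Fin a → Submodule F A)
    (g : Fin b → Submodule F B) (t : ℕ) : Submodule F V :=
  ((vertex f (letterCount w true t)).prod (vertex g (letterCount w false t))).map
    (e : (A × B) →ₗ[F] V)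

theorem prod_lt {X X' : Submodule F A} {Y Y' : Submodule F B} (hX : X ≤ X') (hY : Y ≤ Y')
    (h : X < X' ∨ Y < Y') : X.prod Y < X'.prod Y' := by
  refine lt_of_le_of_ne (Submodule.prod_mono hX hY) fun he => ?_
  rcases h with h | h
  · apply h.ne
    ext x
    have := SetLike.ext_iff.1 he (x, 0)
    simpa using this
  · apply h.ne
    ext y
    have := SetLike.ext_iff.1 he (0, y)
    simpa using this

theorem joinVertex_strict (e : (A × B) ≃ₗ[F] V) {ℓ m a b : ℕ} (w : Shuffle ℓ m)
    {f : Fin a → Submodule F A} {g : Fin b → Submodule F B}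
    (hf : ∀ i j, i < j → j ≤ ℓ → vertex f i < vertex f j)
    (hg : ∀ i j, i < j → j ≤ m → vertex g i < vertex g j) {s t : ℕ} (hst : s < t)
    (ht : t ≤ ℓ + m) : joinVertex e w.1 f g s < joinVertex e w.1 f g t := by
  have c1 := letterCount_add w.1 ht
  have c2 := letterCount_add w.1 (show s ≤ ℓ + m by omega)
  have c3 := letterCount_add w.1 le_rfl
  have c4 := w.2
  have m1 := letterCount_mono w.1 true hst.le
  have m2 := letterCount_mono w.1 false hst.le
  have m3 := letterCount_mono w.1 true ht
  have m4 := letterCount_mono w.1 false ht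
  apply Submodule.map_strictMono_of_injective e.injective
  have hf' : ∀ i j, i ≤ j → j ≤ ℓ → vertex f i ≤ vertex f j := by
    intro i j h h2
    rcases h.lt_or_eq with h | rfl
    · exact (hf i j h h2).le
    · exact le_rfl
  have hg' : ∀ i j, i ≤ j → j ≤ m → vertex g i ≤ vertex g j := by
    intro i j h h2
    rcases h.lt_or_eq with h | rfl
    · exact (hg i j h h2).le
    · exact le_rfl
  refine prod_lt (hf' _ _ m1 (by omega)) (hg' _ _ m2 (by omega)) ?_
  by_cases h : letterCount w.1 true s < letterCount w.1 true t
  · exact Or.inl (hf _ _ h (by omega))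
  · exact Or.inr (hg _ _ (by omega) (by omega))

variable {pA : Submodule F A → Prop} {pB : Submodule F B → Prop} {pV : Submodule F V → Prop}

/-- `joinVertex` gives flags: the hypothesis on the data of a join. -/
def JoinValid (e : (A × B) ≃ₗ[F] V) (pA : Submodule F A → Prop) (pB : Submodule F B → Prop)
    (pV : Submodule F V → Prop) (ℓ m a b N : ℕ) : Prop :=
  ∀ (w : Shuffle ℓ m) (f : FlagOf pA a) (g : FlagOf pB b),
    StrictMono (fun t : Fin N => joinVertex e w.1 f.1 g.1 (t + 1)) ∧
      ∀ t : Fin N, pV (joinVertex e w.1 f.1 g.1 (t + 1))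

/-- The shuffle of two flags. -/
def joinFlag {e : (A × B) ≃ₗ[F] V} {ℓ m a b N : ℕ} (H : JoinValid e pA pB pV ℓ m a b N)
    (w : Shuffle ℓ m) (x : FlagOf pA a × FlagOf pB b) : FlagOf pV N :=
  ⟨fun t => joinVertex e w.1 x.1.1 x.2.1 (t + 1), H w x.1 x.2⟩

/-- The shuffle product of chains. -/
noncomputable def joinChain (R : Type u) [CommRing R] {e : (A × B) ≃ₗ[F] V} {ℓ m a b N : ℕ}
    (H : JoinValid e pA pB pV ℓ m a b N) :
    Chain R pA a ⊗[R] Chain R pB b →ₗ[R] Chain R pV N :=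
  (∑ w : Shuffle ℓ m, w.sign R • Finsupp.lmapDomain R R (joinFlag H w)) ∘ₗ
    (finsuppTensorFinsupp' R (FlagOf pA a) (FlagOf pB b)).toLinearMap

variable {R : Type u} [CommRing R]

theorem tensor_left_vanish {α β γ δ : Type u} (z : α →₀ R) (y : β →₀ R) (Φ : α × β → γ)
    (u : α → δ) (Ψ : δ × β → γ) (h : ∀ x, Φ x = Ψ (u x.1, x.2)) (hz : Finsupp.mapDomain u z = 0) :
    Finsupp.mapDomain Φ (finsuppTensorFinsupp' R α β (z ⊗ₜ y)) = 0 := by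
  induction y using Finsupp.induction_linear with
  | zero => simp
  | add y y' h1 h2 => rw [TensorProduct.tmul_add, map_add, Finsupp.mapDomain_add, h1, h2, add_zero]
  | single b r =>
    have e : finsuppTensorFinsupp' R α β (z ⊗ₜ Finsupp.single b r)
        = r • Finsupp.mapDomain (fun a => (a, b)) z := by
      induction z using Finsupp.induction_linear with
      | zero => simp
      | add z z' h1 h2 =>
        have : ∀ z : α →₀ R, finsuppTensorFinsupp' R α β (z ⊗ₜ Finsupp.single b r)
            = r • Finsupp.mapDomain (fun a => (a, b)) z := by
          intro z
          induction z using Finsupp.induction_linear with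
          | zero => simp
          | add z z' h1 h2 =>
            rw [TensorProduct.add_tmul, map_add, Finsupp.mapDomain_add, h1, h2, smul_add]
          | single a s => simp [Finsupp.mapDomain_single, mul_comm]
        exact this _
      | single a s => simp [Finsupp.mapDomain_single, mul_comm]
    rw [e, Finsupp.mapDomain_smul, ← Finsupp.mapDomain_comp]
    have e2 : Φ ∘ (fun a => (a, b)) = (fun d => Ψ (d, b)) ∘ u := by
      funext a; exact h (a, b)
    rw [e2, Finsupp.mapDomain_comp, hz, Finsupp.mapDomain_zero, smul_zero]

theorem tensor_right_vanish {α β γ δ : Type u} (z : α →₀ R) (y : β →₀ R) (Φ : α × β → γ)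
    (u : β → δ) (Ψ : α × δ → γ) (h : ∀ x, Φ x = Ψ (x.1, u x.2)) (hy : Finsupp.mapDomain u y = 0) :
    Finsupp.mapDomain Φ (finsuppTensorFinsupp' R α β (z ⊗ₜ y)) = 0 := by
  have e : finsuppTensorFinsupp' R α β (z ⊗ₜ y)
      = Finsupp.mapDomain Prod.swap (finsuppTensorFinsupp' R β α (y ⊗ₜ z)) := by
    ext ⟨a, b⟩
    rw [show ((a, b) : α × β) = Prod.swap (b, a) from rfl,
      Finsupp.mapDomain_apply Prod.swap_injective]
    simp [mul_comm]
  rw [e, ← Finsupp.mapDomain_comp]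
  exact tensor_left_vanish y z (Φ ∘ Prod.swap) u (Ψ ∘ Prod.swap) (fun x => h _) hy

theorem joinVertex_blank_left (e : (A × B) ≃ₗ[F] V) {ℓ m a b N : ℕ} (w : Shuffle ℓ m)
    (t : Fin N) (hN : N ≤ ℓ + m) (hl : w.1 ⟨t, by omega⟩ = true)
    (hnext : ∀ h : (t : ℕ) + 1 < ℓ + m, w.1 ⟨t + 1, h⟩ = true)
    (f : Fin a → Submodule F A) (g : Fin b → Submodule F B) (j : Fin a)
    (hj : (j : ℕ) = letterCount w.1 true t) :
    Function.update (fun s : Fin N => joinVertex e w.1 f g (s + 1)) t ⊥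
      = Function.update (fun s : Fin N => joinVertex e w.1 (Function.update f j ⊥) g (s + 1)) t ⊥ := by
  funext s
  by_cases hs : s = t
  · subst hs; simp
  rw [Function.update_of_ne hs, Function.update_of_ne hs]
  unfold joinVertex
  rw [vertex_update f j]
  have ht := t.2
  have hs' := s.2
  have c := letterCount_succ w.1 true (show (t : ℕ) < ℓ + m by omega)
  rw [if_pos hl] at c
  rw [hj]
  have hne : (s : ℕ) ≠ t := fun h => hs (Fin.ext h)
  rcases lt_or_gt_of_ne hne with h | h
  · have := letterCount_mono w.1 true (show (s : ℕ) + 1 ≤ t by omega)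
    omega
  · have c2 := letterCount_succ w.1 true (show (t : ℕ) + 1 < ℓ + m by omega)
    rw [if_pos (hnext (by omega))] at c2
    have := letterCount_mono w.1 true (show (t : ℕ) + 1 + 1 ≤ s + 1 by omega)
    omega

theorem joinVertex_blank_right (e : (A × B) ≃ₗ[F] V) {ℓ m a b N : ℕ} (w : Shuffle ℓ m)
    (t : Fin N) (hN : N ≤ ℓ + m) (hl : w.1 ⟨t, by omega⟩ = false)
    (hnext : ∀ h : (t : ℕ) + 1 < ℓ + m, w.1 ⟨t + 1, h⟩ = false)
    (f : Fin a → Submodule F A) (g : Fin b → Submodule F B) (j : Fin b)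
    (hj : (j : ℕ) = letterCount w.1 false t) :
    Function.update (fun s : Fin N => joinVertex e w.1 f g (s + 1)) t ⊥
      = Function.update (fun s : Fin N => joinVertex e w.1 f (Function.update g j ⊥) (s + 1)) t ⊥ := by
  funext s
  by_cases hs : s = t
  · subst hs; simp
  rw [Function.update_of_ne hs, Function.update_of_ne hs]
  unfold joinVertex
  rw [vertex_update g j]
  have ht := t.2
  have hs' := s.2
  have c := letterCount_succ w.1 false (show (t : ℕ) < ℓ + m by omega)
  rw [if_pos hl] at c
  rw [hj]
  have hne : (s : ℕ) ≠ t := fun h => hs (Fin.ext h)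
  rcases lt_or_gt_of_ne hne with h | h
  · have := letterCount_mono w.1 false (show (s : ℕ) + 1 ≤ t by omega)
    omega
  · have c2 := letterCount_succ w.1 false (show (t : ℕ) + 1 < ℓ + m by omega)
    rw [if_pos (hnext (by omega))] at c2
    have := letterCount_mono w.1 false (show (t : ℕ) + 1 + 1 ≤ s + 1 by omega)
    omega

/-- A term of the blanked join vanishes if the letters on both sides of the blank agree. -/
theorem join_term_vanish {e : (A × B) ≃ₗ[F] V} {ℓ m a b N : ℕ}
    (H : JoinValid e pA pB pV ℓ m a b N) (hN : N ≤ ℓ + m) (ha : ℓ - 1 ≤ a) (hb : m - 1 ≤ b)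
    (hlast : 0 < N → N = ℓ + m → ℓ ≤ a ∧ m ≤ b) {z : Chain R pA a} {y : Chain R pB b}
    (hz : FacesVanish z) (hy : FacesVanish y) (t : Fin N) (w : Shuffle ℓ m)
    (h : ∀ h : (t : ℕ) + 1 < ℓ + m, w.1 ⟨t, by omega⟩ = w.1 ⟨t + 1, h⟩) :
    Finsupp.mapDomain (fun x => Function.update (joinFlag H w x).1 t ⊥)
      (finsuppTensorFinsupp' R (FlagOf pA a) (FlagOf pB b) (z ⊗ₜ y)) = 0 := by
  have ht := t.2
  have c1 := letterCount_add w.1 le_rfl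
  have c2 := w.2
  cases hl : w.1 ⟨t, by omega⟩ with
  | true =>
    have cs := letterCount_succ w.1 true (show (t : ℕ) < ℓ + m by omega)
    rw [if_pos hl] at cs
    have hja : letterCount w.1 true t < a := by
      by_cases h' : (t : ℕ) + 1 < ℓ + m
      · have cs2 := letterCount_succ w.1 true h'
        rw [if_pos ((h h').symm.trans hl)] at cs2
        have := letterCount_mono w.1 true (show (t : ℕ) + 1 + 1 ≤ ℓ + m by omega)
        omega
      · have := hlast (by omega) (by omega)
        have := letterCount_mono w.1 true (show (t : ℕ) + 1 ≤ ℓ + m by omega)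
        omega
    refine tensor_left_vanish z y _
      (fun f : FlagOf pA a => Function.update f.1 ⟨letterCount w.1 true t, hja⟩ ⊥)
      (fun x => Function.update (fun s : Fin N => joinVertex e w.1 x.1 x.2.1 (s + 1)) t ⊥) ?_ (hz _)
    intro x
    exact joinVertex_blank_left e w t hN hl (fun h' => (h h').symm.trans hl) _ _ _ rfl
  | false =>
    have cs := letterCount_succ w.1 false (show (t : ℕ) < ℓ + m by omega)
    rw [if_pos hl] at cs
    have hja : letterCount w.1 false t < b := by
      by_cases h' : (t : ℕ) + 1 < ℓ + m
      · have cs2 := letterCount_succ w.1 false h'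
        rw [if_pos ((h h').symm.trans hl)] at cs2
        have := letterCount_mono w.1 false (show (t : ℕ) + 1 + 1 ≤ ℓ + m by omega)
        omega
      · have := hlast (by omega) (by omega)
        have := letterCount_mono w.1 false (show (t : ℕ) + 1 ≤ ℓ + m by omega)
        omega
    refine tensor_right_vanish z y _
      (fun g : FlagOf pB b => Function.update g.1 ⟨letterCount w.1 false t, hja⟩ ⊥)
      (fun x => Function.update (fun s : Fin N => joinVertex e w.1 x.1.1 x.2 (s + 1)) t ⊥) ?_ (hy _)
    intro x
    exact joinVertex_blank_right e w t hN hl (fun h' => (h h').symm.trans hl) _ _ _ rfl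

theorem facesVanish_joinChain {e : (A × B) ≃ₗ[F] V} {ℓ m a b N : ℕ}
    (H : JoinValid e pA pB pV ℓ m a b N) (hN : N ≤ ℓ + m) (ha : ℓ - 1 ≤ a) (hb : m - 1 ≤ b)
    (hlast : 0 < N → N = ℓ + m → ℓ ≤ a ∧ m ≤ b) {z : Chain R pA a} {y : Chain R pB b}
    (hz : FacesVanish z) (hy : FacesVanish y) : FacesVanish (joinChain R H (z ⊗ₜ y)) := by
  intro t
  have ht := t.2
  change Finsupp.lmapDomain R R _ _ = 0
  simp only [joinChain, LinearMap.comp_apply, LinearMap.sum_apply, LinearMap.smul_apply, map_sum,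
    map_smul]
  set Z := finsuppTensorFinsupp' R (FlagOf pA a) (FlagOf pB b) (z ⊗ₜ y) with hZ
  have e1 : ∀ w : Shuffle ℓ m,
      Finsupp.lmapDomain R R (fun f : FlagOf pV N => Function.update f.1 t ⊥)
        (Finsupp.lmapDomain R R (joinFlag H w) Z)
      = Finsupp.mapDomain (fun x => Function.update (joinFlag H w x).1 t ⊥) Z := by
    intro w
    change Finsupp.mapDomain _ (Finsupp.mapDomain _ Z) = _
    rw [← Finsupp.mapDomain_comp]
    rfl
  change ∑ w : Shuffle ℓ m, w.sign R •
    Finsupp.lmapDomain R R (fun f : FlagOf pV N => Function.update f.1 t ⊥)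
        (Finsupp.lmapDomain R R (joinFlag H w) Z) = 0
  simp only [e1]
  by_cases hlt : (t : ℕ) + 1 < ℓ + m
  · have hsw : ∀ w : Shuffle ℓ m, letterCount (swapLetters hlt w.1) true (ℓ + m) = ℓ := by
      intro w
      rw [letterCount_swapLetters w.1 hlt true (by omega) le_rfl]
      exact w.2
    refine Finset.sum_involution (fun w _ => ⟨swapLetters hlt w.1, hsw w⟩) ?_ ?_ ?_ ?_
    · intro w _
      by_cases hw : w.1 ⟨t, by omega⟩ = w.1 ⟨t + 1, hlt⟩
      · have h0 := join_term_vanish H hN ha hb hlast hz hy t w (fun _ => hw)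
        have h1 : (⟨swapLetters hlt w.1, hsw w⟩ : Shuffle ℓ m) = w :=
          Subtype.ext (swapLetters_eq_self w.1 hlt hw)
        rw [h1, hZ, h0, smul_zero, add_zero]
      · have h1 : Shuffle.sign R (⟨swapLetters hlt w.1, hsw w⟩ : Shuffle ℓ m) = - w.sign R := by
          unfold Shuffle.sign
          rw [prod_swapLetters w.1 hlt (fun i => (-1) ^ (i : ℕ)) (by simp [pow_succ]) true hw]
          ring
        have h2 : (fun x => Function.update
              (joinFlag H (⟨swapLetters hlt w.1, hsw w⟩ : Shuffle ℓ m) x).1 t ⊥)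
            = (fun x => Function.update (joinFlag H w x).1 t ⊥) := by
          funext x
          funext s
          by_cases hs : s = t
          · subst hs; simp
          rw [Function.update_of_ne hs, Function.update_of_ne hs]
          have hne : (s : ℕ) ≠ t := fun h => hs (Fin.ext h)
          have hs' := s.2
          simp only [joinFlag, joinVertex]
          rw [letterCount_swapLetters w.1 hlt true (by omega) (by omega),
            letterCount_swapLetters w.1 hlt false (by omega) (by omega)]
        rw [h1, h2, neg_smul, add_neg_cancel]
    · intro w _ hne heq
      by_cases hw : w.1 ⟨t, by omega⟩ = w.1 ⟨t + 1, hlt⟩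
      · exact hne (by
          rw [hZ, join_term_vanish H hN ha hb hlast hz hy t w (fun _ => hw), smul_zero])
      · exact swapLetters_ne_self w.1 hlt hw (congrArg Subtype.val heq)
    · intro w _; exact Finset.mem_univ _
    · intro w _; exact Subtype.ext (swapLetters_swapLetters w.1 hlt)
  · refine Finset.sum_eq_zero fun w _ => ?_
    rw [hZ, join_term_vanish H hN ha hb hlast hz hy t w (fun h => absurd h hlt), smul_zero]

/-- The linear automorphism of `V = A ⊕ B` that is the identity on `A` and `g` on `B`. -/
def blockHom (e : (A × B) ≃ₗ[F] V) : (B ≃ₗ[F] B) →* (V ≃ₗ[F] V) where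
  toFun g := (e.symm.trans ((LinearEquiv.refl F A).prodCongr g)).trans e
  map_one' := by ext x; simp
  map_mul' g h := by ext x; simp

theorem blockHom_apply (e : (A × B) ≃ₗ[F] V) (g : B ≃ₗ[F] B) (x : A) (y : B) :
    blockHom e g (e (x, y)) = e (x, g y) := by
  simp [blockHom]

theorem det_blockHom [FiniteDimensional F A] [FiniteDimensional F B] (e : (A × B) ≃ₗ[F] V)
    (g : B ≃ₗ[F] B) : LinearEquiv.det (blockHom e g) = LinearEquiv.det g := by
  apply Units.ext
  rw [LinearEquiv.coe_det, LinearEquiv.coe_det]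
  have h : ((blockHom e g : V ≃ₗ[F] V) : V →ₗ[F] V)
      = (e : (A × B) →ₗ[F] V) ∘ₗ (LinearMap.id.prodMap (g : B →ₗ[F] B)) ∘ₗ
        (e.symm : V →ₗ[F] (A × B)) := by
    ext x; rfl
  rw [h, LinearMap.det_conj, LinearMap.det_prodMap, LinearMap.det_id, one_mul]

theorem joinVertex_map (e : (A × B) ≃ₗ[F] V) {n a b : ℕ} (w : Fin n → Bool)
    (f : Fin a → Submodule F A) (g : Fin b → Submodule F B) (γ : B ≃ₗ[F] B) (t : ℕ) :
    joinVertex e w f (fun j => (g j).map (γ : B →ₗ[F] B)) t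
      = (joinVertex e w f g t).map (blockHom e γ : V →ₗ[F] V) := by
  unfold joinVertex
  rw [vertex_map, ← Submodule.map_comp]
  ext v
  simp only [Submodule.mem_map, Submodule.mem_prod]
  constructor
  · rintro ⟨⟨x, y⟩, ⟨hx, y', hy', rfl⟩, rfl⟩
    exact ⟨(x, y'), ⟨hx, hy'⟩, blockHom_apply e γ x y'⟩
  · rintro ⟨⟨x, y⟩, ⟨hx, hy⟩, rfl⟩
    exact ⟨(x, γ y), ⟨hx, y, hy, rfl⟩, (blockHom_apply e γ x y).symm⟩

theorem joinChain_equivariant {e : (A × B) ≃ₗ[F] V} {ℓ m a b N : ℕ}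
    (H : JoinValid e pA pB pV ℓ m a b N) (γ : preserving pB) (δ : preserving pV)
    (hδ : δ.1 = blockHom e γ.1) (z : Chain R pA a) (y : Chain R pB b) :
    joinChain R H (z ⊗ₜ chainRep R pB b γ y) = chainRep R pV N δ (joinChain R H (z ⊗ₜ y)) := by
  have hfl : ∀ (w : Shuffle ℓ m) x,
      joinFlag H w (x.1, FlagOf.map γ x.2) = FlagOf.map δ (joinFlag H w x) := by
    intro w x
    apply Subtype.ext
    funext t
    simp only [joinFlag, FlagOf.map, hδ]
    exact joinVertex_map e w.1 x.1.1 x.2.1 γ.1 _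
  induction z using Finsupp.induction_linear with
  | zero => simp
  | add z z' h1 h2 => rw [TensorProduct.add_tmul, map_add, h1, h2, TensorProduct.add_tmul, map_add,
      map_add]
  | single f r =>
    induction y using Finsupp.induction_linear with
    | zero => simp
    | add y y' h1 h2 => rw [map_add, TensorProduct.tmul_add, map_add, h1, h2, TensorProduct.tmul_add,
        map_add, map_add]
    | single g s =>
      have e1 : chainRep R pB b γ (Finsupp.single g s) = Finsupp.single (FlagOf.map γ g) s :=
        Finsupp.mapDomain_single
      rw [e1]
      simp only [joinChain, LinearMap.comp_apply, LinearEquiv.coe_coe,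
        finsuppTensorFinsupp'_single_tmul_single, LinearMap.sum_apply, LinearMap.smul_apply,
        Finsupp.lmapDomain_apply, Finsupp.mapDomain_single, map_sum, map_smul]
      refine Finset.sum_congr rfl fun w _ => ?_
      congr 1
      rw [hfl w (f, g)]
      exact Finsupp.mapDomain_single.symm

end Join

section Hyperbolic

variable {F : Type u} [Field F] {ℓ : ℕ}

/-- The annihilator of a subspace under the standard pairing. -/
def annihilator (X : Submodule F (Fin ℓ → F)) : Submodule F (Fin ℓ → F) where
  carrier := {b | ∀ x ∈ X, x ⬝ᵥ b = 0}
  zero_mem' x _ := dotProduct_zero x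
  add_mem' {a b} ha hb x hx := by rw [dotProduct_add, ha x hx, hb x hx, add_zero]
  smul_mem' c b hb x hx := by rw [dotProduct_smul, hb x hx, smul_zero]

theorem mem_annihilator {X : Submodule F (Fin ℓ → F)} {b : Fin ℓ → F} :
    b ∈ annihilator X ↔ ∀ x ∈ X, x ⬝ᵥ b = 0 := Iff.rfl

theorem finrank_annihilator (X : Submodule F (Fin ℓ → F)) :
    Module.finrank F X + Module.finrank F (annihilator X) = ℓ := by
  let B : LinearMap.BilinForm F (Fin ℓ → F) := dotProductBilin F F
  have h1 : B.IsRefl := fun x y h => by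
    change y ⬝ᵥ x = 0
    rw [dotProduct_comm]; exact h
  have h2 : B.orthogonal X = annihilator X := rfl
  have h3 := LinearMap.BilinForm.finrank_add_finrank_orthogonal h1 X
  have h4 : B.orthogonal ⊤ = ⊥ := by
    rw [eq_bot_iff]
    intro x hx
    rw [Submodule.mem_bot]
    funext i
    have : Pi.single i (1 : F) ⬝ᵥ x = 0 := hx (Pi.single i 1) trivial
    simpa using this
  rw [h2, h4, inf_bot_eq, finrank_bot, add_zero, Module.finrank_fin_fun] at h3
  exact h3

theorem annihilator_anti {X Y : Submodule F (Fin ℓ → F)} (h : X ≤ Y) :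
    annihilator Y ≤ annihilator X := fun _ hb x hx => hb x (h hx)

theorem annihilator_strictAnti {X Y : Submodule F (Fin ℓ → F)} (h : X < Y) :
    annihilator Y < annihilator X := by
  refine lt_of_le_of_ne (annihilator_anti h.le) fun he => ?_
  have h1 := finrank_annihilator X
  have h2 := finrank_annihilator Y
  rw [he] at h2
  have := Submodule.finrank_lt_finrank_of_lt h
  omega

/-- Nonzero subspaces of `F^ℓ ⊕ F^ℓ` that are totally isotropic for the standard pairing between
the two summands. -/
def IsNull (W : Submodule F ((Fin ℓ → F) × (Fin ℓ → F))) : Prop :=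
  W ≠ ⊥ ∧ ∀ x ∈ W, ∀ y ∈ W, x.1 ⬝ᵥ y.2 = 0

/-- Position `t` of the isotropic flag in `F^ℓ ⊕ F^ℓ` obtained from a flag in the first summand
`F^ℓ` and a word in two letters.  The letter `true` stands for a step of the flag taken from its
beginning, in the first summand; the letter `false` for a step taken from its end, passing to the
annihilator in the second summand. -/
def hypVertex {n a : ℕ} (w : Fin n → Bool) (f : Fin a → Submodule F (Fin ℓ → F)) (t : ℕ) :
    Submodule F ((Fin ℓ → F) × (Fin ℓ → F)) :=
  (vertex f (letterCount w true t)).prod (annihilator (vertex f (ℓ - letterCount w false t)))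

/-- The sign attached to a word in the suspension: the sign, in the group of signed permutations of
`{1, …, ℓ}`, of the rearrangement described by the word. -/
def hypSign (R : Type u) [CommRing R] (w : Fin ℓ → Bool) : R :=
  ∏ i : Fin ℓ, if w i = false then (-1) ^ (ℓ - (i : ℕ)) else 1

theorem vertex_zero {V : Type u} [AddCommGroup V] [Module F V] {k : ℕ}
    (f : Fin k → Submodule F V) : vertex f 0 = ⊥ := by simp [vertex]

theorem vertex_le_of_proper (f : FlagOf (IsProper : Submodule F (Fin ℓ → F) → Prop) (ℓ - 1))
    {i j : ℕ} (hij : i ≤ j) (hj : j ≤ ℓ) : vertex f.1 i ≤ vertex f.1 j := by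
  rcases hij.lt_or_eq with h | rfl
  · exact (vertex_strict_of_proper f h hj).le
  · exact le_rfl

theorem hypVertex_strict (w : Fin ℓ → Bool)
    (f : FlagOf (IsProper : Submodule F (Fin ℓ → F) → Prop) (ℓ - 1)) {s t : ℕ} (hst : s < t)
    (ht : t ≤ ℓ) : hypVertex w f.1 s < hypVertex w f.1 t := by
  have c1 := letterCount_add w ht
  have c2 := letterCount_add w (show s ≤ ℓ by omega)
  have m1 := letterCount_mono w true hst.le
  have m2 := letterCount_mono w false hst.le
  refine prod_lt (vertex_le_of_proper f m1 (by omega))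
    (annihilator_anti (vertex_le_of_proper f (by omega) (by omega))) ?_
  by_cases h : letterCount w true s < letterCount w true t
  · exact Or.inl (vertex_strict_of_proper f h (by omega))
  · exact Or.inr (annihilator_strictAnti (vertex_strict_of_proper f (by omega) (by omega)))

theorem hypVertex_null (w : Fin ℓ → Bool)
    (f : FlagOf (IsProper : Submodule F (Fin ℓ → F) → Prop) (ℓ - 1)) {t : ℕ} (ht : t < ℓ) :
    IsNull (hypVertex w f.1 (t + 1)) := by
  refine ⟨?_, ?_⟩
  · have := hypVertex_strict w f (show 0 < t + 1 by omega) (show t + 1 ≤ ℓ by omega)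
    exact (bot_le.trans_lt this).ne'
  · intro x hx y hy
    have c1 := letterCount_add w (show t + 1 ≤ ℓ by omega)
    exact hy.2 x.1 (vertex_le_of_proper f (by omega) (by omega) hx.1)

/-- The isotropic flag attached to a flag and a word. -/
def hypFlag (w : Fin ℓ → Bool)
    (f : FlagOf (IsProper : Submodule F (Fin ℓ → F) → Prop) (ℓ - 1)) :
    FlagOf (IsNull : Submodule F ((Fin ℓ → F) × (Fin ℓ → F)) → Prop) ℓ :=
  ⟨fun t => hypVertex w f.1 (t + 1),
    fun s t h => hypVertex_strict w f (by have : (s : ℕ) < t := h; omega) (by omega),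
    fun t => hypVertex_null w f t.2⟩

/-- The suspension: it takes the apartment class of a basis `v₁, …, v_ℓ` of `F^ℓ` to the apartment
class of the hyperbolic basis of `F^ℓ ⊕ F^ℓ` consisting of `v₁, …, v_ℓ` and its dual basis. -/
noncomputable def hypChain (F : Type u) [Field F] (R : Type u) [CommRing R] (ℓ : ℕ) :
    Chain R (IsProper : Submodule F (Fin ℓ → F) → Prop) (ℓ - 1) →ₗ[R]
      Chain R (IsNull : Submodule F ((Fin ℓ → F) × (Fin ℓ → F)) → Prop) ℓ :=
  ∑ w : Fin ℓ → Bool, hypSign R w • Finsupp.lmapDomain R R (hypFlag w)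

variable {R : Type u} [CommRing R]

theorem hyp_term_vanish
    {z : Chain R (IsProper : Submodule F (Fin ℓ → F) → Prop) (ℓ - 1)} (hz : FacesVanish z)
    (t : Fin ℓ) (w : Fin ℓ → Bool) (hlt : (t : ℕ) + 1 < ℓ)
    (h : w ⟨t, by omega⟩ = w ⟨t + 1, hlt⟩) :
    Finsupp.mapDomain (fun f => Function.update (hypFlag w f).1 t ⊥) z = 0 := by
  have c1 := letterCount_add w le_rfl
  have ct := letterCount_add w hlt.le
  have ct' := letterCount_add w (show (t : ℕ) + 1 + 1 ≤ ℓ from hlt)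
  have key : ∃ j : Fin (ℓ - 1), ∀ s : Fin ℓ, s ≠ t →
      letterCount w true (s + 1) ≠ j + 1 ∧ ℓ - letterCount w false (s + 1) ≠ j + 1 := by
    cases hl : w ⟨t, by omega⟩ with
    | true =>
      have a1 := letterCount_succ w true (show (t : ℕ) < ℓ by omega)
      rw [if_pos hl] at a1
      have a2 := letterCount_succ w true hlt
      rw [if_pos (h.symm.trans hl)] at a2
      have a3 := letterCount_mono w true (show (t : ℕ) + 1 + 1 ≤ ℓ from hlt)
      refine ⟨⟨letterCount w true t, by omega⟩, fun s hs => ?_⟩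
      have hne : (s : ℕ) ≠ t := fun h => hs (Fin.ext h)
      have hs' := s.2
      have a4 := letterCount_mono w false (show (s : ℕ) + 1 ≤ ℓ by omega)
      constructor
      · rcases lt_or_gt_of_ne hne with h | h
        · have := letterCount_mono w true (show (s : ℕ) + 1 ≤ t by omega)
          simp only; omega
        · have := letterCount_mono w true (show (t : ℕ) + 1 + 1 ≤ s + 1 by omega)
          simp only; omega
      · simp only; omega
    | false =>
      have a1 := letterCount_succ w false (show (t : ℕ) < ℓ by omega)
      rw [if_pos hl] at a1
      have a2 := letterCount_succ w false hlt
      rw [if_pos (h.symm.trans hl)] at a2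
      have a3 := letterCount_mono w false (show (t : ℕ) + 1 + 1 ≤ ℓ from hlt)
      refine ⟨⟨ℓ - letterCount w false (t + 1) - 1, by omega⟩, fun s hs => ?_⟩
      have hne : (s : ℕ) ≠ t := fun h => hs (Fin.ext h)
      have hs' := s.2
      have a4 := letterCount_mono w true (show (s : ℕ) + 1 ≤ ℓ by omega)
      have a5 := letterCount_mono w false (show (s : ℕ) + 1 ≤ ℓ by omega)
      constructor
      · simp only; omega
      · rcases lt_or_gt_of_ne hne with h | h
        · have := letterCount_mono w false (show (s : ℕ) + 1 ≤ t by omega)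
          simp only; omega
        · have := letterCount_mono w false (show (t : ℕ) + 1 + 1 ≤ s + 1 by omega)
          simp only; omega
  obtain ⟨j, hj⟩ := key
  have e : (fun f : FlagOf (IsProper : Submodule F (Fin ℓ → F) → Prop) (ℓ - 1) =>
        Function.update (hypFlag w f).1 t ⊥)
      = (fun f => Function.update (fun s : Fin ℓ => hypVertex w f (s + 1)) t ⊥) ∘
        (fun f => Function.update f.1 j ⊥) := by
    funext f
    funext s
    by_cases hs : s = t
    · subst hs; simp
    simp only [Function.comp]
    rw [Function.update_of_ne hs, Function.update_of_ne hs]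
    simp only [hypFlag, hypVertex]
    rw [vertex_update _ j (hj s hs).1, vertex_update _ j (hj s hs).2]
  rw [e, Finsupp.mapDomain_comp, hz j, Finsupp.mapDomain_zero]

theorem facesVanish_hypChain
    {z : Chain R (IsProper : Submodule F (Fin ℓ → F) → Prop) (ℓ - 1)} (hz : FacesVanish z) :
    FacesVanish (hypChain F R ℓ z) := by
  intro t
  have ht := t.2
  have e0 : Finsupp.mapDomain (fun f : FlagOf IsNull ℓ => Function.update f.1 t ⊥)
        (hypChain F R ℓ z)
      = ∑ w : Fin ℓ → Bool, hypSign R w •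
        Finsupp.mapDomain (fun f => Function.update (hypFlag w f).1 t ⊥) z := by
    change Finsupp.lmapDomain R R _ _ = _
    simp only [hypChain, LinearMap.sum_apply, LinearMap.smul_apply, map_sum, map_smul]
    refine Finset.sum_congr rfl fun w _ => ?_
    congr 1
    change Finsupp.mapDomain _ (Finsupp.mapDomain _ z) = _
    rw [← Finsupp.mapDomain_comp]
    rfl
  rw [e0]
  by_cases hlt : (t : ℕ) + 1 < ℓ
  · refine Finset.sum_involution (fun w _ => swapLetters hlt w) ?_ ?_ ?_ ?_
    · intro w _
      by_cases hw : w ⟨t, by omega⟩ = w ⟨t + 1, hlt⟩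
      · rw [swapLetters_eq_self w hlt hw, hyp_term_vanish hz t w hlt hw, smul_zero, add_zero]
      · have h1 : hypSign R (swapLetters hlt w) = - hypSign R w := by
          unfold hypSign
          refine prod_swapLetters w hlt (fun i => (-1) ^ (ℓ - (i : ℕ))) ?_ false hw
          change (-1 : R) ^ (ℓ - ((t : ℕ) + 1)) = -(-1) ^ (ℓ - (t : ℕ))
          rw [show ℓ - (t : ℕ) = (ℓ - ((t : ℕ) + 1)) + 1 by omega, pow_succ]
          ring
        have h2 : (fun f : FlagOf (IsProper : Submodule F (Fin ℓ → F) → Prop) (ℓ - 1) =>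
              Function.update (hypFlag (swapLetters hlt w) f).1 t ⊥)
            = (fun f => Function.update (hypFlag w f).1 t ⊥) := by
          funext f
          funext s
          by_cases hs : s = t
          · subst hs; simp
          rw [Function.update_of_ne hs, Function.update_of_ne hs]
          have hne : (s : ℕ) ≠ t := fun h => hs (Fin.ext h)
          have hs' := s.2
          simp only [hypFlag, hypVertex]
          rw [letterCount_swapLetters w hlt true (by omega) (by omega),
            letterCount_swapLetters w hlt false (by omega) (by omega)]
        rw [h1, h2, neg_smul, add_neg_cancel]
    · intro w _ hne heq
      by_cases hw : w ⟨t, by omega⟩ = w ⟨t + 1, hlt⟩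
      · exact hne (by rw [hyp_term_vanish hz t w hlt hw, smul_zero])
      · exact swapLetters_ne_self w hlt hw heq
    · intro w _; exact Finset.mem_univ _
    · intro w _; exact swapLetters_swapLetters w hlt
  · have hflip : ∀ w : Fin ℓ → Bool,
        hypSign R (Function.update w t (!w t)) = - hypSign R w := by
      intro w
      have hp : ((-1 : R) ^ (ℓ - (t : ℕ))) = -1 := by
        rw [show ℓ - (t : ℕ) = 1 by omega, pow_one]
      unfold hypSign
      rw [← Finset.mul_prod_erase _ _ (Finset.mem_univ t),
        ← Finset.mul_prod_erase (a := t) Finset.univ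
          (fun i : Fin ℓ => if w i = false then (-1 : R) ^ (ℓ - (i : ℕ)) else 1)
          (Finset.mem_univ t)]
      have e1 : ∏ x ∈ Finset.univ.erase t,
            (if Function.update w t (!w t) x = false then (-1 : R) ^ (ℓ - (x : ℕ)) else 1)
          = ∏ x ∈ Finset.univ.erase t, (if w x = false then (-1 : R) ^ (ℓ - (x : ℕ)) else 1) := by
        refine Finset.prod_congr rfl fun x hx => ?_
        rw [Function.update_of_ne (Finset.ne_of_mem_erase hx)]
      rw [e1, hp, Function.update_self]
      cases w t <;> simp
    refine Finset.sum_involution (fun w _ => Function.update w t (!w t)) ?_ ?_ ?_ ?_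
    · intro w _
      have h2 : (fun f : FlagOf (IsProper : Submodule F (Fin ℓ → F) → Prop) (ℓ - 1) =>
            Function.update (hypFlag (Function.update w t (!w t)) f).1 t ⊥)
          = (fun f => Function.update (hypFlag w f).1 t ⊥) := by
        funext f
        funext s
        by_cases hs : s = t
        · subst hs; simp
        rw [Function.update_of_ne hs, Function.update_of_ne hs]
        have hne : (s : ℕ) ≠ t := fun h => hs (Fin.ext h)
        have hs' := s.2
        have hc : ∀ b, letterCount (Function.update w t (!w t)) b (s + 1)
            = letterCount w b (s + 1) := by
          intro b
          apply letterCount_congr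
          intro i hi
          rw [Function.update_of_ne]
          rintro rfl
          omega
        simp only [hypFlag, hypVertex, hc]
      rw [hflip, h2, neg_smul, add_neg_cancel]
    · intro w _ _ heq
      have := congrFun heq t
      rw [Function.update_self] at this
      cases hw : w t <;> simp [hw] at this
    · intro w _; exact Finset.mem_univ _
    · intro w _
      funext s
      by_cases hs : s = t
      · subst hs; simp
      · simp [Function.update_of_ne hs]

end Hyperbolic

/-! ### General and special linear groups -/

/-- The families `GL_n` and `SL_n`. -/
inductive LinearFamily
  | general
  | special

namespace LinearFamily

variable (X : LinearFamily) (F R : Type u) [Field F] [CommRing R] (ℓ m n : ℕ)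

/-- `GL_n(F)` or `SL_n(F)`, acting on `F^n`. -/
noncomputable def group : Subgroup ((Fin n → F) ≃ₗ[F] (Fin n → F)) :=
  match X with
  | general => ⊤
  | special => (LinearEquiv.det : ((Fin n → F) ≃ₗ[F] (Fin n → F)) →* Fˣ).ker

/-- The stabilizer of the first `ℓ` standard basis vectors `a_j`. -/
def stab : Subgroup (X.group F n) where
  carrier := {g | ∀ j : Fin n, (j : ℕ) < ℓ → g.1 (Pi.single j 1) = Pi.single j 1}
  one_mem' _ _ := rfl
  mul_mem' {g h} hg hh j hj := by
    change g.1 (h.1 _) = _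
    rw [hh j hj, hg j hj]
  inv_mem' {g} hg j hj := by
    change g.1.symm _ = _
    rw [LinearEquiv.symm_apply_eq, hg j hj]

theorem group_le_preserving : X.group F n ≤ preserving IsProper := by
  intro g _ W
  have h1 : W.map (g : (Fin n → F) →ₗ[F] (Fin n → F)) = ⊥ ↔ W = ⊥ := by
    exact Submodule.map_eq_bot_iff (p := W) (e := g)
  have h2 : W.map (g : (Fin n → F) →ₗ[F] (Fin n → F)) = ⊤ ↔ W = ⊤ := by
    constructor
    · intro h
      apply Submodule.map_injective_of_injective g.injective
      rw [h, Submodule.map_top]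
      exact (LinearEquiv.range g).symm
    · rintro rfl
      rw [Submodule.map_top]
      exact LinearEquiv.range g
  change (_ ≠ _ ∧ _ ≠ _) ↔ (_ ≠ _ ∧ _ ≠ _)
  rw [ne_eq, ne_eq, h1, h2]

/-- The Steinberg module: the reduced homology in degree `n - 2` of the Tits building, the
complex of flags of nonzero proper subspaces of `F^n`.  As the building has dimension `n - 2`, this
is the module of reduced `(n - 2)`-cycles.  For `n ≤ 1` the building is empty and this is `R`. -/
abbrev SteinbergModule : Type u :=
  cycles R (IsProper : Submodule F (Fin n → F) → Prop) (n - 1)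

/-- The action of `GL_n(F)` or `SL_n(F)` on the Steinberg module. -/
noncomputable def steinbergAction :
    Representation R (X.group F n) (SteinbergModule F R n) :=
  (cycleRep R (IsProper : Submodule F (Fin n → F) → Prop) (n - 1)).comp
    (Subgroup.inclusion (X.group_le_preserving F n))

/-- The Steinberg representation of `GL_n(F)` or `SL_n(F)`. -/
noncomputable def steinberg : Rep.{u} R (X.group F n) :=
  Rep.of (X := SteinbergModule F R n) (X.steinbergAction F R n)

theorem finrank_le_of_isProper (W : Submodule F (Fin n → F)) (hW : IsProper W) :
    Module.finrank F W ≤ n - 1 := by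
  have := Submodule.finrank_lt hW.2
  rw [Module.finrank_fin_fun] at this
  omega

/-- The decomposition `F^(ℓ+m) = F^ℓ ⊕ F^m`. -/
def split : ((Fin ℓ → F) × (Fin m → F)) ≃ₗ[F] (Fin (ℓ + m) → F) :=
  { Fin.appendEquiv ℓ m with
    map_add' := fun x y => by
      funext i
      refine Fin.addCases (fun i => ?_) (fun i => ?_) i <;> simp [Fin.appendEquiv]
    map_smul' := fun c x => by
      funext i
      refine Fin.addCases (fun i => ?_) (fun i => ?_) i <;> simp [Fin.appendEquiv] }

theorem split_apply (x : Fin ℓ → F) (y : Fin m → F) : split F ℓ m (x, y) = Fin.append x y := rfl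

theorem joinVertex_zero {A B V : Type u} [AddCommGroup A] [Module F A]
    [AddCommGroup B] [Module F B] [AddCommGroup V] [Module F V] (e : (A × B) ≃ₗ[F] V) {n a b : ℕ}
    (w : Fin n → Bool) (f : Fin a → Submodule F A) (g : Fin b → Submodule F B) :
    joinVertex e w f g 0 = ⊥ := by
  simp [joinVertex, letterCount_zero, vertex_zero]

theorem joinValid : JoinValid (split F ℓ m) IsProper IsProper IsProper ℓ m (ℓ - 1) (m - 1)
    (ℓ + m - 1) := by
  intro w f g
  have hs : ∀ {s t : ℕ}, s < t → t ≤ ℓ + m →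
      joinVertex (split F ℓ m) w.1 f.1 g.1 s < joinVertex (split F ℓ m) w.1 f.1 g.1 t :=
    fun h1 h2 => joinVertex_strict _ w (fun _ _ => vertex_strict_of_proper f)
      (fun _ _ => vertex_strict_of_proper g) h1 h2
  refine ⟨fun s t h => hs (by have : (s : ℕ) < t := h; omega) (by have := t.2; omega), fun t => ?_⟩
  have ht := t.2
  exact ⟨(bot_le.trans_lt (hs (show 0 < (t : ℕ) + 1 by omega) (by omega))).ne',
    ((hs (show (t : ℕ) + 1 < ℓ + m by omega) le_rfl).trans_le le_top).ne⟩

/-- The Reeder product map `St_{GL_ℓ} ⊗ St_{GL_m} → St_{GL_(ℓ+m)}` (and likewise for `SL`).  A pair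
of flags is taken to the signed sum over all shuffles of its steps; equivalently, the apartment
classes of a basis `v` of `F^ℓ` and a basis `w` of `F^m` are taken to the apartment class of the
basis `v, w` of `F^ℓ ⊕ F^m`. -/
noncomputable def reederProduct :
    SteinbergModule F R ℓ ⊗[R] SteinbergModule F R m →ₗ[R] SteinbergModule F R (ℓ + m) :=
  LinearMap.codRestrict (cycles R (IsProper : Submodule F (Fin (ℓ + m) → F) → Prop) (ℓ + m - 1))
    (joinChain R (joinValid F ℓ m) ∘ₗ
      TensorProduct.map (cycles R (IsProper : Submodule F (Fin ℓ → F) → Prop) (ℓ - 1)).subtype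
        (cycles R (IsProper : Submodule F (Fin m → F) → Prop) (m - 1)).subtype) (by
    intro x
    induction x using TensorProduct.induction_on with
    | zero => rw [map_zero]; exact Submodule.zero_mem _
    | add x y hx hy => rw [map_add]; exact Submodule.add_mem _ hx hy
    | tmul z y =>
      exact mem_cycles_of_facesVanish (facesVanish_joinChain _ (Nat.sub_le _ _) le_rfl le_rfl
        (fun h0 h => by omega)
        (facesVanish_of_mem_cycles (fun _ h => h.1) (finrank_le_of_isProper F ℓ) z.2)
        (facesVanish_of_mem_cycles (fun _ h => h.1) (finrank_le_of_isProper F m) y.2)))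

theorem blockHom_mem_group (g : X.group F m) : blockHom (split F ℓ m) g.1 ∈ X.group F (ℓ + m) := by
  cases X with
  | general => trivial
  | special =>
    have h : LinearEquiv.det g.1 = 1 := g.2
    change LinearEquiv.det _ = 1
    rw [det_blockHom, h]

/-- The inclusion of `1 × G_m` into the stabilizer of `a_1, …, a_ℓ` in `G_(ℓ+m)`. -/
def inclusion : X.group F m →* X.stab F ℓ (ℓ + m) where
  toFun g := ⟨⟨blockHom (split F ℓ m) g.1, X.blockHom_mem_group F ℓ m g⟩, by
    intro j hj
    have : (Pi.single j 1 : Fin (ℓ + m) → F) = split F ℓ m (Pi.single ⟨j, hj⟩ 1, 0) := by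
      rw [split_apply]
      funext i
      refine Fin.addCases (fun i => ?_) (fun i => ?_) i
      · rw [Fin.append_left]
        simp [Pi.single_apply, Fin.ext_iff]
      · rw [Fin.append_right, Pi.zero_apply, Pi.single_eq_of_ne]
        intro h
        have := congrArg Fin.val h
        simp at this
        omega
    change blockHom (split F ℓ m) g.1 (Pi.single j 1) = _
    rw [this, blockHom_apply, map_zero]⟩
  map_one' := by
    apply Subtype.ext; apply Subtype.ext
    exact map_one (blockHom (split F ℓ m))
  map_mul' g h := by
    apply Subtype.ext; apply Subtype.ext
    exact map_mul (blockHom (split F ℓ m)) g.1 h.1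

/-- The action of `1 × G_m` on `St_{GL_ℓ} ⊗ St_{G_m}`: trivial on the first factor. -/
noncomputable def tensorAction :
    Representation R (X.group F m) (SteinbergModule F R ℓ ⊗[R] SteinbergModule F R m) :=
  (Representation.trivial R (X.group F m) (SteinbergModule F R ℓ)).tprod (X.steinbergAction F R m)

/-- `St_{GL_ℓ} ⊗ St_{G_m}` as a representation of `1 × G_m`. -/
noncomputable def tensorRep : Rep.{u} R (X.group F m) :=
  Rep.of (X := SteinbergModule F R ℓ ⊗[R] SteinbergModule F R m) (X.tensorAction F R ℓ m)

/-- The restriction of `St_{G_n}` to the stabilizer of `a_1, …, a_ℓ`. -/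
noncomputable def stabRep : Rep.{u} R (X.stab F ℓ n) :=
  Rep.res (X.stab F ℓ n).subtype (X.steinberg F R n)

theorem reederProduct_equivariant (g : X.group F m)
    (x : SteinbergModule F R ℓ ⊗[R] SteinbergModule F R m) :
    reederProduct F R ℓ m (X.tensorAction F R ℓ m g x)
      = X.steinbergAction F R (ℓ + m) (X.inclusion F ℓ m g).1 (reederProduct F R ℓ m x) := by
  induction x using TensorProduct.induction_on with
  | zero => simp only [map_zero]
  | add x y hx hy => simp only [map_add, hx, hy]
  | tmul z y =>
    apply Subtype.ext
    exact joinChain_equivariant (joinValid F ℓ m)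
      (Subgroup.inclusion (X.group_le_preserving F m) g)
      (Subgroup.inclusion (X.group_le_preserving F (ℓ + m)) (X.inclusion F ℓ m g).1) rfl
      z.1 y.1

/-- The Reeder product map as a map of representations of `1 × G_m`. -/
noncomputable def reederHom :
    X.tensorRep F R ℓ m ⟶ Rep.res (X.inclusion F ℓ m) (X.stabRep F R ℓ (ℓ + m)) :=
  Rep.ofHom (LinearMap.intertwiningMap_of_isIntertwiningMap _ _ (reederProduct F R ℓ m)
    (X.reederProduct_equivariant F R ℓ m))

/-- The map `H_i(1 × G_m; St_{GL_ℓ} ⊗ St_{G_m}) → H_i(Stab; St_{G_(ℓ+m)})` induced by the inclusion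
of groups and the Reeder product map. -/
noncomputable def homologyMap (i : ℕ) :
    groupHomology (X.tensorRep F R ℓ m) i ⟶ groupHomology (X.stabRep F R ℓ (ℓ + m)) i :=
  groupHomology.map (X.inclusion F ℓ m) (X.reederHom F R ℓ m) i

end LinearFamily

/-! ### Symplectic and orthogonal groups -/

/-- The families `Sp_{2n}`, `SO_{n,n}` and `SO_{n,n+1}`. -/
inductive IsotropicFamily
  | symplectic
  | evenOrthogonal
  | oddOrthogonal

namespace IsotropicFamily

variable (X : IsotropicFamily) (F R : Type u) [Field F] [CommRing R] (ℓ m n : ℕ)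

/-- The number of basis vectors besides the `a_j` and `b_j`: one, called `e`, for `SO_{n,n+1}`, and
none otherwise. -/
def extra : ℕ :=
  match X with
  | symplectic => 0
  | evenOrthogonal => 0
  | oddOrthogonal => 1

/-- The space on which the group acts: a vector is given by its coordinates with respect to the
`a_j`, with respect to the `b_j`, and with respect to `e` (if present). -/
abbrev Space : Type u := (Fin n → F) × (Fin n → F) × (Fin X.extra → F)

variable {X F n} in
/-- The form with `ω(a_i, b_j) = δ_ij = -ω(b_j, a_i)`, the other products being zero. -/
def symplecticForm (x y : X.Space F n) : F := x.1 ⬝ᵥ y.2.1 - x.2.1 ⬝ᵥ y.1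

variable {X F n} in
/-- The quadratic form `∑ c_j d_j`, plus `λ²` if `e` is present. -/
def quadraticForm (x : X.Space F n) : F := x.1 ⬝ᵥ x.2.1 + x.2.2 ⬝ᵥ x.2.2

/-- The linear automorphisms preserving the symplectic form. -/
def symplecticGroup : Subgroup (X.Space F n ≃ₗ[F] X.Space F n) where
  carrier := {g | ∀ x y, symplecticForm (g x) (g y) = symplecticForm x y}
  one_mem' _ _ := rfl
  mul_mem' {g h} hg hh x y := (hg (h x) (h y)).trans (hh x y)
  inv_mem' {g} hg x y := by
    rw [← hg]
    change symplecticForm (g (g.symm x)) (g (g.symm y)) = _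
    rw [g.apply_symm_apply, g.apply_symm_apply]

/-- The linear automorphisms of determinant `1` preserving the quadratic form. -/
def specialOrthogonalGroup : Subgroup (X.Space F n ≃ₗ[F] X.Space F n) where
  carrier := {g | LinearEquiv.det g = 1 ∧ ∀ x, quadraticForm (g x) = quadraticForm x}
  one_mem' := ⟨map_one _, fun _ => rfl⟩
  mul_mem' {g h} hg hh := ⟨by rw [map_mul, hg.1, hh.1, one_mul],
    fun x => (hg.2 (h x)).trans (hh.2 x)⟩
  inv_mem' {g} hg := ⟨by rw [map_inv, hg.1, inv_one], fun x => by
    rw [← hg.2]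
    change quadraticForm (g (g.symm x)) = _
    rw [g.apply_symm_apply]⟩

/-- `Sp_{2n}(F)`, `SO_{n,n}(F)` or `SO_{n,n+1}(F)`. -/
def group : Subgroup (X.Space F n ≃ₗ[F] X.Space F n) :=
  match X with
  | symplectic => symplecticGroup symplectic F n
  | evenOrthogonal => specialOrthogonalGroup evenOrthogonal F n
  | oddOrthogonal => specialOrthogonalGroup oddOrthogonal F n

/-- The stabilizer of `a_1, …, a_ℓ`. -/
def stab : Subgroup (X.group F n) where
  carrier := {g | ∀ j : Fin n, (j : ℕ) < ℓ →
    g.1 (Pi.single j 1, 0, 0) = ((Pi.single j 1, 0, 0) : X.Space F n)}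
  one_mem' _ _ := rfl
  mul_mem' {g h} hg hh j hj := by
    change g.1 (h.1 _) = _
    rw [hh j hj, hg j hj]
  inv_mem' {g} hg j hj := by
    change g.1.symm _ = _
    rw [LinearEquiv.symm_apply_eq, hg j hj]

variable {X F n} in
/-- Isotropic subspaces: those on which the symplectic, respectively quadratic, form vanishes. -/
def Isotropic (W : Submodule F (X.Space F n)) : Prop :=
  match X with
  | symplectic => ∀ x ∈ W, ∀ y ∈ W, symplecticForm (X := symplectic) (n := n) x y = 0
  | evenOrthogonal => ∀ x ∈ W, quadraticForm (X := evenOrthogonal) (n := n) x = 0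
  | oddOrthogonal => ∀ x ∈ W, quadraticForm (X := oddOrthogonal) (n := n) x = 0

variable {X F n} in
/-- Nonzero isotropic subspaces. -/
def IsNonzeroIsotropic (W : Submodule F (X.Space F n)) : Prop := W ≠ ⊥ ∧ Isotropic W

variable {X F n} in
theorem isotropic_map_iff (g : X.group F n) (W : Submodule F (X.Space F n)) :
    Isotropic (W.map (g.1 : X.Space F n →ₗ[F] X.Space F n)) ↔ Isotropic W := by
  cases X with
  | symplectic =>
    constructor
    · intro h x hx y hy
      rw [← g.2 x y]
      exact h _ ⟨x, hx, rfl⟩ _ ⟨y, hy, rfl⟩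
    · rintro h _ ⟨x, hx, rfl⟩ _ ⟨y, hy, rfl⟩
      exact (g.2 x y).trans (h x hx y hy)
  | evenOrthogonal =>
    constructor
    · intro h x hx
      rw [← g.2.2 x]
      exact h _ ⟨x, hx, rfl⟩
    · rintro h _ ⟨x, hx, rfl⟩
      exact (g.2.2 x).trans (h x hx)
  | oddOrthogonal =>
    constructor
    · intro h x hx
      rw [← g.2.2 x]
      exact h _ ⟨x, hx, rfl⟩
    · rintro h _ ⟨x, hx, rfl⟩
      exact (g.2.2 x).trans (h x hx)

theorem group_le_preserving : X.group F n ≤ preserving IsNonzeroIsotropic := by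
  intro g hg W
  have h1 : W.map (g : X.Space F n →ₗ[F] X.Space F n) = ⊥ ↔ W = ⊥ := by
    exact Submodule.map_eq_bot_iff (p := W) (e := g)
  change (_ ≠ _ ∧ _) ↔ (_ ≠ _ ∧ _)
  rw [ne_eq, h1, isotropic_map_iff ⟨g, hg⟩ W]

/-- The Steinberg module: the reduced homology in degree `n - 1` of the Tits building, the
complex of flags of nonzero isotropic subspaces.  As the building has dimension `n - 1`, this is the
module of reduced `(n - 1)`-cycles.  For `n = 0` the building is empty and this is `R`. -/
abbrev SteinbergModule : Type u :=
  cycles R (IsNonzeroIsotropic : Submodule F (X.Space F n) → Prop) n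

/-- The action of the group on the Steinberg module. -/
noncomputable def steinbergAction :
    Representation R (X.group F n) (X.SteinbergModule F R n) :=
  (cycleRep R (IsNonzeroIsotropic : Submodule F (X.Space F n) → Prop) n).comp
    (Subgroup.inclusion (X.group_le_preserving F n))

/-- The Steinberg representation of `Sp_{2n}(F)`, `SO_{n,n}(F)` or `SO_{n,n+1}(F)`. -/
noncomputable def steinberg : Rep.{u} R (X.group F n) :=
  Rep.of (X := X.SteinbergModule F R n) (X.steinbergAction F R n)

variable {X F n} in
theorem Isotropic.properties {W : Submodule F (X.Space F n)} (hW : Isotropic W)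
    {x : X.Space F n} (hx : x ∈ W) (h0 : x.2.1 = 0) :
    x.2.2 = 0 ∧ ∀ y ∈ W, x.1 ⬝ᵥ y.2.1 = 0 := by
  have so : (∀ x ∈ W, quadraticForm x = 0) → x.2.2 = 0 →
      ∀ y ∈ W, x.1 ⬝ᵥ y.2.1 = 0 := by
    intro h he y hy
    have h1 := h _ (W.add_mem hx hy)
    have h2 := h _ hy
    simp only [quadraticForm, Prod.fst_add, Prod.snd_add, h0, he, zero_add, add_dotProduct] at h1 h2
    rw [add_assoc, h2, add_zero] at h1
    exact h1
  cases X with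
  | symplectic =>
    refine ⟨funext fun i => i.elim0, fun y hy => ?_⟩
    have h1 := hW x hx y hy
    simpa [symplecticForm, h0] using h1
  | evenOrthogonal =>
    have he : x.2.2 = 0 := funext fun i => i.elim0
    exact ⟨he, so hW he⟩
  | oddOrthogonal =>
    have he : x.2.2 = 0 := by
      have h1 := hW x hx
      simp only [quadraticForm, h0, dotProduct_zero, zero_add] at h1
      change ∑ i : Fin 1, x.2.2 i * x.2.2 i = 0 at h1
      rw [Fin.sum_univ_one] at h1
      have h2 := mul_self_eq_zero.1 h1
      funext i
      change Fin 1 at i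
      rw [Subsingleton.elim i 0]
      exact h2
    exact ⟨he, so hW he⟩

theorem finrank_le_of_isotropic (W : Submodule F (X.Space F n)) (hW : IsNonzeroIsotropic W) :
    Module.finrank F W ≤ n := by
  let π : X.Space F n →ₗ[F] (Fin n → F) :=
    LinearMap.fst F _ _ ∘ₗ LinearMap.snd F (Fin n → F) ((Fin n → F) × (Fin X.extra → F))
  let α : X.Space F n →ₗ[F] (Fin n → F) := LinearMap.fst F _ _
  let πW : W →ₗ[F] (Fin n → F) := π.domRestrict W
  let K := LinearMap.ker πW
  let αK : K →ₗ[F] (Fin n → F) := α ∘ₗ W.subtype ∘ₗ K.subtype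
  have hK : ∀ x : K, (x.1.1).2.1 = 0 := fun x => x.2
  have hinj : Function.Injective αK := by
    intro x y hxy
    have h0 : (x.1.1 - y.1.1).2.1 = 0 := by
      rw [Prod.snd_sub, Prod.fst_sub, hK x, hK y, sub_zero]
    have h1 := (hW.2.properties (W.sub_mem x.1.2 y.1.2) h0).1
    apply Subtype.ext; apply Subtype.ext
    refine Prod.ext hxy (Prod.ext ((hK x).trans (hK y).symm) (sub_eq_zero.1 h1))
  have hle : LinearMap.range πW ≤ annihilator (LinearMap.range αK) := by
    rintro _ ⟨y, rfl⟩ _ ⟨x, rfl⟩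
    exact (hW.2.properties x.1.2 (hK x)).2 y.1 y.2
  have h1 := LinearMap.finrank_range_add_finrank_ker πW
  have h2 := LinearMap.finrank_range_of_inj hinj
  have h3 := Submodule.finrank_mono hle
  have h4 := finrank_annihilator (LinearMap.range αK)
  have h5 : Module.finrank F (LinearMap.ker πW) = Module.finrank F K := rfl
  omega

/-- The decomposition of the space for `ℓ + m` as the orthogonal sum of the hyperbolic space
`F^ℓ ⊕ F^ℓ` spanned by the `a_j`, `b_j` with `j ≤ ℓ`, and the space for `m`. -/
def split : (((Fin ℓ → F) × (Fin ℓ → F)) × X.Space F m) ≃ₗ[F] X.Space F (ℓ + m) where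
  toFun x := (LinearFamily.split F ℓ m (x.1.1, x.2.1),
    LinearFamily.split F ℓ m (x.1.2, x.2.2.1), x.2.2.2)
  map_add' x y := by
    refine Prod.ext ?_ (Prod.ext ?_ rfl)
    · exact map_add (LinearFamily.split F ℓ m) (x.1.1, x.2.1) (y.1.1, y.2.1)
    · exact map_add (LinearFamily.split F ℓ m) (x.1.2, x.2.2.1) (y.1.2, y.2.2.1)
  map_smul' c x := by
    refine Prod.ext ?_ (Prod.ext ?_ rfl)
    · exact map_smul (LinearFamily.split F ℓ m) c (x.1.1, x.2.1)
    · exact map_smul (LinearFamily.split F ℓ m) c (x.1.2, x.2.2.1)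
  invFun x := ((((LinearFamily.split F ℓ m).symm x.1).1, ((LinearFamily.split F ℓ m).symm x.2.1).1),
    (((LinearFamily.split F ℓ m).symm x.1).2, ((LinearFamily.split F ℓ m).symm x.2.1).2, x.2.2))
  left_inv x := by simp
  right_inv x := by simp

theorem append_dotProduct (a c : Fin ℓ → F) (b d : Fin m → F) :
    LinearFamily.split F ℓ m (a, b) ⬝ᵥ LinearFamily.split F ℓ m (c, d) = a ⬝ᵥ c + b ⬝ᵥ d := by
  simp [LinearFamily.split_apply, dotProduct, Fin.sum_univ_add]

theorem symplecticForm_split (u v : (Fin ℓ → F) × (Fin ℓ → F)) (x y : X.Space F m) :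
    symplecticForm (X.split F ℓ m (u, x)) (X.split F ℓ m (v, y))
      = (u.1 ⬝ᵥ v.2 - u.2 ⬝ᵥ v.1) + symplecticForm x y := by
  change LinearFamily.split F ℓ m (u.1, x.1) ⬝ᵥ LinearFamily.split F ℓ m (v.2, y.2.1)
    - LinearFamily.split F ℓ m (u.2, x.2.1) ⬝ᵥ LinearFamily.split F ℓ m (v.1, y.1) = _
  rw [append_dotProduct, append_dotProduct, symplecticForm]
  ring

theorem quadraticForm_split (u : (Fin ℓ → F) × (Fin ℓ → F)) (x : X.Space F m) :
    quadraticForm (X.split F ℓ m (u, x)) = u.1 ⬝ᵥ u.2 + quadraticForm x := by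
  change LinearFamily.split F ℓ m (u.1, x.1) ⬝ᵥ LinearFamily.split F ℓ m (u.2, x.2.1)
    + x.2.2 ⬝ᵥ x.2.2 = _
  rw [append_dotProduct, quadraticForm]
  ring

theorem joinValid : JoinValid (X.split F ℓ m) IsNull IsNonzeroIsotropic IsNonzeroIsotropic
    ℓ m ℓ m (ℓ + m) := by
  intro w f g
  have hs : ∀ {s t : ℕ}, s < t → t ≤ ℓ + m →
      joinVertex (X.split F ℓ m) w.1 f.1 g.1 s < joinVertex (X.split F ℓ m) w.1 f.1 g.1 t :=
    fun h1 h2 => joinVertex_strict _ w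
      (fun _ _ => vertex_strict_of_ne_bot (fun _ h => h.1) f)
      (fun _ _ => vertex_strict_of_ne_bot (fun _ h => h.1) g) h1 h2
  refine ⟨fun s t h => hs (by have : (s : ℕ) < t := h; omega) (by have := t.2; omega), fun t => ?_⟩
  have ht := t.2
  refine ⟨(bot_le.trans_lt (hs (show 0 < (t : ℕ) + 1 by omega) (by omega))).ne', ?_⟩
  have c1 := letterCount_add w.1 le_rfl
  have c2 := letterCount_mono w.1 true (show (t : ℕ) + 1 ≤ ℓ + m by omega)
  have c3 := letterCount_mono w.1 false (show (t : ℕ) + 1 ≤ ℓ + m by omega)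
  have c4 := w.2
  have hU : ∀ i ≤ ℓ, ∀ x ∈ vertex f.1 i, ∀ y ∈ vertex f.1 i, x.1 ⬝ᵥ y.2 = 0 := by
    intro i hi
    unfold vertex
    split_ifs with h1 h2
    · intro x hx y _
      rw [Submodule.mem_bot] at hx
      rw [hx]; exact zero_dotProduct _
    · exact (f.2.2 _).2
    · omega
  have hG : ∀ i ≤ m, Isotropic (vertex g.1 i) := by
    intro i hi
    unfold vertex
    split_ifs with h1 h2
    · cases X with
      | symplectic =>
        intro x hx y _
        rw [Submodule.mem_bot] at hx
        rw [hx]; simp [symplecticForm]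
      | evenOrthogonal =>
        intro x hx
        rw [Submodule.mem_bot] at hx
        rw [hx]; simp [quadraticForm]
      | oddOrthogonal =>
        intro x hx
        rw [Submodule.mem_bot] at hx
        rw [hx]; simp [quadraticForm]
    · exact (g.2.2 _).2
    · omega
  have hU' := hU (letterCount w.1 true (t + 1)) (by omega)
  have hG' := hG (letterCount w.1 false (t + 1)) (by omega)
  cases X with
  | symplectic =>
    rintro _ ⟨⟨u, x⟩, hx, rfl⟩ _ ⟨⟨v, y⟩, hy, rfl⟩
    refine (symplecticForm_split symplectic F ℓ m u v x y).trans ?_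
    rw [hU' u hx.1 v hy.1, hG' x hx.2 y hy.2, dotProduct_comm, hU' v hy.1 u hx.1]
    simp
  | evenOrthogonal =>
    rintro _ ⟨⟨u, x⟩, hx, rfl⟩
    refine (quadraticForm_split evenOrthogonal F ℓ m u x).trans ?_
    rw [hU' u hx.1 u hx.1, hG' x hx.2, add_zero]
  | oddOrthogonal =>
    rintro _ ⟨⟨u, x⟩, hx, rfl⟩
    refine (quadraticForm_split oddOrthogonal F ℓ m u x).trans ?_
    rw [hU' u hx.1 u hx.1, hG' x hx.2, add_zero]

/-- The Reeder product map `St_{GL_ℓ} ⊗ St_{G_m} → St_{G_(ℓ+m)}`: suspend the first factor, then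
take the signed sum over all shuffles.  Equivalently, the apartment classes of a basis `v` of `F^ℓ`
and of a hyperbolic basis of the space for `m` are taken to the apartment class of the hyperbolic
basis obtained by putting `v` and its dual basis in front. -/
noncomputable def reederProduct :
    LinearFamily.SteinbergModule F R ℓ ⊗[R] X.SteinbergModule F R m →ₗ[R]
      X.SteinbergModule F R (ℓ + m) :=
  LinearMap.codRestrict
    (cycles R (IsNonzeroIsotropic : Submodule F (X.Space F (ℓ + m)) → Prop) (ℓ + m))
    (joinChain R (X.joinValid F ℓ m) ∘ₗ
      TensorProduct.map
        (hypChain F R ℓ ∘ₗ (cycles R (IsProper : Submodule F (Fin ℓ → F) → Prop) (ℓ - 1)).subtype)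
        (cycles R (IsNonzeroIsotropic : Submodule F (X.Space F m) → Prop) m).subtype) (by
    intro x
    induction x using TensorProduct.induction_on with
    | zero => rw [map_zero]; exact Submodule.zero_mem _
    | add x y hx hy => rw [map_add]; exact Submodule.add_mem _ hx hy
    | tmul z y =>
      exact mem_cycles_of_facesVanish (facesVanish_joinChain _ le_rfl (Nat.sub_le _ _)
        (Nat.sub_le _ _) (fun _ _ => ⟨le_rfl, le_rfl⟩)
        (facesVanish_hypChain (facesVanish_of_mem_cycles (fun _ h => h.1)
          (LinearFamily.finrank_le_of_isProper F ℓ) z.2))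
        (facesVanish_of_mem_cycles (fun _ h => h.1) (X.finrank_le_of_isotropic F m) y.2)))

theorem blockHom_mem_group (g : X.group F m) :
    blockHom (X.split F ℓ m) g.1 ∈ X.group F (ℓ + m) := by
  have quad : ∀ h : X.Space F m ≃ₗ[F] X.Space F m,
      (∀ x, quadraticForm (h x) = quadraticForm x) → ∀ x,
      quadraticForm (blockHom (X.split F ℓ m) h x) = quadraticForm x := by
    intro h hh x
    obtain ⟨⟨u, y⟩, rfl⟩ := (X.split F ℓ m).surjective x
    rw [blockHom_apply, quadraticForm_split, quadraticForm_split, hh]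
  cases X with
  | symplectic =>
    intro x y
    obtain ⟨⟨u, x⟩, rfl⟩ := (split symplectic F ℓ m).surjective x
    obtain ⟨⟨v, y⟩, rfl⟩ := (split symplectic F ℓ m).surjective y
    rw [blockHom_apply, blockHom_apply, symplecticForm_split, symplecticForm_split, g.2 x y]
  | evenOrthogonal => exact ⟨(det_blockHom _ _).trans g.2.1, quad _ g.2.2⟩
  | oddOrthogonal => exact ⟨(det_blockHom _ _).trans g.2.1, quad _ g.2.2⟩

/-- The inclusion of `1 × G_m` into the stabilizer of `a_1, …, a_ℓ` in `G_(ℓ+m)`. -/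
def inclusion : X.group F m →* X.stab F ℓ (ℓ + m) where
  toFun g := ⟨⟨blockHom (X.split F ℓ m) g.1, X.blockHom_mem_group F ℓ m g⟩, by
    intro j hj
    have h1 : (Pi.single j 1 : Fin (ℓ + m) → F)
        = LinearFamily.split F ℓ m (Pi.single ⟨j, hj⟩ 1, 0) := by
      rw [LinearFamily.split_apply]
      funext i
      refine Fin.addCases (fun i => ?_) (fun i => ?_) i
      · rw [Fin.append_left]
        simp [Pi.single_apply, Fin.ext_iff]
      · rw [Fin.append_right, Pi.zero_apply, Pi.single_eq_of_ne]
        intro h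
        have := congrArg Fin.val h
        simp at this
        omega
    have h2 : ((Pi.single j 1, 0, 0) : X.Space F (ℓ + m))
        = X.split F ℓ m ((Pi.single ⟨j, hj⟩ 1, 0), 0) :=
      Prod.ext h1 (Prod.ext (map_zero (LinearFamily.split F ℓ m)).symm rfl)
    change blockHom (X.split F ℓ m) g.1 _ = _
    rw [h2, blockHom_apply, map_zero]⟩
  map_one' := by
    apply Subtype.ext; apply Subtype.ext
    exact map_one (blockHom (X.split F ℓ m))
  map_mul' g h := by
    apply Subtype.ext; apply Subtype.ext
    exact map_mul (blockHom (X.split F ℓ m)) g.1 h.1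

/-- The action of `1 × G_m` on `St_{GL_ℓ} ⊗ St_{G_m}`: trivial on the first factor. -/
noncomputable def tensorAction :
    Representation R (X.group F m) (LinearFamily.SteinbergModule F R ℓ ⊗[R] X.SteinbergModule F R m) :=
  (Representation.trivial R (X.group F m) (LinearFamily.SteinbergModule F R ℓ)).tprod (X.steinbergAction F R m)

/-- `St_{GL_ℓ} ⊗ St_{G_m}` as a representation of `1 × G_m`. -/
noncomputable def tensorRep : Rep.{u} R (X.group F m) :=
  Rep.of (X := LinearFamily.SteinbergModule F R ℓ ⊗[R] X.SteinbergModule F R m)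
    (X.tensorAction F R ℓ m)

/-- The restriction of `St_{G_n}` to the stabilizer of `a_1, …, a_ℓ`. -/
noncomputable def stabRep : Rep.{u} R (X.stab F ℓ n) :=
  Rep.res (X.stab F ℓ n).subtype (X.steinberg F R n)

theorem reederProduct_equivariant (g : X.group F m)
    (x : LinearFamily.SteinbergModule F R ℓ ⊗[R] X.SteinbergModule F R m) :
    X.reederProduct F R ℓ m (X.tensorAction F R ℓ m g x)
      = X.steinbergAction F R (ℓ + m) (X.inclusion F ℓ m g).1 (X.reederProduct F R ℓ m x) := by
  induction x using TensorProduct.induction_on with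
  | zero => simp only [map_zero]
  | add x y hx hy => simp only [map_add, hx, hy]
  | tmul z y =>
    apply Subtype.ext
    exact joinChain_equivariant (X.joinValid F ℓ m)
      (Subgroup.inclusion (X.group_le_preserving F m) g)
      (Subgroup.inclusion (X.group_le_preserving F (ℓ + m)) (X.inclusion F ℓ m g).1) rfl
      (hypChain F R ℓ z.1) y.1

/-- The Reeder product map as a map of representations of `1 × G_m`. -/
noncomputable def reederHom :
    X.tensorRep F R ℓ m ⟶ Rep.res (X.inclusion F ℓ m) (X.stabRep F R ℓ (ℓ + m)) :=
  Rep.ofHom (LinearMap.intertwiningMap_of_isIntertwiningMap _ _ (X.reederProduct F R ℓ m)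
    (X.reederProduct_equivariant F R ℓ m))

/-- The map `H_i(1 × G_m; St_{GL_ℓ} ⊗ St_{G_m}) → H_i(Stab; St_{G_(ℓ+m)})` induced by the inclusion
of groups and the Reeder product map. -/
noncomputable def homologyMap (i : ℕ) :
    groupHomology (X.tensorRep F R ℓ m) i ⟶ groupHomology (X.stabRep F R ℓ (ℓ + m)) i :=
  groupHomology.map (X.inclusion F ℓ m) (X.reederHom F R ℓ m) i

end IsotropicFamily

end SteinbergStability

/-! ### Change of groups for the bar resolution. -/

open CategoryTheory

namespace SteinbergStability
namespace Shapiro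

variable {k G H : Type u} [CommRing k] [Group G] [Group H] (φ : H →* G)

/-! Let `A` be the span of `a_1, …, a_ℓ` and put `n = ℓ + m`. The restriction of `St_{G_n}` to the
stabilizer is induced from `1 × G_m`: it is the direct sum of the translates of the image of the
Reeder product, over coset representatives (`LinearFamily.induced_bijective`,
`IsotropicFamily.induced_bijective`). Shapiro's lemma (`Shapiro.isIso_map_of_bijective`) then gives
the first isomorphism. For the second, `St_{GL_ℓ}` carries the trivial action and is free over `R`,
so it can be taken out of the homology (`Shapiro.tensorHomologyEquiv`).

To see that the module is induced, regard a cycle as a finitely supported function on full flags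
whose sum over each panel is zero, a panel being the set of flags that agree away from one position.
Let `O` be the set of flags in general position to `A`: the `m`-th space meets `A` trivially (linear
families), or the `ℓ`-th space meets the orthogonal complement of `A` trivially (isotropic
families). Three facts carry the proof.

A cycle is determined by its values on `O` (`eq_zero_of_opposite`). In the support of a nonzero
cycle take a flag whose spaces meet `A`, and in the isotropic case also its orthogonal complement,
in the smallest total dimension. The panel condition allows each vertex to be exchanged for another,
so minimality forces the dimensions of the intersections to jump as late as possible, and the flag
lies in `O`. The maximal isotropic space at the end of an isotropic flag needs an argument of its
own.

The set `O` is a disjoint union of translates, indexed by the cosets of `1 × G_m`, of the set of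
flags through a standard complement. Indeed the stabilizer acts transitively on the complements by
unipotent elements, and the stabilizer of the standard one is `1 × G_m`. The flags through it are
pairs of a flag in `F^ℓ` and a flag for `G_m`.

Restricted to these pairs, a cycle is a cycle in each variable, hence an element of `St_{GL_ℓ} ⊗
St_{G_m}` (`mem_range_bicycle`). Conversely, exactly one term of the Reeder product meets `O`, and
its coefficient is a sign. The freeness of `St_{GL_ℓ}` follows by induction from the same
decomposition with `ℓ = 1`. -/

theorem exists_retraction {φ : H →* G} (hφ : Function.Injective φ) :
    ∃ r : G → H, ∀ h g, r (φ h * g) = h * r g := by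
  -- Divide `g` by the chosen representative of its right coset under `φ.range`. Left multiplication
  -- by `φ h` does not change the coset, so the quotient is equivariant.
  let := QuotientGroup.rightRel φ.range
  choose! i hi using Quotient.mk'_surjective (α := G)
  have hex : ∀ g : G, ∃ h : H, φ h = g * (i (Quotient.mk' g))⁻¹ := fun g =>
    QuotientGroup.rightRel_apply.1 (Quotient.eq'.1 (hi (Quotient.mk' g)))
  choose r hr using hex
  have hmk (s : H) (g : G) : Quotient.mk' (φ s * g) = Quotient.mk' g :=
    Quotient.eq'.2 (QuotientGroup.rightRel_apply.2 (by simp))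
  refine ⟨r, fun h g => hφ ?_⟩
  rw [hr, hmk, map_mul, hr, mul_assoc]

/-- An element of a coinduced module is an equivariant function on `G`, determined by its values on
coset representatives. Preimages can be chosen there and extended equivariantly by means of the
retraction. Through the adjunction with restriction this makes restriction preserve projectives. -/
theorem coindFunctor_preservesEpimorphisms {φ : H →* G} (hφ : Function.Injective φ) :
    (Rep.coindFunctor k φ : Rep.{u} k H ⥤ Rep.{u} k G).PreservesEpimorphisms where
  preserves {X Y} f hf := (Rep.epi_iff_surjective (A := Rep.coind φ X) (B := Rep.coind φ Y) _).2
    fun y => by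
    choose! s hs using (Rep.epi_iff_surjective f).1 hf
    obtain ⟨r, hr⟩ := exists_retraction hφ
    let x (g : G) : X := X.ρ (r g) (s (y.1 (φ (r g)⁻¹ * g)))
    refine ⟨⟨x, fun h g => ?_⟩, Subtype.ext <| funext fun g => ?_⟩
    · have e : (φ (h * r g))⁻¹ * (φ h * g) = (φ (r g))⁻¹ * g := by
        rw [map_mul, mul_inv_rev, mul_assoc, inv_mul_cancel_left]
      simp [x, ← Module.End.mul_apply, ← map_mul, hr, e]
    · simp only [Rep.coindFunctor_map, Rep.hom_ofHom,
        Representation.coindMap_coe_apply_apply, Rep.hom_comm_apply, x, hs]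
      rw [← y.2 (r g)]
      simp

theorem resFunctor_preservesProjectiveObjects {φ : H →* G} (hφ : Function.Injective φ) :
    (Rep.resFunctor φ : Rep.{u} k G ⥤ Rep.{u} k H).PreservesProjectiveObjects :=
  have := coindFunctor_preservesEpimorphisms (k := k) hφ
  (Rep.resFunctor φ).preservesProjectiveObjects_of_adjunction_of_preservesEpimorphisms
    (Rep.resCoindAdjunction k φ)

noncomputable def barMapX (n : ℕ) :
    Rep.free.{u,u,u} k H (Fin n → H) ⟶ Rep.res φ (Rep.free k G (Fin n → G)) :=
  Rep.freeLift k H _ fun x => Finsupp.single (φ ∘ x) (.single 1 1)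

theorem barMapX_single {n : ℕ} (x : Fin n → H) (h : H) (r : k):
    (barMapX φ n).hom (Finsupp.single x (.single h r)) = Finsupp.single (φ ∘ x) (.single (φ h) r) := by
  simp [barMapX]

noncomputable def barMap :
    Rep.barComplex k H ⟶ ((Rep.resFunctor.{u} φ).mapHomologicalComplex _).obj (Rep.barComplex k G) where
  f n := barMapX φ n
  comm' i j (hij : _ = _) := by
    subst hij
    refine Rep.free_ext k H _ _ _ fun x => ?_
    have e1 := barMapX_single (k := k) φ x 1 1
    rw [map_one] at e1
    have e2 := Rep.barComplex.d_single (k := k) (n := j) x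
    have e3 := Rep.barComplex.d_single (k := k) (n := j) (φ ∘ x)
    rw [Functor.mapHomologicalComplex_obj_d, Rep.barComplex.d_def, Rep.barComplex.d_def]
    change (Rep.barComplex.d k G j).hom ((barMapX φ (j + 1)).hom _) = (barMapX φ j).hom ((Rep.barComplex.d k H j).hom _)
    refine (congrArg _ e1).trans ?_
    refine Eq.trans ?_ (congrArg _ e2).symm
    rw [map_add, map_sum]
    have e4 : ∀ j₁ : Fin (j+1), (barMapX (k := k) φ j).hom (Finsupp.single (j₁.contractNth (· * ·) x) (.single (1 : H) ((-1 : k) ^ (j₁.val + 1)))) = Finsupp.single (j₁.contractNth (· * ·) (φ ∘ x)) (.single (1 : G) ((-1 : k) ^ (j₁.val + 1))) := by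
      intro j₁
      rw [barMapX_single, map_one, Fin.comp_contractNth (· * ·) (· * ·) (fun a b => map_mul φ a b)]
    refine Eq.trans ?_ (congrArg₂ _ (barMapX_single φ _ _ _).symm (Finset.sum_congr rfl fun i _ => (e4 i).symm))
    exact e3

/-- Only the coefficient `r` is needed: the augmentation of the standard complex takes the same
value on all basis elements, so `y` may stay unspecified. -/
theorem diagonalSuccIsoFree_inv_single (m : ℕ) (f : Fin m → G) (g : G) (r : k) :
    ∃ y, (Rep.diagonalSuccIsoFree k G m).inv.hom (Finsupp.single f (MonoidAlgebra.single g r)) =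
          (MonoidAlgebra.single y r : MonoidAlgebra k (Fin (m + 1) → G)) := by
  simp only [Rep.diagonalSuccIsoFree, Rep.diagonalSuccIsoTensorTrivial, Iso.trans_inv, Rep.hom_comp,
        Representation.IntertwiningMap.comp_apply]
  have step1 : (Rep.Hom.hom (Rep.leftRegularTensorTrivialIsoFree k G (Fin m → G)).inv)
          (Finsupp.single f (.single g r)) = .single g 1 ⊗ₜ[k] .single f r :=
        Representation.leftRegularTensorTrivialIsoFree_symm_apply_single_single f g r
  rw [step1]
  have key₁ := Representation.linearizeMap_single (k := k)
        (Action.diagonalSuccIsoTensorTrivial G m).inv (g, f) ((1 : k) * r)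
  have key₂ := Representation.LinearizeMonoidal.μ_apply_single_single (k := k)
        (X := Action.leftRegular G) (Y := Action.trivial G (Fin m → G)) g f 1 r
  have key₃ := (congrArg (fun z => (Representation.linearizeMap
        (Action.diagonalSuccIsoTensorTrivial G m).inv) z) key₂).trans key₁
  rw [one_mul] at key₃
  exact ⟨_, key₃⟩

theorem ε_single (x : Fin 1 → G) (r : k) : (Rep.standardComplex.ε k G).hom (MonoidAlgebra.single x r) = (r : k) := by
  simp [Rep.standardComplex.ε, ← Representation.IntertwiningMap.toLinearMap_apply]

theorem barResolution_π_single (x : Fin 0 → G) (g : G) (r : k) :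
    ((Rep.barResolution k G).π.f 0).hom (Finsupp.single x (MonoidAlgebra.single g r)) = (r : k) := by
  obtain ⟨y, hy⟩ := diagonalSuccIsoFree_inv_single 0 x g r
  refine Eq.trans ?_ (ε_single y r)
  have h1 : (Rep.barResolution k G).π.f 0 = (Rep.diagonalSuccIsoFree k G 0).inv ≫ Rep.standardComplex.ε k G := by
    have e1 : (Rep.standardComplex.εToSingle₀ k G).f 0 = Rep.standardComplex.ε k G :=
      ChainComplex.toSingle₀Equiv_symm_apply_f_zero _ _
    rw [← e1]
    rfl
  have h2 := congrArg (fun f => f.hom (Finsupp.single x (MonoidAlgebra.single g r))) h1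
  exact h2.trans (congrArg (Rep.standardComplex.ε k G).hom hy)

/-- Compatibility with the augmentations determines `barMap` up to homotopy, as a map of projective
resolutions. -/
theorem barMap_π [(Rep.resFunctor φ : Rep.{u} k G ⥤ Rep.{u} k H).PreservesProjectiveObjects] :
    barMap φ ≫ ((Rep.resFunctor φ).mapProjectiveResolution (Rep.barResolution k G)).π = (Rep.barResolution k H).π := by
    refine HomologicalComplex.to_single_hom_ext ?_
    refine Rep.free_ext k H _ _ _ fun x => ?_
    refine Eq.trans ?_ (barResolution_π_single (k := k) x 1 1).symm
    refine Eq.trans ?_ (barResolution_π_single (k := k) (φ ∘ x) 1 1)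
    have e1 := barMapX_single (k := k) φ x 1 1
    rw [map_one] at e1
    have e2 : (barMap φ ≫ ((Rep.resFunctor φ).mapProjectiveResolution (Rep.barResolution k G)).π).f 0
       = barMapX φ 0 ≫ (Rep.resFunctor φ).map ((Rep.barResolution k G).π.f 0) := by
      rfl
    have e3 := congrArg (fun f => f.hom (Finsupp.single x (MonoidAlgebra.single 1 1))) e2
    exact e3.trans (congrArg ((Rep.barResolution k G).π.f 0).hom e1)

end Shapiro
end SteinbergStability

/-! ### Shapiro's lemma. -/

open CategoryTheory

namespace SteinbergStability
namespace Shapiro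

variable {k G H : Type u} [CommRing k] [Group G] [Group H] (φ : H →* G)

/-- The restricted bar resolution of `G` is again a projective resolution of the trivial module.
Hence `barMap` is homotopic to a homotopy equivalence of resolutions, and additive functors preserve
homotopies. -/
theorem isIso_homologyMap_barMap (hφ : Function.Injective φ) {C : Type*} [Category C] [Abelian C]
    (T : Rep.{u} k H ⥤ C) [T.Additive] (i : ℕ) :
    IsIso (HomologicalComplex.homologyMap ((T.mapHomologicalComplex _).map (barMap (k := k) φ)) i) := by
  have := resFunctor_preservesProjectiveObjects (k := k) hφ
  let P : ProjectiveResolution (Rep.trivial k H k) := Rep.barResolution k H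
  let Q : ProjectiveResolution (Rep.trivial k H k) :=
    (Rep.resFunctor φ).mapProjectiveResolution (Rep.barResolution k G)
  let b : P.complex ⟶ Q.complex := barMap φ
  have hb : b ≫ Q.π = P.π := barMap_π φ
  let e := ProjectiveResolution.homotopyEquiv P Q
  have ho : Homotopy b e.hom := ProjectiveResolution.liftHomotopy (𝟙 _) _ _ (by rw [hb]; simp) (by simp [e])
  have h1 := (T.mapHomotopy ho).homologyMap_eq i
  change IsIso (HomologicalComplex.homologyMap ((T.mapHomologicalComplex _).map b) i)
  rw [h1]
  exact inferInstanceAs (IsIso ((T.mapHomotopyEquiv e).toHomologyIso i).hom)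

/-- At `P` this is `A ⊗_H Res P ≅ (Ind A) ⊗_G P ⟶ B ⊗_G P`. -/
noncomputable def indTransform {A : Rep.{u} k H} {B : Rep.{u} k G} (F : Rep.ind φ A ⟶ B) :
    Rep.resFunctor φ ⋙ (Rep.coinvariantsTensor k H).obj A ⟶ (Rep.coinvariantsTensor k G).obj B :=
  (Rep.coinvariantsTensorIndNatIso φ A).inv ≫ (Rep.coinvariantsTensor k G).map F

theorem indTransform_app_mk {A : Rep.{u} k H} {B : Rep.{u} k G} (F : Rep.ind φ A ⟶ B) (P : Rep.{u} k G) (a : A) (y : P) :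
    ((indTransform φ F).app P).hom (Rep.coinvariantsTensorMk A (Rep.res φ P) a y)
      = Rep.coinvariantsTensorMk B P (F.hom (Representation.IndV.mk φ A.ρ 1 a)) y := by
  have h := Rep.coinvariantsTensorIndInv_mk_tmul_indMk φ (A := A) (B := P) a y
  exact congrArg (((Rep.coinvariantsTensor k G).map F).app P).hom h

noncomputable def indChain {A : Rep.{u} k H} {B : Rep.{u} k G} (F : Rep.ind φ A ⟶ B) :
    HomologicalComplex.coinvariantsTensorObj A (((Rep.resFunctor.{u} φ).mapHomologicalComplex _).obj (Rep.barComplex k G))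
     ⟶ HomologicalComplex.coinvariantsTensorObj B (Rep.barComplex k G) :=
  (NatTrans.mapHomologicalComplex (indTransform φ F) (ComplexShape.down ℕ)).app (Rep.barComplex k G)

theorem inhomogeneousChainsIso_hom_single [DecidableEq G] (B : Rep.{u} k G) (n : ℕ) (x : Fin n → G) (b : B) :
    ((groupHomology.inhomogeneousChainsIso B).hom.f n).hom (Finsupp.single x b) =
      Rep.coinvariantsTensorMk B (Rep.free k G (Fin n → G)) b (Finsupp.single x (.single 1 1)) :=
  Rep.finsuppToCoinvariantsTensorFree_single x b

/-- Separates the change of group from the change of coefficients. For injective `φ` the factor from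
`barMap` induces isomorphisms on homology; the factor `indChain` is an isomorphism as soon as the
adjoint `Ind A ⟶ B` of `f` is one. -/
theorem chainsMap_comp_iso [DecidableEq G] [DecidableEq H] {A : Rep.{u} k H} {B : Rep.{u} k G} (f : A ⟶ Rep.res φ B) :
    groupHomology.chainsMap φ f ≫ (groupHomology.inhomogeneousChainsIso B).hom =
      (groupHomology.inhomogeneousChainsIso A).hom ≫
      (((Rep.coinvariantsTensor k H).obj A).mapHomologicalComplex _).map (barMap φ) ≫
      indChain φ ((Rep.indResHomEquiv φ A B).symm f) := by
  refine HomologicalComplex.hom_ext _ _ fun n => ?_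
  refine groupHomology.inhomogeneousChains.ext fun x => ?_
  refine ModuleCat.hom_ext <| LinearMap.ext fun a => ?_
  have h1 := groupHomology.chainsMap_f_single φ f n x a
  have h2 := inhomogeneousChainsIso_hom_single B n (φ ∘ x) (f.hom a)
  have h3 := inhomogeneousChainsIso_hom_single A n x a
  have h5 := barMapX_single (k := k) φ x 1 1
  rw [map_one] at h5
  have h4 : ((((Rep.coinvariantsTensor k H).obj A).map (barMapX (k := k) φ n)).hom 
    (Rep.coinvariantsTensorMk A (Rep.free k H (Fin n → H)) a (Finsupp.single x (.single 1 1))))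
     = Rep.coinvariantsTensorMk A (Rep.res φ (Rep.free k G (Fin n → G))) a (Finsupp.single (φ ∘ x) (.single 1 1)) := 
    congrArg (Rep.coinvariantsTensorMk A (Rep.res φ (Rep.free k G (Fin n → G))) a) h5
  have h6 := indTransform_app_mk φ ((Rep.indResHomEquiv φ A B).symm f) (Rep.free k G (Fin n → G)) a (Finsupp.single (φ ∘ x) (.single 1 1))
  have h7 : ((Rep.indResHomEquiv φ A B).symm f).hom (Representation.IndV.mk φ A.ρ 1 a) = f.hom a := by
    simp 
  rw [h7] at h6
  refine (congrArg ((groupHomology.inhomogeneousChainsIso B).hom.f n).hom h1).trans (h2.trans ?_)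
  refine h6.symm.trans (congrArg _ ?_)
  refine h4.symm.trans (congrArg _ ?_)
  exact h3.symm

theorem isIso_map_of_isIso (hφ : Function.Injective φ) {A : Rep.{u} k H} {B : Rep.{u} k G} (f : A ⟶ Rep.res φ B)
   (hf : IsIso ((Rep.indResHomEquiv φ A B).symm f)) (i : ℕ) : IsIso (groupHomology.map φ f i) := by
  classical
  have h := chainsMap_comp_iso φ f
  have h1 := isIso_homologyMap_barMap (k := k) φ hφ ((Rep.coinvariantsTensor k H).obj A) i
  have h2 : IsIso (indChain φ ((Rep.indResHomEquiv φ A B).symm f)) := by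
    have : IsIso (indTransform φ ((Rep.indResHomEquiv φ A B).symm f)) := by
      unfold indTransform; infer_instance
    exact ((NatIso.mapHomologicalComplex (asIso (indTransform φ ((Rep.indResHomEquiv φ A B).symm f)))
      (ComplexShape.down ℕ)).app (Rep.barComplex k G)).isIso_hom
  have h3 := congrArg (fun g => HomologicalComplex.homologyMap g i) h
  simp only [HomologicalComplex.homologyMap_comp] at h3
  have h5 (C : Rep.{u} k H) : IsIso (HomologicalComplex.homologyMap (groupHomology.inhomogeneousChainsIso C).hom i) :=
    (HomologicalComplex.homologyMapIso (groupHomology.inhomogeneousChainsIso C) i).isIso_hom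
  have h6 : IsIso (HomologicalComplex.homologyMap (groupHomology.inhomogeneousChainsIso B).hom i) :=
    (HomologicalComplex.homologyMapIso (groupHomology.inhomogeneousChainsIso B) i).isIso_hom
  have h7 := (HomologicalComplex.homologyMapIso (asIso (indChain φ ((Rep.indResHomEquiv φ A B).symm f))) i).isIso_hom
  rw [HomologicalComplex.homologyMapIso_hom, asIso_hom] at h7
  have h4 : IsIso (HomologicalComplex.homologyMap (groupHomology.chainsMap φ f) i ≫ HomologicalComplex.homologyMap (groupHomology.inhomogeneousChainsIso B).hom i) := by
    rw [h3]; infer_instance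
  exact @IsIso.of_isIso_comp_right _ _ _ _ _ (HomologicalComplex.homologyMap (groupHomology.chainsMap φ f) i) (HomologicalComplex.homologyMap (groupHomology.inhomogeneousChainsIso B).hom i) h6 h4

/-- Shapiro's lemma for a map `A ⟶ B` that exhibits `B` as induced from `A`. -/
theorem isIso_map_of_bijective (hφ : Function.Injective φ) {A : Rep.{u} k H} {B : Rep.{u} k G} (f : A ⟶ Rep.res φ B)
    {U : Type u} (t : U → G) (ht : ∀ g, ∃ c h, g = t c * φ h)
    (hf : Function.Bijective (Finsupp.lsum k fun c : U => B.ρ (t c) ∘ₗ f.hom.toLinearMap : (U →₀ A) →ₗ[k] B)) (i : ℕ) :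
    IsIso (groupHomology.map φ f i) := by
  refine isIso_map_of_isIso φ hφ f ?_ i
  set F := (Rep.indResHomEquiv φ A B).symm f with hF
  -- The inverse is there because `F` sends the class of `g` and `a` to `g⁻¹ • f a`. The composite
  -- of `s` with `F` is the bijection `hf`; as `s` is surjective, `F` is bijective.
  let s : (U →₀ A) →ₗ[k] Representation.IndV φ A.ρ := Finsupp.lsum k fun c => Representation.IndV.mk φ A.ρ (t c)⁻¹
  have hs : Function.Surjective s := by
    rw [← LinearMap.range_eq_top, ← top_le_iff]
    have h1 : ∀ g a, Representation.IndV.mk φ A.ρ g a ∈ LinearMap.range s := by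
      intro g a
      obtain ⟨c, h, hg⟩ := ht g⁻¹
      refine ⟨Finsupp.single c (A.ρ h a), ?_⟩
      have h2 := Representation.Coinvariants.mk_inv_tmul ((Representation.leftRegular k G).comp φ) A.ρ
        (MonoidAlgebra.single (t c)⁻¹ (1 : k)) a h
      have h3 : g = φ h⁻¹ * (t c)⁻¹ := by rw [map_inv, ← mul_inv_rev, ← hg, inv_inv]
      simp only [s, Finsupp.lsum_single]
      rw [h3]
      refine Eq.trans ?_ (h2.symm.trans ?_)
      · rfl
      · simp
    have h2 : (LinearMap.range s).mkQ = 0 := by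
      refine Representation.IndV.hom_ext φ A.ρ fun g => LinearMap.ext fun a => ?_
      exact (Submodule.Quotient.mk_eq_zero _).2 (h1 g a)
    rintro x -
    exact (Submodule.Quotient.mk_eq_zero _).1 (LinearMap.congr_fun h2 x)
  have hc : ∀ x, F.hom (s x) = Finsupp.lsum k (fun c : U => B.ρ (t c) ∘ₗ f.hom.toLinearMap) x := by
    intro x
    induction x using Finsupp.induction_linear with
    | zero => simp only [map_zero]
    | add x y hx hy => simp only [map_add, hx, hy]
    | single c a =>
      simp only [s, Finsupp.lsum_single]
      simp [hF]
  have hb : Function.Bijective F.hom := by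
    refine ⟨fun x y hxy => ?_, fun y => ?_⟩
    · obtain ⟨x, rfl⟩ := hs x
      obtain ⟨y, rfl⟩ := hs y
      rw [hc, hc] at hxy
      rw [hf.1 hxy]
    · obtain ⟨x, hx⟩ := hf.2 y
      exact ⟨s x, (hc x).trans hx⟩
  have h1 : Mono F := (Rep.mono_iff_injective F).2 hb.1
  have h2 : Epi F := (Rep.epi_iff_surjective F).2 hb.2
  exact isIso_of_mono_of_epi F

end Shapiro
end SteinbergStability

/-! ### Homology with a flat tensor factor on which the group acts trivially. -/

open CategoryTheory

namespace SteinbergStability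
namespace Shapiro

variable {k H : Type u} [CommRing k] [Group H] (M : Type u) [AddCommGroup M] [Module k M]
  {A : Type u} [AddCommGroup A] [Module k A] (τ : Representation k H A)

theorem inhomogeneousChains_d_single (B : Rep.{u} k H) {n : ℕ} (g : Fin (n + 1) → H) (b : B) :
    ((groupHomology.inhomogeneousChains B).d (n + 1) n).hom (Finsupp.single g b) =
      Finsupp.single (fun i => g i.succ) (B.ρ (g 0)⁻¹ b) +
      Finset.univ.sum fun j : Fin (n + 1) =>
        (-1 : k) ^ ((j : ℕ) + 1) • Finsupp.single (Fin.contractNth j (· * ·) g) b := by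
  rw [groupHomology.inhomogeneousChains.d_def]
  exact groupHomology.inhomogeneousChains.d_single _ _ _

/-- Since the action on `M` is trivial, no term of the differential touches the factor `M`, so
moving `M` inside the finitely supported functions commutes with the differentials. -/
noncomputable def tensorChainsIso :
    ((MonoidalCategory.tensorLeft (ModuleCat.of k M)).mapHomologicalComplex _).obj
      (groupHomology.inhomogeneousChains (Rep.of τ)) ≅
    groupHomology.inhomogeneousChains (Rep.of ((Representation.trivial k H M).tprod τ)) := by
  classical
  refine HomologicalComplex.Hom.isoOfComponents
    (fun n => (TensorProduct.finsuppRight k k M A (Fin n → H)).toModuleIso) ?_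
  rintro i j (rfl : _ = _)
  refine ModuleCat.hom_ext <| TensorProduct.ext <| LinearMap.ext fun m => Finsupp.lhom_ext fun g a => ?_
  have h1 : ∀ {n : ℕ} (g : Fin n → H) (a : A), TensorProduct.finsuppRight k k M A (Fin n → H) (m ⊗ₜ Finsupp.single g a) = Finsupp.single g (m ⊗ₜ a) := 
    fun g a => by simp
  have h2 := inhomogeneousChains_d_single (Rep.of ((Representation.trivial k H M).tprod τ)) g
    (m ⊗ₜ[k] a : M ⊗[k] A)
  have h3 := inhomogeneousChains_d_single (Rep.of τ) g a
  refine (congrArg _ (h1 g a)).trans ?_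
  refine h2.trans ?_
  refine Eq.trans ?_ (congrArg (fun y => TensorProduct.finsuppRight k k M A (Fin j → H) (m ⊗ₜ y)) h3).symm
  simp only [TensorProduct.tmul_add, TensorProduct.tmul_sum, TensorProduct.tmul_smul, map_add, map_sum, map_smul, h1]
  simp

/-- Tensoring with a flat module is exact, hence commutes with taking homology of the chain complex.
-/
noncomputable def tensorHomologyEquiv [Module.Flat k M] (i : ℕ) :
    M ⊗[k] groupHomology (Rep.of τ) i ≃ₗ[k]
      groupHomology (Rep.of ((Representation.trivial k H M).tprod τ)) i :=
  (((groupHomology.inhomogeneousChains (Rep.of τ)).sc i).mapHomologyIso 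
    (MonoidalCategory.tensorLeft (ModuleCat.of k M)) ).symm.toLinearEquiv.trans
  (HomologicalComplex.homologyMapIso (tensorChainsIso M τ) i).toLinearEquiv 

end Shapiro
end SteinbergStability

/-! ### Cycles as functions on flags with vanishing panel sums. -/

namespace SteinbergStability

section Faces

variable {F V : Type u} [Field F] [AddCommGroup V] [Module F V]
  {R : Type u} [CommRing R] {p : Submodule F V → Prop} {k : ℕ}

theorem update_bot_eq_iff (f g : FlagOf p k) (j : Fin k) :
    Function.update f.1 j ⊥ = Function.update g.1 j ⊥ ↔ ∀ i, i ≠ j → f.1 i = g.1 i := by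
  constructor
  · intro h i hi
    simpa [hi] using congrFun h i
  · intro h
    funext i
    by_cases hi : i = j
    · subst hi; simp
    · simp [hi, h i hi]

-- Two flags have the same face with position `j` blanked exactly when they agree at all other
-- positions, that is, lie in a common panel. The coefficient of a face is therefore a panel sum.
open Classical in
theorem facesVanish_iff_sum {z : Chain R p k} :
    FacesVanish z ↔ ∀ (j : Fin k) (f : FlagOf p k),
      ∑ g ∈ z.support with (∀ i, i ≠ j → g.1 i = f.1 i), z g = 0 := by
  have key : ∀ (j : Fin k) (a : Fin k → Submodule F V),
      Finsupp.mapDomain (fun f : FlagOf p k => Function.update f.1 j ⊥) z a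
        = ∑ g ∈ z.support with Function.update g.1 j ⊥ = a, z g := by
    intro j a
    rw [Finsupp.mapDomain, Finsupp.sum_apply, Finsupp.sum, Finset.sum_filter]
    exact Finset.sum_congr rfl fun g _ => Finsupp.single_apply
  constructor
  · intro h j f
    rw [← Finsupp.zero_apply (M := R) (a := Function.update f.1 j ⊥), ← h j, key]
    simp only [update_bot_eq_iff]
  · intro h j
    ext a
    rw [key, Finsupp.zero_apply]
    by_cases ha : ∃ f : FlagOf p k, Function.update f.1 j ⊥ = a
    · obtain ⟨f, rfl⟩ := ha
      simp only [update_bot_eq_iff]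
      exact h j f
    · rw [Finset.filter_false_of_mem, Finset.sum_empty]
      exact fun g _ hg => ha ⟨g, hg⟩

/-- A panel sum with exactly one nonzero term cannot vanish. -/
theorem FacesVanish.exists_ne {z : Chain R p k} (hz : FacesVanish z) {f : FlagOf p k}
    (hf : z f ≠ 0) (j : Fin k) : ∃ g, z g ≠ 0 ∧ g.1 j ≠ f.1 j ∧ ∀ i, i ≠ j → g.1 i = f.1 i := by
  classical
  by_contra! hcon
  refine hf ?_
  rw [← facesVanish_iff_sum.1 hz j f, Finset.sum_eq_single f]
  · intro g hg hgf
    rw [Finset.mem_filter, Finsupp.mem_support_iff] at hg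
    by_contra hg0
    obtain ⟨i, hi, hne⟩ := hcon g hg.1 (fun h => hgf (Subtype.ext (funext fun i => by
      by_cases hi : i = j
      · rw [hi, h]
      · exact hg.2 i hi)))
    exact hne (hg.2 i hi)
  · intro h
    by_contra hf0
    exact h (by simp [hf0])

/-- The hypothesis `h` says that `c` carries the panel of `f` at `j` onto the panel of `c f` at `τ
j`, so the panel sums of the restricted chain are among those of `z`. -/
theorem FacesVanish.comapDomain {W : Type u} [AddCommGroup W] [Module F W]
    {q : Submodule F W → Prop} {l : ℕ} {z : Chain R p k} (hz : FacesVanish z)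
    (c : FlagOf q l → FlagOf p k) (hc : Function.Injective c) (τ : Fin l → Fin k)
    (h : ∀ j f g, (∀ i, i ≠ τ j → g.1 i = (c f).1 i) ↔
      ∃ f', c f' = g ∧ ∀ i, i ≠ j → f'.1 i = f.1 i) :
    FacesVanish (Finsupp.comapDomain c z hc.injOn : Chain R q l) := by
  classical
  rw [facesVanish_iff_sum] at hz ⊢
  intro j f
  rw [← hz (τ j) (c f)]
  refine Finset.sum_nbij c ?_ hc.injOn ?_ (fun _ _ => rfl)
  · intro a ha
    rw [Finset.mem_filter, Finsupp.comapDomain_support, Finset.mem_preimage] at ha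
    exact Finset.mem_filter.2 ⟨ha.1, (h j f _).2 ⟨a, rfl, ha.2⟩⟩
  · intro g hg
    rw [Finset.mem_coe, Finset.mem_filter] at hg
    obtain ⟨f', rfl, hf'⟩ := (h j f g).1 hg.2
    refine ⟨f', ?_, rfl⟩
    rw [Finset.mem_coe, Finset.mem_filter, Finsupp.comapDomain_support, Finset.mem_preimage]
    exact ⟨hg.1, hf'⟩

/-- The exactness argument for tensor products needs the cycles as a kernel. For `k = 0`, where
everything is a cycle, the zero map serves. -/
theorem exists_cycles_eq_ker (R : Type u) [CommRing R] (p : Submodule F V → Prop) (k : ℕ) :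
    ∃ (δ : Type u) (d : Chain R p k →ₗ[R] (δ →₀ R)), cycles R p k = LinearMap.ker d := by
  cases k with
  | zero => exact ⟨PEmpty, 0, LinearMap.ker_zero.symm⟩
  | succ k => exact ⟨_, boundary R p k, rfl⟩

end Faces

/-! ### Tensor products of cycle modules as functions of two variables. -/

section Bicycles

variable {R : Type u} [CommRing R] {α β δ : Type u}

theorem finsuppTensorFinsupp'_tmul (x : α →₀ R) (y : β →₀ R) (p : α × β) :
    finsuppTensorFinsupp' R α β (x ⊗ₜ y) p = x p.1 * y p.2 := by
  obtain ⟨a, b⟩ := p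
  simp

/-- Elements of the tensor product of two submodules of free modules, as functions. -/
noncomputable def bicycle (S : Submodule R (α →₀ R)) (T : Submodule R (β →₀ R)) :
    S ⊗[R] T →ₗ[R] (α × β →₀ R) :=
  (finsuppTensorFinsupp' R α β).toLinearMap ∘ₗ TensorProduct.map S.subtype T.subtype

variable {S : Submodule R (α →₀ R)} {T : Submodule R (β →₀ R)}

/-- Pass through `S ⊗ (β →₀ R)`: the first step is injective because `S` is flat, the second because
`β →₀ R` is free. No flatness of `T` enters. -/
theorem bicycle_injective [Module.Flat R S] : Function.Injective (bicycle S T) := by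
  have h : TensorProduct.map S.subtype T.subtype
      = S.subtype.rTensor (β →₀ R) ∘ₗ T.subtype.lTensor S := by
    rw [LinearMap.rTensor_comp_lTensor]
  rw [bicycle, h]
  have h1 : Function.Injective (S.subtype.rTensor (β →₀ R)) :=
    Module.Flat.rTensor_preserves_injective_linearMap S.subtype S.injective_subtype
  have h2 : Function.Injective (T.subtype.lTensor S) :=
    Module.Flat.lTensor_preserves_injective_linearMap T.subtype T.injective_subtype
  exact (finsuppTensorFinsupp' R α β).injective.comp (h1.comp h2)

open Classical in
theorem finsuppScalarLeft_symm (t : α × β →₀ R) (a : α) (b : β) :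
    TensorProduct.finsuppScalarLeft R (β →₀ R) α ((finsuppTensorFinsupp' R α β).symm t) a b
      = t (a, b) := by
  classical
  induction t using Finsupp.induction_linear with
  | zero => simp
  | add x y hx hy => simp only [map_add, Finsupp.add_apply, hx, hy]
  | single p r =>
    obtain ⟨a', b'⟩ := p
    rw [finsuppTensorFinsupp'_symm_single_eq_single_one_tmul]
    by_cases h1 : a' = a <;> by_cases h2 : b' = b <;> simp [h1, h2]

/-- Because its columns lie in `S`, the function `t` comes from `S ⊗ (β →₀ R)`. Its rows are killed
by `d`, so its image in `S ⊗ (δ →₀ R)` dies in `(α →₀ R) ⊗ (δ →₀ R)` and is therefore zero, `δ →₀ R`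
being flat. Tensoring `T → (β →₀ R) → (δ →₀ R)` with the flat module `S` preserves exactness, so `t`
comes from `S ⊗ T`. -/
theorem mem_range_bicycle [Module.Flat R S] (d : (β →₀ R) →ₗ[R] (δ →₀ R))
    (hT : T = LinearMap.ker d) (t : α × β →₀ R)
    (h1 : ∀ b, Finsupp.comapDomain (fun a => (a, b)) t (Prod.mk_left_injective b).injOn ∈ S)
    (h2 : ∀ a, Finsupp.comapDomain (fun b => (a, b)) t (Prod.mk_right_injective a).injOn ∈ T) :
    ∃ x, bicycle S T x = t := by
  classical
  let t1 : S ⊗[R] (β →₀ R) :=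
    ∑ b ∈ t.support.image Prod.snd, (⟨_, h1 b⟩ : S) ⊗ₜ Finsupp.single b (1 : R)
  have ht1 : finsuppTensorFinsupp' R α β (S.subtype.rTensor (β →₀ R) t1) = t := by
    ext ⟨a, b⟩
    simp only [t1, map_sum, LinearMap.rTensor_tmul, Finsupp.finsetSum_apply, finsuppTensorFinsupp'_tmul]
    simp only [Submodule.subtype_apply, Finsupp.comapDomain_apply, Finsupp.single_apply, mul_ite, mul_one, mul_zero]
    rw [Finset.sum_ite_eq']
    split_ifs with h
    · rfl
    · by_contra hne
      exact h (Finset.mem_image.2 ⟨(a, b), Finsupp.mem_support_iff.2 (Ne.symm hne), rfl⟩)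
  have ht2 : d.lTensor S t1 = 0 := by
    have ht1' : S.subtype.rTensor (β →₀ R) t1 = (finsuppTensorFinsupp' R α β).symm t :=
      (LinearEquiv.eq_symm_apply _).2 ht1
    apply Module.Flat.rTensor_preserves_injective_linearMap (M := δ →₀ R) S.subtype
      S.injective_subtype
    rw [map_zero, ← LinearMap.comp_apply, LinearMap.rTensor_comp_lTensor,
      ← LinearMap.lTensor_comp_rTensor, LinearMap.comp_apply, ht1']
    apply (TensorProduct.finsuppScalarLeft R (δ →₀ R) α).injective
    ext1 a
    rw [map_zero, Finsupp.zero_apply]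
    have key : ∀ y : (α →₀ R) ⊗[R] (β →₀ R), TensorProduct.finsuppScalarLeft R (δ →₀ R) α (d.lTensor (α →₀ R) y) a
       = d (TensorProduct.finsuppScalarLeft R (β →₀ R) α y a) := by
      intro y
      induction y using TensorProduct.induction_on with
      | zero => simp
      | add x y hx hy => simp only [map_add, Finsupp.add_apply, hx, hy]
      | tmul x y => simp
    rw [key]
    have h3 := h2 a
    rw [hT, LinearMap.mem_ker] at h3
    convert h3
    ext b
    rw [finsuppScalarLeft_symm, Finsupp.comapDomain_apply]
  have hex : Function.Exact (⇑T.subtype) (⇑d) := by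
    rw [LinearMap.exact_iff, ← hT, Submodule.range_subtype]
  obtain ⟨x, hx⟩ := (Module.Flat.lTensor_exact (R := R) (M := S) (N := T) (N' := β →₀ R) (N'' := δ →₀ R)
    (f := T.subtype) (g := d) hex t1).1 ht2
  refine ⟨x, ?_⟩
  rw [← ht1, ← hx, ← LinearMap.comp_apply (S.subtype.rTensor _), LinearMap.rTensor_comp_lTensor]
  rfl

end Bicycles
end SteinbergStability

/-! ### A criterion for modules of functions to be induced. -/

namespace SteinbergStability

section InducedBijective

variable {R G α β γ δ : Type u} [CommRing R] [Group G]
  {S : Submodule R (α →₀ R)} {T : Submodule R (β →₀ R)} {N : Submodule R (γ →₀ R)}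

/-- A criterion for a representation `N` of `G` on a space of functions to be induced from a
subgroup `K`. The functions in `N` are determined by their values on a set `O`, which is the
disjoint union of the translates of the image of an injective map `J`, indexed by `G ⧸ K`. -/
theorem induced_bijective [Module.Flat R S] (d : (β →₀ R) →ₗ[R] (δ →₀ R))
    (hT : T = LinearMap.ker d) (ρ : Representation R G N) (act : G → γ → γ)
    (act_one : ∀ F, act 1 F = F) (act_mul : ∀ g h F, act (g * h) F = act g (act h F))
    (hρ : ∀ g z F, (ρ g z).1 (act g F) = z.1 F) (Θ : S ⊗[R] T →ₗ[R] N)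
    (J : α × β → γ) (hJ : Function.Injective J) (O : Set γ) (K : Subgroup G) {ε : R}
    (hε : IsUnit ε) (hΘ : ∀ x p, (Θ x).1 (J p) = ε * bicycle S T x p)
    (hΘ' : ∀ x, ∀ F ∈ O, F ∉ Set.range J → (Θ x).1 F = 0)
    (hO : ∀ z : N, (∀ F ∈ O, z.1 F = 0) → z = 0)
    (hactO : ∀ g, ∀ F ∈ O, act g F ∈ O) (hJO : ∀ p, J p ∈ O)
    (hcover : ∀ F ∈ O, ∃ g p, F = act g (J p))
    (hK : ∀ g p p', act g (J p) = J p' → g ∈ K)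
    (hK' : ∀ g ∈ K, ∀ p, act g (J p) ∈ Set.range J)
    (hS : ∀ (z : N) b, Finsupp.comapDomain (fun a => J (a, b)) z.1
      (hJ.comp (Prod.mk_left_injective b)).injOn ∈ S)
    (hT' : ∀ (z : N) a, Finsupp.comapDomain (fun b => J (a, b)) z.1
      (hJ.comp (Prod.mk_right_injective a)).injOn ∈ T) :
    Function.Bijective (Finsupp.lsum R fun c : G ⧸ K => ρ c.out ∘ₗ Θ :
      (G ⧸ K →₀ S ⊗[R] T) →ₗ[R] N) := by
  classical
  have hρ' : ∀ g h z F, (ρ g z).1 (act h F) = z.1 (act (g⁻¹ * h) F) := by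
    intro g h z F
    rw [← hρ g z, ← act_mul, mul_inv_cancel_left]
  have hdiag : ∀ (c : G ⧸ K) x p, (ρ c.out (Θ x)).1 (act c.out (J p)) = ε * bicycle S T x p := by
    intro c x p
    rw [hρ, hΘ]
  -- Translated back by `c.out`, the flag remains in `O`. If it were in the image of `J`, then `hK`
  -- would identify the two cosets; so it is not, and `hΘ'` applies.
  have hoff : ∀ (c c' : G ⧸ K) x p, c ≠ c' → (ρ c.out (Θ x)).1 (act c'.out (J p)) = 0 := by
    intro c c' x p hne
    rw [hρ']
    refine hΘ' x _ (hactO _ _ (hJO p)) ?_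
    rintro ⟨p', hp'⟩
    apply hne
    have := hK _ _ _ hp'.symm
    rw [← QuotientGroup.eq, QuotientGroup.out_eq', QuotientGroup.out_eq'] at this
    exact this
  have heval : ∀ (x : G ⧸ K →₀ S ⊗[R] T) (c : G ⧸ K) p,
      ((Finsupp.lsum R fun c : G ⧸ K => ρ c.out ∘ₗ Θ) x : N).1 (act c.out (J p))
        = ε * bicycle S T (x c) p := by
    intro x c p
    induction x using Finsupp.induction_linear with
    | zero => simp
    | add x y hx hy =>
      rw [map_add, Submodule.coe_add, Finsupp.add_apply, hx, hy, Finsupp.add_apply, map_add,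
        Finsupp.add_apply, mul_add]
    | single c' x =>
      rw [Finsupp.lsum_single, LinearMap.comp_apply, Finsupp.single_apply]
      split_ifs with h
      · subst h; exact hdiag _ _ _
      · rw [hoff _ _ _ _ h, map_zero, Finsupp.zero_apply, mul_zero]
  constructor
  · intro x x' hx
    ext1 c
    apply bicycle_injective
    ext p
    have h := heval x c p
    rw [hx, heval] at h
    exact hε.mul_left_cancel h.symm
  · intro z
    -- The component at `c` can only be `z` translated back by `c.out` and restricted along `J`, up
    -- to the unit `ε`. The row and column conditions make this restriction a tensor.
    have hloc : ∀ c : G ⧸ K, ∃ x : S ⊗[R] T,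
        ∀ p, bicycle S T x p = z.1 (act c.out (J p)) := by
      intro c
      obtain ⟨x, hx⟩ := mem_range_bicycle (S := S) d hT
        (Finsupp.comapDomain J (ρ c.out⁻¹ z).1 hJ.injOn)
        (fun b => by convert hS (ρ c.out⁻¹ z) b using 1; ext; rfl)
        (fun a => by convert hT' (ρ c.out⁻¹ z) a using 1; ext; rfl)
      refine ⟨x, fun p => ?_⟩
      rw [hx, Finsupp.comapDomain_apply]
      have := hρ' c.out⁻¹ 1 z (J p)
      rwa [act_one, inv_inv, mul_one] at this
    choose y hy using hloc
    -- Each coset with nonzero component supplies an element of the finite support of `z`, and `hK`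
    -- makes these elements distinct.
    have hfin : Set.Finite {c : G ⧸ K | y c ≠ 0} := by
      have h1 : ∀ c : G ⧸ K, y c ≠ 0 → ∃ p, z.1 (act c.out (J p)) ≠ 0 := by
        intro c hc
        by_contra! hcon
        refine hc (bicycle_injective ?_)
        ext p
        rw [hy, hcon, map_zero, Finsupp.zero_apply]
      choose q hq using fun c : {c : G ⧸ K | y c ≠ 0} => h1 c.1 c.2
      refine Finite.of_injective (β := z.1.support)
        (fun c => ⟨act c.1.out (J (q c)), Finsupp.mem_support_iff.2 (hq c)⟩) ?_
      intro c c' h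
      have h' : act c.1.out (J (q c)) = act c'.1.out (J (q c')) := congrArg Subtype.val h
      have h2 : act (c'.1.out⁻¹ * c.1.out) (J (q c)) = J (q c') := by
        rw [act_mul, h', ← act_mul, inv_mul_cancel, act_one]
      have := hK _ _ _ h2
      rw [← QuotientGroup.eq, QuotientGroup.out_eq', QuotientGroup.out_eq'] at this
      exact Subtype.ext this.symm
    obtain ⟨η, rfl⟩ := hε
    refine ⟨((↑η⁻¹ : R) • Finsupp.ofSupportFinite y hfin : G ⧸ K →₀ S ⊗[R] T), ?_⟩
    -- By `hO` it suffices to compare values on `O`. Each element of `O` is a translate of some `J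
    -- p` by some `g`, and `hK'` allows `g` to be replaced by the representative of its coset.
    rw [← sub_eq_zero]
    refine hO _ fun F hF => ?_
    obtain ⟨g, p, rfl⟩ := hcover F hF
    obtain ⟨k, hk⟩ := QuotientGroup.mk_out_eq_mul K g
    obtain ⟨p', hp'⟩ := hK' _ (inv_mem k.2) p
    have h3 : act g (J p) = act (g : G ⧸ K).out (J p') := by
      rw [hk, hp', ← act_mul, mul_inv_cancel_right]
    rw [h3, Submodule.coe_sub, Finsupp.sub_apply, heval, sub_eq_zero, Finsupp.smul_apply, map_smul,
      Finsupp.smul_apply, smul_eq_mul, Units.mul_inv_cancel_left]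
    exact hy _ _

end InducedBijective
end SteinbergStability

/-! ### Pairs of flags embedded into flags. -/

namespace SteinbergStability

section InducedFlags

variable {F A B V : Type u} [Field F] [AddCommGroup A] [Module F A] [AddCommGroup B] [Module F B]
  [AddCommGroup V] [Module F V] {R : Type u} [CommRing R]
  {pA : Submodule F A → Prop} {pB : Submodule F B → Prop} {pV : Submodule F V → Prop} {a b N : ℕ}

theorem FlagOf.map_injective (g : preserving pV) :
    Function.Injective (FlagOf.map g : FlagOf pV N → FlagOf pV N) := by
  intro f f' h
  have h2 := congrArg (FlagOf.map g⁻¹) h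
  rwa [← FlagOf.map_mul, ← FlagOf.map_mul, inv_mul_cancel, FlagOf.map_one, FlagOf.map_one] at h2

theorem cycleRep_apply_map (g : preserving pV) (z : cycles R pV N) (f : FlagOf pV N) :
    (cycleRep R pV N g z).1 (FlagOf.map g f) = z.1 f :=
  Finsupp.mapDomain_apply (FlagOf.map_injective g) _ _

/-- An embedding of pairs of flags in `A` and `B` into the flags in `V`: the steps in `A` are
recorded at the positions `τA`, those in `B` at the positions `τB`, and the other positions are
occupied by the constants `C`. -/
structure FlagEmbedding (J : FlagOf pA a × FlagOf pB b → FlagOf pV N) (τA : Fin a → Fin N)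
    (τB : Fin b → Fin N) (ψA : Submodule F A → Submodule F V)
    (ψB : Submodule F B → Submodule F V) (C : Fin N → Submodule F V) : Prop where
  injA : Function.Injective τA
  injB : Function.Injective τB
  disjoint : ∀ i j, τA i ≠ τB j
  inj_left : Function.Injective ψA
  inj_right : Function.Injective ψB
  apply_left : ∀ x i, (J x).1 (τA i) = ψA (x.1.1 i)
  apply_right : ∀ x i, (J x).1 (τB i) = ψB (x.2.1 i)
  const : ∀ x t, (∀ i, τA i ≠ t) → (∀ i, τB i ≠ t) → (J x).1 t = C t
  surj : ∀ f : FlagOf pV N,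
    (∀ t, (∀ i, τA i ≠ t) → (∀ i, τB i ≠ t) → f.1 t = C t) → ∃ x, J x = f

namespace FlagEmbedding

variable {J : FlagOf pA a × FlagOf pB b → FlagOf pV N} {τA : Fin a → Fin N}
  {τB : Fin b → Fin N} {ψA : Submodule F A → Submodule F V} {ψB : Submodule F B → Submodule F V}
  {C : Fin N → Submodule F V} (H : FlagEmbedding J τA τB ψA ψB C)

include H

theorem injective : Function.Injective J := by
  intro x y h
  refine Prod.ext (Subtype.ext (funext fun i => H.inj_left ?_))
    (Subtype.ext (funext fun i => H.inj_right ?_))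
  · rw [← H.apply_left, ← H.apply_left, h]
  · rw [← H.apply_right, ← H.apply_right, h]

/-- A flag in the panel of `J (f, g)` at a position `τA j` still has the prescribed constants, so
`surj` writes it as a value of `J`; its entries at the positions `τB` force the second component to
be `g`. Thus the whole panel comes from a panel in `A`. -/
theorem facesVanish_left {z : Chain R pV N} (hz : FacesVanish z) (g : FlagOf pB b) :
    FacesVanish (Finsupp.comapDomain (fun f => J (f, g)) z
      (H.injective.comp (Prod.mk_left_injective g)).injOn : Chain R pA a) := by
  refine hz.comapDomain (fun f => J (f, g)) (H.injective.comp (Prod.mk_left_injective g)) τA ?_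
  intro j f f'
  constructor
  · intro h
    obtain ⟨y, rfl⟩ := H.surj f' fun t h1 h2 => (h t (h1 j).symm).trans (H.const _ t h1 h2)
    refine ⟨y.1, ?_, fun i hi => H.inj_left ?_⟩
    · have e : y.2 = g := Subtype.ext (funext fun i => H.inj_right (by
        rw [← H.apply_right y, h _ (H.disjoint j i).symm, H.apply_right]))
      rw [← e]
    · rw [← H.apply_left y, h _ (H.injA.ne hi), H.apply_left]
  · rintro ⟨f', rfl, h⟩ t ht
    by_cases h1 : ∃ i, τA i = t
    · obtain ⟨i, rfl⟩ := h1
      rw [H.apply_left, H.apply_left, h i fun hij => ht (congrArg τA hij)]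
    · by_cases h2 : ∃ i, τB i = t
      · obtain ⟨i, rfl⟩ := h2
        rw [H.apply_right, H.apply_right]
      · exact (H.const _ t (not_exists.1 h1) (not_exists.1 h2)).trans
          (H.const _ t (not_exists.1 h1) (not_exists.1 h2)).symm

theorem facesVanish_right {z : Chain R pV N} (hz : FacesVanish z) (f : FlagOf pA a) :
    FacesVanish (Finsupp.comapDomain (fun g => J (f, g)) z
      (H.injective.comp (Prod.mk_right_injective f)).injOn : Chain R pB b) := by
  refine hz.comapDomain (fun g => J (f, g)) (H.injective.comp (Prod.mk_right_injective f)) τB ?_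
  intro j g f'
  constructor
  · intro h
    obtain ⟨y, rfl⟩ := H.surj f' fun t h1 h2 => (h t (h2 j).symm).trans (H.const _ t h1 h2)
    refine ⟨y.2, ?_, fun i hi => H.inj_right ?_⟩
    · have e : y.1 = f := Subtype.ext (funext fun i => H.inj_left (by
        rw [← H.apply_left y, h _ (H.disjoint i j), H.apply_left]))
      rw [← e]
    · rw [← H.apply_right y, h _ (H.injB.ne hi), H.apply_right]
  · rintro ⟨f', rfl, h⟩ t ht
    by_cases h1 : ∃ i, τA i = t
    · obtain ⟨i, rfl⟩ := h1
      rw [H.apply_left, H.apply_left]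
    · by_cases h2 : ∃ i, τB i = t
      · obtain ⟨i, rfl⟩ := h2
        rw [H.apply_right, H.apply_right, h i fun hij => ht (congrArg τB hij)]
      · exact (H.const _ t (not_exists.1 h1) (not_exists.1 h2)).trans
          (H.const _ t (not_exists.1 h1) (not_exists.1 h2)).symm

/-- A criterion for the cycles in `V` to be induced from the tensor product of the cycles in `A`
and in `B`, embedded by a signed sum over maps `j i` of flags, only one of which (`j i₀`) meets the
set `O`. -/
theorem induced_bijective {G : Type u} {κ : Type*} [Group G] [Fintype κ] [FiniteDimensional F V]
    [Module.Flat R (cycles R pA a)]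
    (hpV : ∀ W, pV W → W ≠ ⊥) (hpN : ∀ W, pV W → Module.finrank F W ≤ N) (σ : G →* preserving pV)
    (Θ : cycles R pA a ⊗[R] cycles R pB b →ₗ[R] cycles R pV N) (s : κ → R)
    (j : κ → FlagOf pA a × FlagOf pB b → FlagOf pV N)
    (hΘ : ∀ x, (Θ x).1
      = ∑ i, s i • Finsupp.mapDomain (j i) (bicycle (cycles R pA a) (cycles R pB b) x))
    (i₀ : κ) (hJ : j i₀ = J) (hs : IsUnit (s i₀)) (O : Set (FlagOf pV N))
    (hjO : ∀ i x, j i x ∈ O → i = i₀) (hJO : ∀ x, J x ∈ O)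
    (hO : ∀ z : Chain R pV N, FacesVanish z → (∀ f ∈ O, z f = 0) → z = 0)
    (hactO : ∀ g, ∀ f ∈ O, FlagOf.map (σ g) f ∈ O)
    (hcover : ∀ f ∈ O, ∃ g x, f = FlagOf.map (σ g) (J x)) (K : Subgroup G)
    (hK : ∀ g x y, FlagOf.map (σ g) (J x) = J y → g ∈ K)
    (hK' : ∀ g ∈ K, ∀ x, FlagOf.map (σ g) (J x) ∈ Set.range J) :
    Function.Bijective (Finsupp.lsum R fun c : G ⧸ K => (cycleRep R pV N).comp σ c.out ∘ₗ Θ :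
      (G ⧸ K →₀ cycles R pA a ⊗[R] cycles R pB b) →ₗ[R] cycles R pV N) := by
  classical
  obtain ⟨δ, d, hd⟩ := exists_cycles_eq_ker R pB b
  subst hJ
  -- On `O` only the term `i₀` survives, so there `Θ` is a unit multiple of `bicycle` carried along
  -- `J`.
  have key : ∀ i x (f : FlagOf pV N), f ∈ O → i ≠ i₀ →
      Finsupp.mapDomain (j i) (bicycle (cycles R pA a) (cycles R pB b) x) f = 0 := by
    intro i x f hf hi
    apply Finsupp.mapDomain_of_notMem_range
    rintro ⟨y, rfl⟩
    exact hi (hjO i y hf)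
  have hval : ∀ x (f : FlagOf pV N), f ∈ O → (Θ x).1 f
      = s i₀ * Finsupp.mapDomain (j i₀) (bicycle (cycles R pA a) (cycles R pB b) x) f := by
    intro x f hf
    rw [hΘ, Finsupp.finsetSum_apply, Finset.sum_eq_single i₀]
    · rfl
    · intro i _ hi
      rw [Finsupp.smul_apply, key i x f hf hi, smul_zero]
    · exact fun h => absurd (Finset.mem_univ _) h
  refine SteinbergStability.induced_bijective d hd ((cycleRep R pV N).comp σ) (fun g => FlagOf.map (σ g))
    (fun f => ?_) (fun g h f => ?_) (fun g z f => cycleRep_apply_map _ _ _) Θ (j i₀) H.injective O K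
    hs ?_ ?_ ?_ hactO hJO hcover hK hK' ?_ ?_
  · rw [map_one, FlagOf.map_one]
  · rw [map_mul, FlagOf.map_mul]
  · intro x p
    rw [hval x _ (hJO p), Finsupp.mapDomain_apply H.injective]
  · intro x f hf hr
    rw [hval x f hf, Finsupp.mapDomain_of_notMem_range _ _ hr, mul_zero]
  · intro z hz
    exact Subtype.ext (hO z.1 (facesVanish_of_mem_cycles hpV hpN z.2) hz)
  · intro z g
    exact mem_cycles_of_facesVanish
      (H.facesVanish_left (facesVanish_of_mem_cycles hpV hpN z.2) g)
  · intro z f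
    exact mem_cycles_of_facesVanish
      (H.facesVanish_right (facesVanish_of_mem_cycles hpV hpN z.2) f)

end FlagEmbedding

end InducedFlags
end SteinbergStability

/-! ### Minimal flags and dimensions of intersections. -/

namespace SteinbergStability

section Vertices

variable {F V : Type u} [Field F] [AddCommGroup V] [Module F V] {R : Type u} [CommRing R]
  {p : Submodule F V → Prop} {k : ℕ}

theorem vertex_succ (f : Fin k → Submodule F V) (i : Fin k) : vertex f (i + 1) = f i := by
  simp [vertex]

theorem vertex_of_lt (f : Fin k → Submodule F V) {i : ℕ} (hi : k < i) : vertex f i = ⊤ := by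
  rw [vertex, if_neg (by omega), dif_neg (by omega)]

theorem FlagOf.vertex_map (g : preserving p) (f : FlagOf p k) (i : ℕ) :
    vertex (FlagOf.map g f).1 i = (vertex f.1 i).map (g.1 : V →ₗ[F] V) :=
  SteinbergStability.vertex_map g.1 f.1 i

/-- A chain all of whose faces vanish has in its support a simplex of minimal weight; it can be
changed at each position without decreasing the weight of the vertex there. -/
theorem FacesVanish.exists_minimal {z : Chain R p k} (hz : FacesVanish z) (h0 : z ≠ 0)
    (wt : Submodule F V → ℕ) : ∃ f, z f ≠ 0 ∧ ∀ t, 1 ≤ t → t ≤ k → ∃ g : FlagOf p k,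
      vertex g.1 t ≠ vertex f.1 t ∧ (∀ i, i ≠ t → vertex g.1 i = vertex f.1 i) ∧
      wt (vertex f.1 t) ≤ wt (vertex g.1 t) := by
  obtain ⟨f, hf, hmin⟩ := Finset.exists_min_image z.support
    (fun f => ∑ i, wt (f.1 i)) (Finsupp.support_nonempty_iff.2 h0)
  rw [Finsupp.mem_support_iff] at hf
  refine ⟨f, hf, fun t h1 h2 => ?_⟩
  obtain ⟨j, rfl⟩ : ∃ j : Fin k, t = j + 1 := ⟨⟨t - 1, by omega⟩, by simp; omega⟩
  obtain ⟨g, hg, hne, heq⟩ := hz.exists_ne hf j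
  refine ⟨g, by rwa [vertex_succ, vertex_succ], fun i hi => ?_, ?_⟩
  · by_cases hi0 : i = 0
    · rw [hi0, vertex_zero, vertex_zero]
    · by_cases hik : i ≤ k
      · obtain ⟨i, rfl⟩ : ∃ i' : Fin k, i = i' + 1 := ⟨⟨i - 1, by omega⟩, by simp; omega⟩
        rw [vertex_succ, vertex_succ, heq]
        rintro rfl; exact hi rfl
      · rw [vertex_of_lt _ (by omega), vertex_of_lt _ (by omega)]
  · have h := hmin g (Finsupp.mem_support_iff.2 hg)
    rw [← Finset.add_sum_erase _ _ (Finset.mem_univ j),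
      ← Finset.add_sum_erase _ (fun i => wt (g.1 i)) (Finset.mem_univ j)] at h
    have h3 : ∑ i ∈ Finset.univ.erase j, wt (g.1 i) = ∑ i ∈ Finset.univ.erase j, wt (f.1 i) :=
      Finset.sum_congr rfl fun i hi => by rw [heq i (Finset.ne_of_mem_erase hi)]
    rw [vertex_succ, vertex_succ]
    omega

end Vertices

section Dimensions

variable {F V : Type u} [Field F] [AddCommGroup V] [Module F V] [FiniteDimensional F V]

open Module

/-- The quotient of `Q ⊓ A` by `P ⊓ A` embeds into the quotient of `Q` by `P`. Along a full flag the
dimension of the intersection with `A` therefore rises by at most one at each step. -/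
theorem finrank_inf_add_le {P Q : Submodule F V} (h : P ≤ Q) (A : Submodule F V) :
    finrank F (Q ⊓ A : Submodule F V) + finrank F P
      ≤ finrank F (P ⊓ A : Submodule F V) + finrank F Q := by
  have h1 := Submodule.finrank_sup_add_finrank_inf_eq (Q ⊓ A) P
  have h2 : (Q ⊓ A) ⊓ P = P ⊓ A := by
    rw [inf_right_comm, inf_eq_right.2 h]
  have h3 : finrank F (Q ⊓ A ⊔ P : Submodule F V) ≤ finrank F Q :=
    Submodule.finrank_mono (sup_le inf_le_left h)
  rw [h2] at h1
  omega

theorem finrank_inf_mono {P Q : Submodule F V} (h : P ≤ Q) (A : Submodule F V) :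
    finrank F (P ⊓ A : Submodule F V) ≤ finrank F (Q ⊓ A : Submodule F V) :=
  Submodule.finrank_mono (inf_le_inf_right A h)

/-- Two subspaces of equal dimension between `P` and `Q`. -/
theorem inf_le_of_finrank_eq {P L L' Q : Submodule F V} (hPL : P ≤ L) (hLQ : L ≤ Q) (hPL' : P ≤ L')
    (hLQ' : L' ≤ Q) (hL : finrank F L = finrank F P + 1) (hL' : finrank F L' = finrank F P + 1)
    (hne : L' ≠ L) {A : Submodule F V}
    (h : finrank F (L ⊓ A : Submodule F V) = finrank F (Q ⊓ A : Submodule F V)) : L' ⊓ A ≤ P := by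
  -- All of `Q ⊓ A` already lies in `L`, so `L' ⊓ A` lies in `L ⊓ L'`. This is `P`, as `L` and `L'`
  -- are distinct and one dimension larger than `P`.
  have h1 : L ⊓ A = Q ⊓ A := Submodule.eq_of_le_of_finrank_eq (inf_le_inf_right A hLQ) h
  have h2 : L' ⊓ A ≤ L ⊓ L' :=
    le_inf ((inf_le_inf_right A hLQ').trans (h1 ▸ inf_le_left)) inf_le_left
  have h3 : P = L ⊓ L' := by
    refine Submodule.eq_of_le_of_finrank_le (le_inf hPL hPL') ?_
    by_contra hlt
    have h4 : finrank F L ≤ finrank F (L ⊓ L' : Submodule F V) := by omega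
    have h5 := Submodule.eq_of_le_of_finrank_le inf_le_left h4
    exact hne (Submodule.eq_of_le_of_finrank_eq (inf_eq_left.1 h5) (hL.trans hL'.symm)).symm
  rwa [h3]

/-- If the dimension jumped from `P` to `L` but not from `L` to `Q`, exchanging `L` for `L'` would
lower the weight. For a jump in `E`, both intersections of `L'` shrink into `P`. For a jump in `A`,
the intersection with `A` shrinks, and the one with `E` cannot grow in exchange: since `A ≤ E`,
there was a jump in `E` at `L` as well, and `L'` gains at most one dimension over `P`. -/
theorem finrank_inf_of_minimal {P L L' Q A E : Submodule F V} (hPL : P ≤ L) (hLQ : L ≤ Q)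
    (hPL' : P ≤ L') (hLQ' : L' ≤ Q) (hL : finrank F L = finrank F P + 1)
    (hL' : finrank F L' = finrank F P + 1)
    (hne : L' ≠ L) (hAE : A ≤ E)
    (hmin : finrank F (L ⊓ E : Submodule F V) + finrank F (L ⊓ A : Submodule F V)
      ≤ finrank F (L' ⊓ E : Submodule F V) + finrank F (L' ⊓ A : Submodule F V)) :
    (finrank F (L ⊓ E : Submodule F V) = finrank F (Q ⊓ E : Submodule F V) →
      finrank F (L ⊓ E : Submodule F V) = finrank F (P ⊓ E : Submodule F V)) ∧
    (finrank F (L ⊓ A : Submodule F V) = finrank F (Q ⊓ A : Submodule F V) →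
      finrank F (L ⊓ A : Submodule F V) = finrank F (P ⊓ A : Submodule F V)) := by
  have e1 := finrank_inf_mono hPL E
  have a1 := finrank_inf_mono hPL A
  constructor
  · intro h
    have h1 := inf_le_of_finrank_eq hPL hLQ hPL' hLQ' hL hL' hne h
    have h2 : finrank F (L' ⊓ E : Submodule F V) ≤ finrank F (P ⊓ E : Submodule F V) :=
      Submodule.finrank_mono (le_inf h1 inf_le_right)
    have h3 : finrank F (L' ⊓ A : Submodule F V) ≤ finrank F (P ⊓ A : Submodule F V) :=
      Submodule.finrank_mono (le_inf ((inf_le_inf_left L' hAE).trans h1) inf_le_right)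
    omega
  · intro h
    have h1 := inf_le_of_finrank_eq hPL hLQ hPL' hLQ' hL hL' hne h
    have h2 : finrank F (L' ⊓ A : Submodule F V) ≤ finrank F (P ⊓ A : Submodule F V) :=
      Submodule.finrank_mono (le_inf h1 inf_le_right)
    have h3 := finrank_inf_add_le hPL' E
    by_contra hcon
    have h4 : P ⊓ E < L ⊓ E := by
      refine lt_of_le_of_ne (inf_le_inf_right E hPL) fun heq => hcon ?_
      have h5 : L ⊓ A ≤ P ⊓ A :=
        le_inf (((inf_le_inf_left L hAE).trans heq.ge).trans inf_le_left) inf_le_right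
      have := Submodule.finrank_mono h5
      omega
    have h5 := Submodule.finrank_lt_finrank_of_lt h4
    omega

/-- A sequence of integers with increments `0` and `1`, in which an increment `1` is never followed
by an increment `0`. -/
theorem eq_zero_or_of_no_descent {d : ℕ → ℕ} {n : ℕ} (h0 : d 0 = 0)
    (hmono : ∀ i < n, d i ≤ d (i + 1)) (hstep : ∀ i < n, d (i + 1) ≤ d i + 1)
    (hno : ∀ i, i + 2 ≤ n → d (i + 1) = d (i + 2) → d (i + 1) = d i) {i : ℕ} (hi : i ≤ n) :
    d i = 0 ∨ d n = d i + (n - i) := by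
  -- Once an increment is `1`, all later ones are.
  have key : ∀ j, j + 1 ≤ n → d j < d (j + 1) → ∀ c, j + c + 1 ≤ n →
      d (j + c) < d (j + c + 1) ∧ d (j + c + 1) = d (j + 1) + c := by
    intro j hj hlt c
    induction c with
    | zero => exact fun _ => ⟨hlt, rfl⟩
    | succ c ih =>
      intro hc
      have ih := ih (by omega)
      have h1 := hno (j + c) (by omega)
      have h2 := hstep (j + c + 1) (by omega)
      have h3 := hmono (j + c + 1) (by omega)
      rw [show j + (c + 1) = j + c + 1 by omega]
      change d (j + c + 1 + 1) ≤ d (j + c + 1) + 1 at h2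
      change d (j + c + 1) = d (j + c + 1 + 1) → _ at h1
      omega
  by_cases h : ∃ j < i, d j < d (j + 1)
  · obtain ⟨j, hj, hlt⟩ := h
    right
    have h1 := (key j (by omega) hlt (n - (j + 1)) (by omega)).2
    have h2 := (key j (by omega) hlt (i - (j + 1)) (by omega)).2
    rw [show j + (n - (j + 1)) + 1 = n by omega] at h1
    rw [show j + (i - (j + 1)) + 1 = i by omega] at h2
    omega
  · left
    push Not at h
    have : ∀ j ≤ i, d j = 0 := by
      intro j
      induction j with
      | zero => exact fun _ => h0
      | succ j ih => intro hj; have := ih (by omega); have := h j (by omega); omega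
    exact this i le_rfl

end Dimensions

/-! ### Decompositions `V = A ⊕ B` and shears. -/

section Blocks

variable {F A B V : Type u} [Field F] [AddCommGroup A] [Module F A] [AddCommGroup B] [Module F B]
  [AddCommGroup V] [Module F V] (e : (A × B) ≃ₗ[F] V)

/-- The subspace `U ⊕ W` of `V = A ⊕ B`. -/
def block (U : Submodule F A) (W : Submodule F B) : Submodule F V :=
  (U.prod W).map (e : (A × B) →ₗ[F] V)

variable {e} {U U' : Submodule F A} {W W' : Submodule F B} {X : Submodule F V}

theorem mem_block {x : A × B} : e x ∈ block e U W ↔ x.1 ∈ U ∧ x.2 ∈ W := by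
  rw [block, Submodule.mem_map]
  constructor
  · rintro ⟨y, hy, hyx⟩
    rw [← e.injective hyx]
    exact hy
  · intro h
    exact ⟨x, h, rfl⟩

theorem le_iff_forall_apply {X Y : Submodule F V} : X ≤ Y ↔ ∀ x, e x ∈ X → e x ∈ Y :=
  ⟨fun h _ hx => h hx, fun h v hv => by
    obtain ⟨x, rfl⟩ := e.surjective v
    exact h x hv⟩

theorem block_le_block : block e U W ≤ block e U' W' ↔ U ≤ U' ∧ W ≤ W' := by
  rw [le_iff_forall_apply (e := e)]
  simp only [mem_block]
  constructor
  · intro h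
    exact ⟨fun a ha => (h (a, 0) ⟨ha, W.zero_mem⟩).1, fun b hb => (h (0, b) ⟨U.zero_mem, hb⟩).2⟩
  · rintro ⟨h1, h2⟩ x ⟨hx1, hx2⟩
    exact ⟨h1 hx1, h2 hx2⟩

theorem block_inj : block e U W = block e U' W' ↔ U = U' ∧ W = W' := by
  rw [le_antisymm_iff, block_le_block, block_le_block, le_antisymm_iff, le_antisymm_iff]
  tauto

theorem block_lt_block_left : block e U W < block e U' W ↔ U < U' := by
  rw [lt_iff_le_not_ge, lt_iff_le_not_ge, block_le_block, block_le_block]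
  tauto

theorem block_lt_block_right : block e U W < block e U W' ↔ W < W' := by
  rw [lt_iff_le_not_ge, lt_iff_le_not_ge, block_le_block, block_le_block]
  tauto

theorem block_bot : block e ⊥ ⊥ = ⊥ := by
  rw [block, Submodule.prod_bot, Submodule.map_bot]

theorem block_top : block e ⊤ ⊤ = ⊤ := by
  rw [block, Submodule.prod_top, Submodule.map_top]
  exact LinearEquiv.range e

theorem exists_eq_block_of_ge (h : block e ⊥ ⊤ ≤ X) : ∃ U, X = block e U ⊤ := by
  refine ⟨X.comap ((e : (A × B) →ₗ[F] V) ∘ₗ LinearMap.inl F A B), ?_⟩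
  have key : ∀ a b, e (a, b) ∈ X ↔ e (a, 0) ∈ X := by
    intro a b
    have h1 : e (a, b) = e (a, 0) + e (0, b) := by rw [← map_add]; simp
    rw [h1]
    exact X.add_mem_iff_left (h (mem_block.2 ⟨rfl, trivial⟩))
  refine le_antisymm ?_ ?_ <;> rw [le_iff_forall_apply (e := e)] <;> rintro ⟨a, b⟩ hx
  · exact mem_block.2 ⟨(key a b).1 hx, trivial⟩
  · exact (key a b).2 (mem_block.1 hx).1

theorem exists_eq_block_of_le (h : X ≤ block e ⊥ ⊤) : ∃ W, X = block e ⊥ W := by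
  refine ⟨X.comap ((e : (A × B) →ₗ[F] V) ∘ₗ LinearMap.inr F A B), ?_⟩
  refine le_antisymm ?_ ?_ <;> rw [le_iff_forall_apply (e := e)] <;> rintro ⟨a, b⟩ hx
  · have h1 := (mem_block.1 (h hx)).1
    obtain rfl : a = 0 := h1
    exact mem_block.2 ⟨rfl, hx⟩
  · obtain ⟨h1, h2⟩ := mem_block.1 hx
    obtain rfl : a = 0 := h1
    exact h2

/-- Both `γ` and its inverse preserve `B`, so their restrictions to `B` are mutually inverse.
Invertibility needs no finite dimension here. -/
theorem exists_eq_blockHom (γ : V ≃ₗ[F] V) (hA : ∀ a, γ (e (a, 0)) = e (a, 0))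
    (hB : (block e ⊥ ⊤).map (γ : V →ₗ[F] V) = block e ⊥ ⊤) : ∃ h, γ = blockHom e h := by
  have h0 : ∀ (δ : V ≃ₗ[F] V), (block e ⊥ ⊤).map (δ : V →ₗ[F] V) = block e ⊥ ⊤ → ∀ b,
      e (0, (e.symm (δ (e (0, b)))).2) = δ (e (0, b)) := by
    intro δ hδ b
    have h1 : δ (e (0, b)) ∈ block e ⊥ ⊤ := by
      rw [← hδ]
      exact Submodule.mem_map_of_mem (mem_block.2 ⟨rfl, trivial⟩)
    obtain ⟨⟨a, b'⟩, hx⟩ := e.surjective (δ (e (0, b)))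
    rw [← hx, mem_block] at h1
    obtain rfl : a = 0 := h1.1
    rw [← hx, e.symm_apply_apply]
  have hB' : (block e ⊥ ⊤).map (γ.symm : V →ₗ[F] V) = block e ⊥ ⊤ := by
    conv_lhs => rw [← hB, ← Submodule.map_comp]
    convert Submodule.map_id _ using 2
    ext x
    simp
  let s (δ : V ≃ₗ[F] V) : B →ₗ[F] B := LinearMap.snd F A B ∘ₗ (e.symm : V →ₗ[F] (A × B)) ∘ₗ
    (δ : V →ₗ[F] V) ∘ₗ (e : (A × B) →ₗ[F] V) ∘ₗ LinearMap.inr F A B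
  have hs : ∀ (δ : V ≃ₗ[F] V), (block e ⊥ ⊤).map (δ : V →ₗ[F] V) = block e ⊥ ⊤ → ∀ b,
      e (0, s δ b) = δ (e (0, b)) := h0
  have hinj : ∀ b b' : B, e (0, b) = e (0, b') → b = b' := fun b b' h =>
    congrArg Prod.snd (e.injective h)
  let h : B ≃ₗ[F] B := LinearEquiv.ofLinearMap (s γ) (s γ.symm)
    (LinearMap.ext fun b => hinj _ _ (by
      rw [LinearMap.comp_apply, hs γ hB, hs _ hB', γ.apply_symm_apply, LinearMap.id_apply]))
    (LinearMap.ext fun b => hinj _ _ (by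
      rw [LinearMap.comp_apply, hs _ hB', hs γ hB, γ.symm_apply_apply, LinearMap.id_apply]))
  refine ⟨h, LinearEquiv.ext fun v => ?_⟩
  obtain ⟨⟨a, b⟩, rfl⟩ := e.surjective v
  rw [blockHom_apply]
  have h1 : ∀ b', e (a, b') = e (a, 0) + e (0, b') := by
    intro b'; rw [← map_add]; simp
  rw [h1 b, h1 (h b), map_add, hA, ← hs γ hB]
  rfl

theorem blockHom_injective : Function.Injective (blockHom e) := by
  intro g h hgh
  ext b
  have h1 := LinearEquiv.congr_fun hgh (e (0, b))
  rw [blockHom_apply, blockHom_apply] at h1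
  exact congrArg Prod.snd (e.injective h1)

/-- The automorphism `(a, b) ↦ (a + η b, b)` of `A ⊕ B`. -/
def shear (e : (A × B) ≃ₗ[F] V) (η : B →ₗ[F] A) : V ≃ₗ[F] V :=
  (e.symm.trans
    { toFun := fun x => (x.1 + η x.2, x.2)
      map_add' := fun x y => Prod.ext (by simp only [Prod.fst_add, Prod.snd_add, map_add]; abel) rfl
      map_smul' := fun c x => Prod.ext (by simp) rfl
      invFun := fun x => (x.1 - η x.2, x.2)
      left_inv := fun x => by simp
      right_inv := fun x => by simp }).trans e

theorem shear_apply (η : B →ₗ[F] A) (a : A) (b : B) :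
    shear e η (e (a, b)) = e (a + η b, b) := by
  simp [shear]

/-- Such a map is the identity on `W` and on the quotient by `W`, and its determinant is the product
of the two determinants. -/
theorem det_eq_one_of_unipotent [FiniteDimensional F V] (f : V →ₗ[F] V) (W : Submodule F V)
    (h1 : ∀ x ∈ W, f x = x) (h2 : ∀ x, f x - x ∈ W) : LinearMap.det f = 1 := by
  have hW : W ≤ W.comap f := fun x hx => by rw [Submodule.mem_comap, h1 x hx]; exact hx
  have e1 : f.restrict hW = LinearMap.id := LinearMap.ext fun x => Subtype.ext (h1 x.1 x.2)
  have e2 : W.mapQ W f hW = LinearMap.id := by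
    refine Submodule.linearMap_qext _ (LinearMap.ext fun x => ?_)
    exact (Submodule.Quotient.eq W).2 (h2 x)
  rw [LinearMap.det_eq_det_mul_det W f hW, e1, e2, LinearMap.det_id, LinearMap.det_id, one_mul]

theorem det_shear [FiniteDimensional F A] [FiniteDimensional F B] (η : B →ₗ[F] A) :
    LinearEquiv.det (shear e η) = 1 := by
  have : FiniteDimensional F V := Module.Finite.equiv e
  apply Units.ext
  rw [LinearEquiv.coe_det, Units.val_one]
  refine det_eq_one_of_unipotent _ (block e ⊤ ⊥) ?_ ?_
  · intro x hx
    obtain ⟨⟨a, b⟩, rfl⟩ := e.surjective x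
    obtain rfl : b = 0 := (mem_block.1 hx).2
    rw [LinearEquiv.coe_coe, shear_apply, map_zero, add_zero]
  · intro x
    obtain ⟨⟨a, b⟩, rfl⟩ := e.surjective x
    rw [LinearEquiv.coe_coe, shear_apply, ← map_sub, mem_block]
    exact ⟨trivial, sub_self b⟩

theorem finrank_block_bot_top : Module.finrank F (block e ⊥ ⊤) = Module.finrank F B := by
  rw [block, LinearEquiv.finrank_map_eq, ← Submodule.map_inr, Submodule.map_top]
  exact LinearMap.finrank_range_of_inj LinearMap.inr_injective

theorem finrank_block_top_bot : Module.finrank F (block e ⊤ ⊥) = Module.finrank F A := by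
  rw [block, LinearEquiv.finrank_map_eq, ← Submodule.map_inl, Submodule.map_top]
  exact LinearMap.finrank_range_of_inj LinearMap.inl_injective

/-- A complement of `A` in `A ⊕ B` is the image of `B` under a shear. -/
theorem exists_map_shear_eq [FiniteDimensional F A] [FiniteDimensional F B] {X : Submodule F V}
    (h0 : X ⊓ block e ⊤ ⊥ = ⊥) (hX : Module.finrank F X = Module.finrank F B) :
    ∃ η : B →ₗ[F] A, (block e ⊥ ⊤).map (shear e η : V →ₗ[F] V) = X := by
  -- Projection along `A` is injective on `X`, hence an isomorphism onto `B` by dimension. So `X` is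
  -- a graph over `B`, and `η` is the function of which it is the graph.
  let π : X →ₗ[F] B := LinearMap.snd F A B ∘ₗ (e.symm : V →ₗ[F] (A × B)) ∘ₗ X.subtype
  have hπ : Function.Injective π := by
    rw [← LinearMap.ker_eq_bot, LinearMap.ker_eq_bot']
    intro x hx
    obtain ⟨⟨a, b⟩, hab⟩ := e.surjective x.1
    have h1 : π x = b := by
      change (e.symm x.1).2 = b
      rw [← hab, e.symm_apply_apply]
    have h2 : x.1 ∈ X ⊓ block e ⊤ ⊥ :=
      ⟨x.2, by rw [← hab, SetLike.mem_coe, mem_block]; exact ⟨trivial, h1.symm.trans hx⟩⟩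
    rw [h0] at h2
    exact Subtype.ext h2
  have : FiniteDimensional F V := Module.Finite.equiv e
  let ε : X ≃ₗ[F] B := LinearEquiv.ofInjectiveOfFinrankEq π hπ hX
  refine ⟨LinearMap.fst F A B ∘ₗ (e.symm : V →ₗ[F] (A × B)) ∘ₗ X.subtype ∘ₗ
    (ε.symm : B →ₗ[F] X), ?_⟩
  refine Submodule.eq_of_le_of_finrank_eq ?_ ?_
  · rintro _ ⟨v, hv, rfl⟩
    obtain ⟨⟨a, b⟩, rfl⟩ := e.surjective v
    obtain rfl : a = 0 := (mem_block.1 hv).1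
    obtain ⟨x, rfl⟩ := ε.surjective b
    have h1 : e (0 + (e.symm x.1).1, ε x) = x.1 := by
      rw [zero_add]
      exact e.apply_symm_apply x.1
    have h2 := shear_apply (e := e) (LinearMap.fst F A B ∘ₗ (e.symm : V →ₗ[F] (A × B)) ∘ₗ
      X.subtype ∘ₗ (ε.symm : B →ₗ[F] X)) 0 (ε x)
    simp only [LinearMap.comp_apply, LinearEquiv.coe_coe, ε.symm_apply_apply] at h2 ⊢
    rw [h2]
    exact h1 ▸ x.2
  · rw [hX, LinearEquiv.finrank_map_eq, finrank_block_bot_top]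

end Blocks
end SteinbergStability

/-! ### Words and the flags they produce. -/

namespace SteinbergStability

section Words

theorem eq_of_letterCount_eq {n : ℕ} {w w' : Fin n → Bool}
    (h : ∀ t ≤ n, letterCount w true t = letterCount w' true t) : w = w' := by
  funext i
  have h1 := letterCount_succ w true i.2
  have h2 := letterCount_succ w' true i.2
  have h3 := h _ i.2
  have h4 := h _ i.2.le
  change letterCount w true (i + 1) = _ at h3
  rw [h1, h2, h4] at h3
  cases hw : w i <;> cases hw' : w' i <;> simp [hw, hw'] at h3 <;> rfl

theorem Shuffle.isUnit_sign {R : Type u} [CommRing R] {ℓ m : ℕ} (w : Shuffle ℓ m) :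
    IsUnit (w.sign R) := by
  refine (isUnit_one.neg.pow _).mul
    (Finset.prod_induction _ IsUnit (fun _ _ => IsUnit.mul) isUnit_one fun i _ => ?_)
  split_ifs
  · exact isUnit_one.neg.pow _
  · exact isUnit_one

theorem Shuffle.letterCount_false {ℓ m : ℕ} (w : Shuffle ℓ m) :
    letterCount w.1 false (ℓ + m) = m := by
  have h1 := letterCount_add w.1 le_rfl
  have h2 := w.2
  omega

theorem letterCount_decide_le {n m t : ℕ} (ht : t ≤ n) :
    letterCount (fun i : Fin n => decide (m ≤ i)) true t = t - m := by
  induction t with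
  | zero => simp [letterCount_zero]
  | succ t ih =>
    rw [letterCount_succ _ _ ht, ih (by omega)]
    by_cases h : m ≤ t <;> simp [h] <;> omega

theorem letterCount_decide_lt {n m t : ℕ} (ht : t ≤ n) :
    letterCount (fun i : Fin n => decide ((i : ℕ) < m)) true t = min t m := by
  induction t with
  | zero => simp [letterCount_zero]
  | succ t ih =>
    rw [letterCount_succ _ _ ht, ih (by omega)]
    by_cases h : t < m <;> simp [h] <;> omega

/-- The word with all letters `true` at the end. -/
def Shuffle.last (ℓ m : ℕ) : Shuffle ℓ m :=
  ⟨fun i => decide (m ≤ i), by rw [letterCount_decide_le le_rfl]; omega⟩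

/-- The word with all letters `true` at the beginning. -/
def Shuffle.first (ℓ m : ℕ) : Shuffle ℓ m :=
  ⟨fun i => decide ((i : ℕ) < ℓ), by rw [letterCount_decide_lt le_rfl]; omega⟩

variable {ℓ m t : ℕ}

theorem Shuffle.letterCount_last_true (ht : t ≤ ℓ + m) :
    letterCount (Shuffle.last ℓ m).1 true t = t - m :=
  letterCount_decide_le ht

theorem Shuffle.letterCount_last_false (ht : t ≤ ℓ + m) :
    letterCount (Shuffle.last ℓ m).1 false t = min t m := by
  have h1 := letterCount_add (Shuffle.last ℓ m).1 ht
  rw [letterCount_last_true ht] at h1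
  omega

theorem Shuffle.letterCount_first_true (ht : t ≤ ℓ + m) :
    letterCount (Shuffle.first ℓ m).1 true t = min t ℓ :=
  letterCount_decide_lt ht

theorem Shuffle.letterCount_first_false (ht : t ≤ ℓ + m) :
    letterCount (Shuffle.first ℓ m).1 false t = t - ℓ := by
  have h1 := letterCount_add (Shuffle.first ℓ m).1 ht
  rw [letterCount_first_true ht] at h1
  omega

/-- Singles out the only shuffle that contributes in general position for the linear families. -/
theorem Shuffle.eq_last (w : Shuffle ℓ m) (h : letterCount w.1 true m = 0) :
    w = Shuffle.last ℓ m := by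
  refine Subtype.ext (eq_of_letterCount_eq fun t ht => ?_)
  rw [letterCount_last_true ht]
  have h1 := letterCount_add w.1 ht
  have h2 := letterCount_add w.1 (show m ≤ ℓ + m by omega)
  have h3 := w.letterCount_false
  have h4 := letterCount_mono w.1 false ht
  rcases le_total t m with htm | htm
  · have := letterCount_mono w.1 true htm
    omega
  · have := letterCount_mono w.1 false htm
    omega

/-- Plays the same role for the isotropic families, where the steps in the hyperbolic part have to
come first. -/
theorem Shuffle.eq_first (w : Shuffle ℓ m) (h : letterCount w.1 true ℓ = ℓ) :
    w = Shuffle.first ℓ m := by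
  refine Subtype.ext (eq_of_letterCount_eq fun t ht => ?_)
  rw [letterCount_first_true ht]
  have h1 := letterCount_add w.1 ht
  have h2 := letterCount_add w.1 (show ℓ ≤ ℓ + m by omega)
  have h3 := w.2
  have h4 := letterCount_mono w.1 true ht
  rcases le_total t ℓ with htm | htm
  · have := letterCount_mono w.1 false htm
    omega
  · have := letterCount_mono w.1 true htm
    omega

end Words

section JoinFlags

variable {F A B V : Type u} [Field F] [AddCommGroup A] [Module F A] [AddCommGroup B] [Module F B]
  [AddCommGroup V] [Module F V] {e : (A × B) ≃ₗ[F] V}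
  {pA : Submodule F A → Prop} {pB : Submodule F B → Prop} {pV : Submodule F V → Prop}
  {ℓ m a b N : ℕ}

theorem joinVertex_eq_block {n : ℕ} (w : Fin n → Bool) (f : Fin a → Submodule F A)
    (g : Fin b → Submodule F B) (t : ℕ) : joinVertex e w f g t
      = block e (vertex f (letterCount w true t)) (vertex g (letterCount w false t)) := rfl

theorem vertex_joinFlag (H : JoinValid e pA pB pV ℓ m a b N) (w : Shuffle ℓ m)
    (x : FlagOf pA a × FlagOf pB b) {t : ℕ} (ht : t ≤ N) :
    vertex (joinFlag H w x).1 t = block e (vertex x.1.1 (letterCount w.1 true t))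
      (vertex x.2.1 (letterCount w.1 false t)) := by
  rw [← joinVertex_eq_block]
  by_cases h : t = 0
  · rw [h, vertex_zero, LinearFamily.joinVertex_zero]
  · obtain ⟨i, rfl⟩ : ∃ i : Fin N, t = i + 1 := ⟨⟨t - 1, by omega⟩, by simp; omega⟩
    rw [vertex_succ]
    rfl

theorem joinFlag_apply (H : JoinValid e pA pB pV ℓ m a b N) (w : Shuffle ℓ m)
    (x : FlagOf pA a × FlagOf pB b) (t : Fin N) :
    (joinFlag H w x).1 t = block e (vertex x.1.1 (letterCount w.1 true (t + 1)))
      (vertex x.2.1 (letterCount w.1 false (t + 1))) := rfl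

theorem map_joinFlag (H : JoinValid e pA pB pV ℓ m a b N) (w : Shuffle ℓ m) (γ : preserving pB)
    (δ : preserving pV) (hδ : δ.1 = blockHom e γ.1) (x : FlagOf pA a × FlagOf pB b) :
    FlagOf.map δ (joinFlag H w x) = joinFlag H w (x.1, FlagOf.map γ x.2) := by
  apply Subtype.ext
  funext t
  simp only [joinFlag, FlagOf.map, hδ]
  exact (joinVertex_map e w.1 x.1.1 x.2.1 γ.1 _).symm

end JoinFlags

theorem map_eq_self_of_forall_eq {F V : Type u} [Field F] [AddCommGroup V] [Module F V]
    (γ : V ≃ₗ[F] V) {W : Submodule F V} (h : ∀ x ∈ W, γ x = x) :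
    W.map (γ : V →ₗ[F] V) = W := by
  ext v
  constructor
  · rintro ⟨x, hx, rfl⟩
    rw [LinearEquiv.coe_coe, h x hx]
    exact hx
  · intro hv
    exact ⟨v, hv, h v hv⟩

section ProperFlags

variable {F : Type u} [Field F] {n : ℕ}

theorem vertex_of_proper (f : FlagOf (IsProper : Submodule F (Fin n → F) → Prop) (n - 1)) :
    vertex f.1 n = ⊤ := by
  rcases Nat.eq_zero_or_pos n with rfl | hn
  · exact Subsingleton.elim _ _
  -- Only `n - 1` subspaces are recorded, so position `n` takes the default value `⊤`.
  · exact vertex_of_lt _ (by omega)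

theorem finrank_vertex_of_proper
    (f : FlagOf (IsProper : Submodule F (Fin n → F) → Prop) (n - 1)) {i : ℕ} (hi : i ≤ n) :
    Module.finrank F (vertex f.1 i) = i := by
  rcases Nat.eq_zero_or_pos i with rfl | h0
  · rw [vertex_zero, finrank_bot]
  · rcases hi.lt_or_eq with h | rfl
    · obtain ⟨j, rfl⟩ : ∃ j : Fin (n - 1), i = j + 1 := ⟨⟨i - 1, by omega⟩, by simp; omega⟩
      rw [vertex_succ]
      exact FlagOf.finrank_eq (fun _ h => h.1) (LinearFamily.finrank_le_of_isProper F n) f j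
    · rw [vertex_of_proper, finrank_top, Module.finrank_fin_fun]

end ProperFlags

/-! ### The linear families: flags in general position. -/

namespace LinearFamily

variable (X : LinearFamily) (F : Type u) [Field F] (ℓ m n : ℕ)

/-- The hypothesis is empty when position `m` is not a recorded vertex. For `m = 0` both sides are
`⊥`; for `ℓ = 0` both are `⊤`, the left one by the default value of `vertex`. -/
theorem vertex_eq_block_bot_top
    {f : FlagOf (IsProper : Submodule F (Fin (ℓ + m) → F) → Prop) (ℓ + m - 1)}
    (hf : ∀ t : Fin (ℓ + m - 1), (t : ℕ) + 1 = m → f.1 t = block (split F ℓ m) ⊥ ⊤) :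
    vertex f.1 m = block (split F ℓ m) ⊥ ⊤ := by
  rcases Nat.eq_zero_or_pos m with rfl | h0
  · rw [vertex_zero, show (⊤ : Submodule F (Fin 0 → F)) = ⊥ from Subsingleton.elim _ _, block_bot]
  · rcases Nat.eq_zero_or_pos ℓ with rfl | h1
    · rw [show (⊥ : Submodule F (Fin 0 → F)) = ⊤ from Subsingleton.elim _ _, block_top]
      exact vertex_of_lt _ (by omega)
    · rw [← hf ⟨m - 1, by omega⟩ (by simp only; omega), ← vertex_succ f.1 _]
      congr 1
      simp only
      omega

/-- The flags in question are those through the summand `F^m`: below it they are flags of `F^m`,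
above it flags of the quotient `F^ℓ`. Index `t` holds a space of dimension `t + 1`, so `F^m` itself
sits at index `m - 1` and the flag of `F^ℓ` starts at index `m`. -/
theorem flagEmbedding : FlagEmbedding (joinFlag (joinValid F ℓ m) (Shuffle.last ℓ m))
    (fun i => ⟨m + i, by omega⟩) (fun i => ⟨i, by omega⟩) (fun U => block (split F ℓ m) U ⊤)
    (fun W => block (split F ℓ m) ⊥ W) (fun _ => block (split F ℓ m) ⊥ ⊤) := by
  have apply_left : ∀ x (i : Fin (ℓ - 1)), (joinFlag (joinValid F ℓ m) (Shuffle.last ℓ m) x).1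
      ⟨m + i, by omega⟩ = block (split F ℓ m) (x.1.1 i) ⊤ := by
    intro x i
    rw [joinFlag_apply, Shuffle.letterCount_last_true (by simp only; omega),
      Shuffle.letterCount_last_false (by simp only; omega),
      show min ((m + i : ℕ) + 1) m = m by omega, show (m + i : ℕ) + 1 - m = i + 1 by omega,
      vertex_of_proper, vertex_succ]
  have apply_right : ∀ x (i : Fin (m - 1)), (joinFlag (joinValid F ℓ m) (Shuffle.last ℓ m) x).1
      ⟨i, by omega⟩ = block (split F ℓ m) ⊥ (x.2.1 i) := by
    intro x i
    rw [joinFlag_apply, Shuffle.letterCount_last_true (by simp only; omega),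
      Shuffle.letterCount_last_false (by simp only; omega),
      show min ((i : ℕ) + 1) m = i + 1 by omega, show (i : ℕ) + 1 - m = 0 by omega,
      vertex_zero, vertex_succ]
  have apply_const : ∀ x (t : Fin (ℓ + m - 1)), (t : ℕ) + 1 = m →
      (joinFlag (joinValid F ℓ m) (Shuffle.last ℓ m) x).1 t = block (split F ℓ m) ⊥ ⊤ := by
    intro x t h
    rw [joinFlag_apply, Shuffle.letterCount_last_true (by omega),
      Shuffle.letterCount_last_false (by omega), h, min_self, Nat.sub_self, vertex_zero,
      vertex_of_proper]
  refine ⟨fun i j h => Fin.ext (by simpa using h), fun i j h => Fin.ext (by simpa using h),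
    fun i j h => ?_, fun U U' h => (block_inj.1 h).1, fun W W' h => (block_inj.1 h).2,
    apply_left, apply_right, fun x t h1 h2 => ?_, fun f hf => ?_⟩
  · have := congrArg Fin.val h
    have := j.2
    simp only at *
    omega
  · have h3 : ¬ (t : ℕ) < m - 1 := fun h => h2 ⟨t, h⟩ rfl
    have h4 : ¬ m ≤ (t : ℕ) := fun h => h1 ⟨t - m, by omega⟩ (Fin.ext (by simp only; omega))
    exact apply_const x t (by omega)
  · have hconst : ∀ t : Fin (ℓ + m - 1), (t : ℕ) + 1 = m → f.1 t = block (split F ℓ m) ⊥ ⊤ := by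
      intro t ht
      refine hf t (fun i hi => ?_) (fun i hi => ?_)
      · have := congrArg Fin.val hi; simp only at this; omega
      · have := congrArg Fin.val hi; simp only at this; omega
    have hm := vertex_eq_block_bot_top F ℓ m hconst
    have hltA : ∀ i : Fin (ℓ - 1), block (split F ℓ m) ⊥ ⊤ < f.1 ⟨m + i, by omega⟩ := by
      intro i
      rw [← hm, ← vertex_succ f.1 _]
      exact vertex_strict_of_proper f (by simp only; omega) (by simp only; omega)
    have hltB : ∀ i : Fin (m - 1), f.1 ⟨i, by omega⟩ < block (split F ℓ m) ⊥ ⊤ := by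
      intro i
      rw [← hm, ← vertex_succ f.1 _]
      exact vertex_strict_of_proper f (by simp only; omega) (by omega)
    choose U hU using fun i => exists_eq_block_of_ge (hltA i).le
    choose W hW using fun i => exists_eq_block_of_le (hltB i).le
    let x1 : FlagOf (IsProper : Submodule F (Fin ℓ → F) → Prop) (ℓ - 1) := ⟨U, fun i j h => by
        rw [← block_lt_block_left (e := split F ℓ m), ← hU, ← hU]
        exact f.2.1 (Fin.mk_lt_mk.2 (by have : (i : ℕ) < j := h; omega)), fun i => ⟨fun h => by
          have := hltA i
          rw [hU, h] at this
          exact this.ne rfl, fun h => (f.2.2 ⟨m + i, by omega⟩).2 (by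
            rw [hU, h, block_top])⟩⟩
    let x2 : FlagOf (IsProper : Submodule F (Fin m → F) → Prop) (m - 1) := ⟨W, fun i j h => by
        rw [← block_lt_block_right (e := split F ℓ m) (U := ⊥), ← hW, ← hW]
        exact f.2.1 (Fin.mk_lt_mk.2 (by have : (i : ℕ) < j := h; omega)), fun i => ⟨fun h =>
          (f.2.2 ⟨i, by omega⟩).1 (by rw [hW, h, block_bot]), fun h => by
          have := hltB i
          rw [hW, h] at this
          exact this.ne rfl⟩⟩
    refine ⟨(x1, x2), Subtype.ext (funext fun t => ?_)⟩
    rcases lt_trichotomy ((t : ℕ) + 1) m with h | h | h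
    · exact (apply_right (x1, x2) ⟨t, by omega⟩).trans (hW ⟨t, by omega⟩).symm
    · rw [apply_const _ _ h, hconst t h]
    · have ht : t = ⟨m + (⟨t - m, by omega⟩ : Fin (ℓ - 1)), by simp only; omega⟩ :=
        Fin.ext (by simp only; omega)
      rw [ht]
      exact (apply_left (x1, x2) ⟨t - m, by omega⟩).trans (hU ⟨t - m, by omega⟩).symm

/-- The flags in general position with respect to the span of the first `ℓ` basis vectors. -/
def Opposite (f : FlagOf (IsProper : Submodule F (Fin (ℓ + m) → F) → Prop) (ℓ + m - 1)) : Prop :=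
  vertex f.1 m ⊓ block (split F ℓ m) ⊤ ⊥ = ⊥

variable {F ℓ m n}

/-- The `m`-th space of a shuffle is `U ⊕ W`, with `U` a member of the flag in `F^ℓ`. It meets `F^ℓ`
in `U`, so general position means that no step has yet been taken in `F^ℓ`. -/
theorem eq_last_of_opposite {w : Shuffle ℓ m}
    {x : FlagOf (IsProper : Submodule F (Fin ℓ → F) → Prop) (ℓ - 1) ×
      FlagOf (IsProper : Submodule F (Fin m → F) → Prop) (m - 1)}
    (h : Opposite F ℓ m (joinFlag (joinValid F ℓ m) w x)) (hℓ : 1 ≤ ℓ) : w = Shuffle.last ℓ m := by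
  apply w.eq_last
  by_contra h0
  rw [Opposite, vertex_joinFlag _ _ _ (by omega)] at h
  have h1 : vertex x.1.1 (letterCount w.1 true m) ≠ ⊥ := by
    have h2 := letterCount_mono w.1 true (show m ≤ ℓ + m by omega)
    rw [w.2] at h2
    exact (bot_le.trans_lt (vertex_strict_of_proper x.1 (Nat.pos_of_ne_zero h0) h2)).ne'
  obtain ⟨a, ha, ha0⟩ := Submodule.exists_mem_ne_zero_of_ne_bot h1
  have h3 : split F ℓ m (a, 0) ∈ (⊥ : Submodule F (Fin (ℓ + m) → F)) := by
    rw [← h]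
    exact ⟨mem_block.2 ⟨ha, Submodule.zero_mem _⟩, mem_block.2 ⟨trivial, rfl⟩⟩
  rw [Submodule.mem_bot, LinearEquiv.map_eq_zero_iff] at h3
  exact ha0 (congrArg Prod.fst h3)

theorem vertex_joinFlag_last (hℓ : 1 ≤ ℓ)
    (x : FlagOf (IsProper : Submodule F (Fin ℓ → F) → Prop) (ℓ - 1) ×
      FlagOf (IsProper : Submodule F (Fin m → F) → Prop) (m - 1)) :
    vertex (joinFlag (joinValid F ℓ m) (Shuffle.last ℓ m) x).1 m = block (split F ℓ m) ⊥ ⊤ := by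
  rw [vertex_joinFlag _ _ _ (by omega), Shuffle.letterCount_last_true (by omega),
    Shuffle.letterCount_last_false (by omega), Nat.sub_self, min_self, vertex_zero,
    vertex_of_proper]

theorem opposite_joinFlag_last (hℓ : 1 ≤ ℓ)
    (x : FlagOf (IsProper : Submodule F (Fin ℓ → F) → Prop) (ℓ - 1) ×
      FlagOf (IsProper : Submodule F (Fin m → F) → Prop) (m - 1)) :
    Opposite F ℓ m (joinFlag (joinValid F ℓ m) (Shuffle.last ℓ m) x) := by
  rw [Opposite, vertex_joinFlag_last hℓ, eq_bot_iff, le_iff_forall_apply (e := split F ℓ m)]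
  rintro ⟨a, b⟩ ⟨h1, h2⟩
  obtain rfl : a = 0 := (mem_block.1 h1).1
  obtain rfl : b = 0 := (mem_block.1 h2).2
  exact map_zero (split F ℓ m)

theorem exists_joinFlag_last_eq
    {f : FlagOf (IsProper : Submodule F (Fin (ℓ + m) → F) → Prop) (ℓ + m - 1)}
    (hf : vertex f.1 m = block (split F ℓ m) ⊥ ⊤) :
    ∃ x, joinFlag (joinValid F ℓ m) (Shuffle.last ℓ m) x = f := by
  refine (flagEmbedding F ℓ m).surj f fun t h1 h2 => ?_
  have h3 : ¬ (t : ℕ) < m - 1 := fun h => h2 ⟨t, h⟩ rfl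
  have h4 : ¬ m ≤ (t : ℕ) := fun h => h1 ⟨t - m, by omega⟩ (Fin.ext (by simp only; omega))
  rw [← hf, ← vertex_succ f.1 t]
  congr 1
  omega

theorem eq_zero_of_opposite {R : Type u} [CommRing R] (hℓ : 1 ≤ ℓ)
    (z : Chain R (IsProper : Submodule F (Fin (ℓ + m) → F) → Prop) (ℓ + m - 1))
    (hz : FacesVanish z) (h : ∀ f, Opposite F ℓ m f → z f = 0) : z = 0 := by
  by_contra h0
  set A := block (split F ℓ m) ⊤ ⊥ with hA
  -- One summand would do here. It is repeated to match `finrank_inf_of_minimal`, applied with both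
  -- of its subspaces equal to `A`.
  obtain ⟨f, hf, hmin⟩ := hz.exists_minimal h0 fun W =>
    Module.finrank F (W ⊓ A : Submodule F (Fin (ℓ + m) → F)) +
      Module.finrank F (W ⊓ A : Submodule F (Fin (ℓ + m) → F))
  apply hf
  apply h
  have hle : ∀ i < ℓ + m, vertex f.1 i ≤ vertex f.1 (i + 1) := fun i hi =>
    (vertex_strict_of_proper f (by omega) (by omega)).le
  have hfin : ∀ (g : FlagOf (IsProper : Submodule F (Fin (ℓ + m) → F) → Prop) (ℓ + m - 1)),
      ∀ i ≤ ℓ + m, Module.finrank F (vertex g.1 i) = i :=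
    fun g i hi => finrank_vertex_of_proper g hi
  have key := eq_zero_or_of_no_descent
    (d := fun i => Module.finrank F (vertex f.1 i ⊓ A : Submodule F (Fin (ℓ + m) → F)))
    (n := ℓ + m) (by simp [vertex_zero]) (fun i hi => finrank_inf_mono (hle i hi) A)
    (fun i hi => by
      have h1 := finrank_inf_add_le (hle i hi) A
      rw [hfin f _ hi, hfin f i hi.le] at h1
      omega)
    (fun i hi => by
      obtain ⟨g, hne, heq, hw⟩ := hmin (i + 1) (by omega) (by omega)
      have hg1 : vertex g.1 i < vertex g.1 (i + 1) :=
        vertex_strict_of_proper g (by omega) (by omega)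
      have hg2 : vertex g.1 (i + 1) < vertex g.1 (i + 2) :=
        vertex_strict_of_proper g (by omega) (by omega)
      rw [heq i (by omega)] at hg1
      rw [heq (i + 2) (by omega)] at hg2
      exact (finrank_inf_of_minimal (hle i (by omega)) (hle (i + 1) (by omega)) hg1.le hg2.le
        (by rw [hfin f _ (by omega), hfin f _ (by omega)])
        (by rw [hfin g _ (by omega), hfin f _ (by omega)]) hne le_rfl hw).1)
    (show m ≤ ℓ + m by omega)
  -- There are `ℓ` jumps in all and none is followed by a step without a jump, so they occupy the
  -- last `ℓ` steps and the intersection at position `m` is zero.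
  have h1 : Module.finrank F (vertex f.1 (ℓ + m) ⊓ A : Submodule F (Fin (ℓ + m) → F)) = ℓ := by
    rw [vertex_of_proper, top_inf_eq, hA, finrank_block_top_bot, Module.finrank_fin_fun]
  rw [Opposite, ← hA, ← Submodule.finrank_eq_zero (R := F)]
  rcases key with h2 | h2
  · exact h2
  · simp only [h1] at h2
    omega

theorem split_single (j : Fin ℓ) : split F ℓ m (Pi.single j 1, 0) = Pi.single (Fin.castAdd m j) 1 := by
  rw [split_apply]
  funext i
  refine Fin.addCases (fun i => ?_) (fun i => ?_) i
  · rw [Fin.append_left]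
    simp [Pi.single_apply, Fin.ext_iff]
  · rw [Fin.append_right, Pi.zero_apply, Pi.single_eq_of_ne]
    intro h
    have := congrArg Fin.val h
    simp at this
    omega

theorem stab_apply (g : X.stab F ℓ (ℓ + m)) (a : Fin ℓ → F) :
    g.1.1 (split F ℓ m (a, 0)) = split F ℓ m (a, 0) := by
  have h : (g.1.1 : (Fin (ℓ + m) → F) →ₗ[F] _) ∘ₗ (split F ℓ m).toLinearMap ∘ₗ LinearMap.inl F _ _
      = (split F ℓ m).toLinearMap ∘ₗ LinearMap.inl F _ (Fin m → F) := by
    refine LinearMap.pi_ext' fun j => LinearMap.ext_ring ?_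
    simp only [LinearMap.comp_apply, LinearMap.inl_apply, LinearMap.single_apply,
      LinearEquiv.coe_coe, split_single]
    exact g.2 _ (by simp)
  exact LinearMap.congr_fun h a

theorem mem_stab (g : X.group F (ℓ + m))
    (h : ∀ a, g.1 (split F ℓ m (a, 0)) = split F ℓ m (a, 0)) : g ∈ X.stab F ℓ (ℓ + m) := by
  intro j hj
  have h1 := h (Pi.single ⟨j, hj⟩ 1)
  rw [split_single] at h1
  exact h1

theorem mem_group_of_det {g : (Fin n → F) ≃ₗ[F] (Fin n → F)} (h : LinearEquiv.det g = 1) :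
    g ∈ X.group F n := by
  cases X with
  | general => trivial
  | special => exact h

theorem mem_group_of_blockHom {h : (Fin m → F) ≃ₗ[F] (Fin m → F)}
    (hh : blockHom (split F ℓ m) h ∈ X.group F (ℓ + m)) : h ∈ X.group F m := by
  cases X with
  | general => trivial
  | special =>
    have h1 : LinearEquiv.det (blockHom (split F ℓ m) h) = 1 := hh
    rw [det_blockHom] at h1
    exact h1

theorem induced_bijective (F R : Type u) [Field F] [CommRing R] (ℓ m : ℕ) (hℓ : 1 ≤ ℓ)
    [Module.Flat R (SteinbergModule F R ℓ)] :
    Function.Bijective (Finsupp.lsum R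
      fun c : X.stab F ℓ (ℓ + m) ⧸ (X.inclusion F ℓ m).range =>
        (X.stabRep F R ℓ (ℓ + m)).ρ c.out ∘ₗ reederProduct F R ℓ m :
      ((X.stab F ℓ (ℓ + m) ⧸ (X.inclusion F ℓ m).range) →₀
        SteinbergModule F R ℓ ⊗[R] SteinbergModule F R m) →ₗ[R] SteinbergModule F R (ℓ + m)) := by
  refine (flagEmbedding F ℓ m).induced_bijective (fun _ h => h.1)
    (finrank_le_of_isProper F (ℓ + m))
    ((Subgroup.inclusion (X.group_le_preserving F (ℓ + m))).comp (X.stab F ℓ (ℓ + m)).subtype)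
    (reederProduct F R ℓ m) (fun w => w.sign R) (joinFlag (joinValid F ℓ m)) (fun x => ?_)
    (Shuffle.last ℓ m) rfl (Shuffle.isUnit_sign _) {f | Opposite F ℓ m f}
    (fun w x h => eq_last_of_opposite h hℓ) (opposite_joinFlag_last hℓ)
    (eq_zero_of_opposite hℓ) ?_ ?_ _ ?_ ?_
  · change (∑ w : Shuffle ℓ m, w.sign R • Finsupp.lmapDomain R R (joinFlag (joinValid F ℓ m) w))
      (bicycle _ _ x) = _
    rw [LinearMap.sum_apply]
    rfl
  · intro g f hf
    have hA := map_eq_self_of_forall_eq g.1.1 (W := block (split F ℓ m) ⊤ ⊥) (fun v hv => by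
      obtain ⟨⟨a, b⟩, rfl⟩ := (split F ℓ m).surjective v
      obtain rfl : b = 0 := (mem_block.1 hv).2
      exact X.stab_apply g a)
    change vertex (FlagOf.map _ f).1 m ⊓ _ = ⊥
    rw [FlagOf.vertex_map]
    conv_lhs => rw [← hA]
    refine (Submodule.map_inf _ g.1.1.injective).symm.trans ?_
    rw [show vertex f.1 m ⊓ block (split F ℓ m) ⊤ ⊥ = ⊥ from hf, Submodule.map_bot]
  · intro f hf
    -- The `m`-th space is a complement of `F^ℓ`, hence a sheared copy of `F^m`. Shears fix `F^ℓ`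
    -- and have determinant one, so they lie in the stabilizer for `SL` as well as for `GL`.
    obtain ⟨η, hη⟩ := exists_map_shear_eq hf (by
      rw [finrank_vertex_of_proper f (by omega), Module.finrank_fin_fun])
    let γ : X.stab F ℓ (ℓ + m) := ⟨⟨shear (split F ℓ m) η, X.mem_group_of_det (det_shear η)⟩,
      X.mem_stab _ fun a => by rw [shear_apply, map_zero, add_zero]⟩
    set σ := (Subgroup.inclusion (X.group_le_preserving F (ℓ + m))).comp
      (X.stab F ℓ (ℓ + m)).subtype
    have h1 : vertex (FlagOf.map (σ γ⁻¹) f).1 m = block (split F ℓ m) ⊥ ⊤ := by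
      rw [FlagOf.vertex_map, ← hη, ← Submodule.map_comp]
      convert Submodule.map_id _ using 2
      exact LinearMap.ext fun v => (shear (split F ℓ m) η).symm_apply_apply v
    obtain ⟨x, hx⟩ := exists_joinFlag_last_eq h1
    refine ⟨γ, x, ?_⟩
    rw [hx, ← FlagOf.map_mul, ← map_mul, mul_inv_cancel, map_one, FlagOf.map_one]
  · intro g x y h
    -- Comparing the `m`-th spaces shows that `g` preserves `F^m`; as it fixes `F^ℓ` pointwise, it
    -- belongs to `1 × G_m`.
    have h1 := congrArg (fun f => vertex f.1 m) h
    simp only [FlagOf.vertex_map, vertex_joinFlag_last hℓ] at h1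
    obtain ⟨k, hk⟩ := exists_eq_blockHom g.1.1 (X.stab_apply g) h1
    refine ⟨⟨k, X.mem_group_of_blockHom (ℓ := ℓ) (hk ▸ g.1.2)⟩, ?_⟩
    exact Subtype.ext (Subtype.ext hk.symm)
  · rintro _ ⟨g, rfl⟩ x
    exact ⟨_, (map_joinFlag (joinValid F ℓ m) _
      (Subgroup.inclusion (X.group_le_preserving F m) g) _ rfl x).symm⟩

end LinearFamily
end SteinbergStability

/-! ### Freeness of the Steinberg module; conclusion for the linear families. -/

namespace SteinbergStability
namespace LinearFamily

/-- The decomposition with `ℓ = 1` writes the module for `1 + n` as a direct sum of copies of the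
one for `1` tensored with the one for `n`. It requires flatness only of the module for `1`, which is
`R`, so the induction is not circular. -/
instance (F R : Type u) [Field F] [CommRing R] (n : ℕ) : Module.Free R (SteinbergModule F R n) := by
  have h0 : ∀ n, n - 1 = 0 → Module.Free R (SteinbergModule F R n) := by
    intro n hn
    change Module.Free R (cycles R (IsProper : Submodule F (Fin n → F) → Prop) (n - 1))
    rw [hn]
    exact Module.Free.of_equiv (Submodule.topEquiv (R := R)
      (M := Chain R (IsProper : Submodule F (Fin n → F) → Prop) 0)).symm
  induction n with
  | zero => exact h0 0 rfl
  | succ n ih =>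
    have h1 := h0 1 rfl
    rw [Nat.add_comm]
    exact Module.Free.of_equiv (LinearEquiv.ofBijective _ (general.induced_bijective F R 1 n le_rfl))

theorem isIso_homologyMap (X : LinearFamily) (F R : Type u) [Field F] [CommRing R] (ℓ m : ℕ)
    (hℓ : 1 ≤ ℓ) (i : ℕ) : CategoryTheory.IsIso (X.homologyMap F R ℓ m i) := by
  refine Shapiro.isIso_map_of_bijective (X.inclusion F ℓ m) ?_ (X.reederHom F R ℓ m)
    (fun c : X.stab F ℓ (ℓ + m) ⧸ (X.inclusion F ℓ m).range => c.out) (fun g => ?_)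
    (X.induced_bijective F R ℓ m hℓ) i
  · intro g h hgh
    exact Subtype.ext (blockHom_injective (congrArg (fun k => k.1.1) hgh))
  · obtain ⟨⟨_, h, rfl⟩, hk⟩ := QuotientGroup.mk_out_eq_mul (X.inclusion F ℓ m).range g
    refine ⟨g, h⁻¹, ?_⟩
    rw [hk, map_inv, mul_inv_cancel_right]

theorem nonempty_homologyEquiv (X : LinearFamily) (F R : Type u) [Field F] [CommRing R] (ℓ m : ℕ)
    (hℓ : 1 ≤ ℓ) (i : ℕ) : Nonempty (SteinbergModule F R ℓ ⊗[R]
      groupHomology (X.steinberg F R m) i ≃ₗ[R] groupHomology (X.stabRep F R ℓ (ℓ + m)) i) := by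
  have := X.isIso_homologyMap F R ℓ m hℓ i
  exact ⟨(Shapiro.tensorHomologyEquiv (SteinbergModule F R ℓ) (X.steinbergAction F R m) i).trans
    (CategoryTheory.asIso (X.homologyMap F R ℓ m i)).toLinearEquiv⟩

end LinearFamily
end SteinbergStability

/-! ### The isotropic families: forms, orthogonality and the stabilizer. -/

namespace SteinbergStability

theorem finrank_map_add_finrank_inf_ker {F V W : Type u} [Field F] [AddCommGroup V] [Module F V]
    [FiniteDimensional F V] [AddCommGroup W] [Module F W] (f : V →ₗ[F] W) (P : Submodule F V) :
    Module.finrank F (P.map f) + Module.finrank F (P ⊓ LinearMap.ker f : Submodule F V)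
      = Module.finrank F P := by
  have h : P ⊓ LinearMap.ker f = (LinearMap.ker (f.domRestrict P)).map P.subtype := by
    ext x
    simp [and_comm]
  rw [← LinearMap.finrank_range_add_finrank_ker (f.domRestrict P), LinearMap.range_domRestrict, h,
    Submodule.finrank_map_subtype_eq]

section Annihilator

variable {F : Type u} [Field F] {ℓ : ℕ}

theorem annihilator_annihilator (U : Submodule F (Fin ℓ → F)) :
    annihilator (annihilator U) = U := by
  symm
  refine Submodule.eq_of_le_of_finrank_eq (fun x hx b hb => ?_) ?_
  · rw [dotProduct_comm]; exact hb x hx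
  · have h1 := finrank_annihilator U
    have h2 := finrank_annihilator (annihilator U)
    omega

theorem annihilator_injective :
    Function.Injective (annihilator : Submodule F (Fin ℓ → F) → Submodule F (Fin ℓ → F)) :=
  Function.LeftInverse.injective annihilator_annihilator

theorem annihilator_top : annihilator (⊤ : Submodule F (Fin ℓ → F)) = ⊥ := by
  have h := finrank_annihilator (⊤ : Submodule F (Fin ℓ → F))
  rw [finrank_top, Module.finrank_fin_fun] at h
  rw [← Submodule.finrank_eq_zero (R := F)]
  omega

theorem annihilator_bot : annihilator (⊥ : Submodule F (Fin ℓ → F)) = ⊤ := by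
  rw [← annihilator_top, annihilator_annihilator]

end Annihilator

namespace IsotropicFamily

variable (X : IsotropicFamily) (F : Type u) [Field F] (ℓ m n : ℕ)

/-- The symmetry sign of the bilinear form. -/
def sgn : F :=
  match X with
  | symplectic => -1
  | evenOrthogonal => 1
  | oddOrthogonal => 1

/-- Zero if no quadratic form is present, and one otherwise. -/
def quad : F :=
  match X with
  | symplectic => 0
  | evenOrthogonal => 1
  | oddOrthogonal => 1

variable {X F ℓ m n}

/-- The symplectic form, respectively the polarization of the quadratic form. -/
def pairing (x y : X.Space F n) : F :=
  x.1 ⬝ᵥ y.2.1 + X.sgn F * (x.2.1 ⬝ᵥ y.1) + 2 * (x.2.2 ⬝ᵥ y.2.2)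

/-- The quadratic form, if there is one, and zero otherwise. -/
def quadPart (x : X.Space F n) : F := X.quad F * quadraticForm x

theorem pairing_add_left (x x' y : X.Space F n) :
    pairing (x + x') y = pairing x y + pairing x' y := by
  simp only [pairing, Prod.fst_add, Prod.snd_add, add_dotProduct]
  ring

theorem pairing_smul_left (c : F) (x y : X.Space F n) : pairing (c • x) y = c * pairing x y := by
  simp only [pairing, Prod.smul_fst, Prod.smul_snd, smul_dotProduct, smul_eq_mul]
  ring

theorem sgn_mul_sgn : X.sgn F * X.sgn F = 1 := by
  cases X <;> simp [sgn]

theorem sgn_ne_zero : X.sgn F ≠ 0 := fun h => by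
  have := X.sgn_mul_sgn (F := F)
  rw [h, mul_zero] at this
  exact zero_ne_one this

theorem pairing_comm (x y : X.Space F n) : pairing x y = X.sgn F * pairing y x := by
  have h : 2 * (x.2.2 ⬝ᵥ y.2.2) = X.sgn F * (2 * (y.2.2 ⬝ᵥ x.2.2)) := by
    rw [dotProduct_comm]
    cases X with
    | symplectic =>
      have : y.2.2 ⬝ᵥ x.2.2 = 0 := Finset.sum_eq_zero fun i _ => i.elim0
      rw [this]; simp
    | evenOrthogonal => simp [sgn]
    | oddOrthogonal => simp [sgn]
  rw [pairing, pairing, h, dotProduct_comm x.1, dotProduct_comm x.2.1]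
  linear_combination -(y.2.1 ⬝ᵥ x.1) * sgn_mul_sgn (X := X) (F := F)

theorem pairing_add_right (x y y' : X.Space F n) :
    pairing x (y + y') = pairing x y + pairing x y' := by
  simp only [pairing, Prod.fst_add, Prod.snd_add, dotProduct_add]
  ring

theorem pairing_smul_right (c : F) (x y : X.Space F n) : pairing x (c • y) = c * pairing x y := by
  simp only [pairing, Prod.smul_fst, Prod.smul_snd, dotProduct_smul, smul_eq_mul]
  ring

theorem pairing_zero_right (x : X.Space F n) : pairing x 0 = 0 := by
  simpa using pairing_smul_right 0 x 0

theorem quadPart_add (x y : X.Space F n) :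
    quadPart (x + y) = quadPart x + quadPart y + X.quad F * pairing x y := by
  have h : X.quad F * X.sgn F = X.quad F := by cases X <;> simp [sgn, quad]
  simp only [quadPart, quadraticForm, pairing, Prod.fst_add, Prod.snd_add, add_dotProduct,
    dotProduct_add]
  rw [dotProduct_comm y.1 x.2.1, dotProduct_comm y.2.2 x.2.2]
  linear_combination (-(x.2.1 ⬝ᵥ y.1)) * h

theorem quadPart_smul (c : F) (x : X.Space F n) : quadPart (c • x) = c ^ 2 * quadPart x := by
  simp only [quadPart, quadraticForm, Prod.smul_fst, Prod.smul_snd, smul_dotProduct,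
    dotProduct_smul, smul_eq_mul]
  ring

theorem pairing_symplectic (x y : symplectic.Space F n) : pairing x y = symplecticForm x y := by
  have : x.2.2 ⬝ᵥ y.2.2 = 0 := Finset.sum_eq_zero fun i _ => i.elim0
  simp [pairing, symplecticForm, sgn, this, sub_eq_add_neg]

/-- Puts the three families on one footing. A quadratic form that vanishes on `W` has vanishing
polarization there; in characteristic two the converse fails, so the quadratic part is kept as a
separate condition. For the symplectic family that part is identically zero. -/
theorem isotropic_iff {W : Submodule F (X.Space F n)} :
    Isotropic W ↔ (∀ x ∈ W, ∀ y ∈ W, pairing x y = 0) ∧ ∀ x ∈ W, quadPart x = 0 := by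
  have so : X.quad F = 1 → ((∀ x ∈ W, quadraticForm x = 0) ↔
      (∀ x ∈ W, ∀ y ∈ W, pairing x y = 0) ∧ ∀ x ∈ W, quadPart x = 0) := by
    intro h1
    simp only [quadPart, h1, one_mul]
    refine ⟨fun h => ⟨fun x hx y hy => ?_, h⟩, fun h => h.2⟩
    have h2 := quadPart_add x y
    rw [quadPart, quadPart, quadPart, h1, h _ (W.add_mem hx hy), h x hx, h y hy] at h2
    simpa using h2.symm
  cases X with
  | symplectic =>
    simp only [pairing_symplectic, quadPart, quad, zero_mul]
    exact ⟨fun h => ⟨h, fun _ _ => trivial⟩, fun h => h.1⟩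
  | evenOrthogonal => exact so rfl
  | oddOrthogonal => exact so rfl

theorem mem_group_iff {g : X.Space F n ≃ₗ[F] X.Space F n} : g ∈ X.group F n ↔
    (∀ x y, pairing (g x) (g y) = pairing x y) ∧ (∀ x, quadPart (g x) = quadPart x) ∧
      (X = symplectic ∨ LinearEquiv.det g = 1) := by
  have so : X.quad F = 1 → X ≠ symplectic → ((LinearEquiv.det g = 1 ∧
      ∀ x, quadraticForm (g x) = quadraticForm x) ↔
        (∀ x y, pairing (g x) (g y) = pairing x y) ∧ (∀ x, quadPart (g x) = quadPart x) ∧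
      (X = symplectic ∨ LinearEquiv.det g = 1)) := by
    intro h1 hX
    simp only [quadPart, h1, one_mul]
    constructor
    · rintro ⟨h2, h3⟩
      refine ⟨fun x y => ?_, h3, Or.inr h2⟩
      have h4 := quadPart_add x y
      have h5 := quadPart_add (g x) (g y)
      simp only [quadPart, h1, one_mul, ← map_add, h3] at h4 h5
      rw [h4] at h5
      exact (add_left_cancel h5).symm
    · rintro ⟨_, h3, h4⟩
      exact ⟨h4.resolve_left hX, h3⟩
  cases X with
  | symplectic =>
    simp only [pairing_symplectic, quadPart, quad, zero_mul]
    exact ⟨fun h => ⟨h, fun _ => trivial, Or.inl trivial⟩, fun h => h.1⟩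
  | evenOrthogonal => exact so rfl (by simp)
  | oddOrthogonal => exact so rfl (by simp)

theorem pairing_split (u v : (Fin ℓ → F) × (Fin ℓ → F)) (x y : X.Space F m) :
    pairing (X.split F ℓ m (u, x)) (X.split F ℓ m (v, y))
      = u.1 ⬝ᵥ v.2 + X.sgn F * (u.2 ⬝ᵥ v.1) + pairing x y := by
  change LinearFamily.split F ℓ m (u.1, x.1) ⬝ᵥ LinearFamily.split F ℓ m (v.2, y.2.1)
    + X.sgn F * (LinearFamily.split F ℓ m (u.2, x.2.1) ⬝ᵥ LinearFamily.split F ℓ m (v.1, y.1))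
    + 2 * (x.2.2 ⬝ᵥ y.2.2) = _
  rw [append_dotProduct, append_dotProduct, pairing]
  ring

theorem quadPart_split (u : (Fin ℓ → F) × (Fin ℓ → F)) (x : X.Space F m) :
    quadPart (X.split F ℓ m (u, x)) = X.quad F * (u.1 ⬝ᵥ u.2) + quadPart x := by
  rw [quadPart, quadraticForm_split, quadPart]
  ring

theorem mem_group_of_blockHom {h : X.Space F m ≃ₗ[F] X.Space F m}
    (hh : blockHom (X.split F ℓ m) h ∈ X.group F (ℓ + m)) : h ∈ X.group F m := by
  rw [mem_group_iff] at hh ⊢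
  obtain ⟨h1, h2, h3⟩ := hh
  rw [det_blockHom] at h3
  refine ⟨fun x y => ?_, fun x => ?_, h3⟩
  · have := h1 (X.split F ℓ m (0, x)) (X.split F ℓ m (0, y))
    rw [blockHom_apply, blockHom_apply, pairing_split, pairing_split] at this
    exact add_left_cancel this
  · have := h2 (X.split F ℓ m (0, x))
    rw [blockHom_apply, quadPart_split, quadPart_split] at this
    exact add_left_cancel this

variable (X F ℓ m)

/-- The decomposition of the space for `ℓ + m` with the span of `a_1, …, a_ℓ` split off. -/
def splitA : ((Fin ℓ → F) × ((Fin ℓ → F) × X.Space F m)) ≃ₗ[F] X.Space F (ℓ + m) :=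
  (LinearEquiv.prodAssoc F _ _ _).symm.trans (X.split F ℓ m)

/-- The decomposition of the space for `ℓ + m` with the span of `b_1, …, b_ℓ` split off. -/
def splitB : (((Fin ℓ → F) × X.Space F m) × (Fin ℓ → F)) ≃ₗ[F] X.Space F (ℓ + m) :=
  (((LinearEquiv.prodComm F _ _).trans (LinearEquiv.prodAssoc F _ _ _).symm).trans
    ((LinearEquiv.prodComm F _ _).prodCongr (LinearEquiv.refl F _))).trans (X.split F ℓ m)

variable {X F ℓ m}

theorem splitA_apply (a b : Fin ℓ → F) (x : X.Space F m) :
    X.splitA F ℓ m (a, (b, x)) = X.split F ℓ m ((a, b), x) := rfl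

theorem splitB_apply (a b : Fin ℓ → F) (x : X.Space F m) :
    X.splitB F ℓ m ((a, x), b) = X.split F ℓ m ((a, b), x) := rfl

variable (X F ℓ m)

/-- The span of `a_1, …, a_ℓ`. -/
abbrev spanA : Submodule F (X.Space F (ℓ + m)) := block (X.splitA F ℓ m) ⊤ ⊥

/-- The span of `b_1, …, b_ℓ`. -/
abbrev spanB : Submodule F (X.Space F (ℓ + m)) := block (X.splitB F ℓ m) ⊥ ⊤

/-- The orthogonal complement of the span of `a_1, …, a_ℓ`. -/
abbrev perpA : Submodule F (X.Space F (ℓ + m)) := block (X.splitB F ℓ m) ⊤ ⊥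

variable {X F ℓ m}

theorem split_mem_spanA {a b : Fin ℓ → F} {x : X.Space F m} :
    X.split F ℓ m ((a, b), x) ∈ X.spanA F ℓ m ↔ b = 0 ∧ x = 0 := by
  rw [← splitA_apply, mem_block]
  simp

theorem split_mem_spanB {a b : Fin ℓ → F} {x : X.Space F m} :
    X.split F ℓ m ((a, b), x) ∈ X.spanB F ℓ m ↔ a = 0 ∧ x = 0 := by
  rw [← splitB_apply, mem_block]
  simp

theorem split_mem_perpA {a b : Fin ℓ → F} {x : X.Space F m} :
    X.split F ℓ m ((a, b), x) ∈ X.perpA F ℓ m ↔ b = 0 := by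
  rw [← splitB_apply, mem_block]
  simp

theorem exists_split (v : X.Space F (ℓ + m)) : ∃ a b x, X.split F ℓ m ((a, b), x) = v := by
  obtain ⟨⟨⟨a, b⟩, x⟩, h⟩ := (X.split F ℓ m).surjective v
  exact ⟨a, b, x, h⟩

theorem spanA_le_perpA : X.spanA F ℓ m ≤ X.perpA F ℓ m := by
  intro v hv
  obtain ⟨a, b, x, rfl⟩ := exists_split v
  exact split_mem_perpA.2 (split_mem_spanA.1 hv).1

/-- Pairing with `a_j` reads off the coordinate at `b_j` up to sign. In this intrinsic form it is
clear that the stabilizer preserves `perpA`. -/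
theorem mem_perpA_iff {v : X.Space F (ℓ + m)} : v ∈ X.perpA F ℓ m ↔
    ∀ a, pairing v (X.split F ℓ m ((a, 0), 0)) = 0 := by
  obtain ⟨a, b, x, rfl⟩ := exists_split v
  rw [split_mem_perpA]
  simp only [pairing_split, dotProduct_zero, pairing_zero_right, zero_add, add_zero, mul_eq_zero,
    sgn_ne_zero, false_or]
  constructor
  · rintro rfl a
    exact zero_dotProduct a
  · intro h
    funext i
    simpa using h (Pi.single i 1)

theorem split_single (j : Fin ℓ) : X.split F ℓ m ((Pi.single j 1, 0), 0)
    = ((Pi.single (Fin.castAdd m j) 1, 0, 0) : X.Space F (ℓ + m)) :=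
  Prod.ext (LinearFamily.split_single j) (Prod.ext (map_zero (LinearFamily.split F ℓ m)) rfl)

theorem stab_apply (g : X.stab F ℓ (ℓ + m)) (a : Fin ℓ → F) :
    g.1.1 (X.split F ℓ m ((a, 0), 0)) = X.split F ℓ m ((a, 0), 0) := by
  have h : (g.1.1 : X.Space F (ℓ + m) →ₗ[F] _) ∘ₗ (X.split F ℓ m).toLinearMap ∘ₗ
        LinearMap.inl F _ _ ∘ₗ LinearMap.inl F _ _
      = (X.split F ℓ m).toLinearMap ∘ₗ LinearMap.inl F _ _ ∘ₗ LinearMap.inl F _ _ := by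
    refine LinearMap.pi_ext' fun j => LinearMap.ext_ring ?_
    simp only [LinearMap.comp_apply, LinearMap.inl_apply, LinearMap.single_apply,
      LinearEquiv.coe_coe, split_single]
    exact g.2 _ (by simp)
  exact LinearMap.congr_fun h a

theorem mem_stab (g : X.group F (ℓ + m))
    (h : ∀ a, g.1 (X.split F ℓ m ((a, 0), 0)) = X.split F ℓ m ((a, 0), 0)) :
    g ∈ X.stab F ℓ (ℓ + m) := by
  intro j hj
  have h1 := h (Pi.single ⟨j, hj⟩ 1)
  rw [split_single] at h1
  exact h1

theorem pairing_group (g : X.group F n) (x y : X.Space F n) :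
    pairing (g.1 x) (g.1 y) = pairing x y := (mem_group_iff.1 g.2).1 x y

theorem map_eq_of_mem_iff (g : X.Space F n ≃ₗ[F] X.Space F n) {W : Submodule F (X.Space F n)}
    (h : ∀ v, g v ∈ W ↔ v ∈ W) : W.map (g : X.Space F n →ₗ[F] X.Space F n) = W := by
  ext v
  obtain ⟨v, rfl⟩ := g.surjective v
  rw [h]
  constructor
  · rintro ⟨w, hw, hwv⟩
    rwa [← g.injective hwv]
  · exact fun hv => ⟨v, hv, rfl⟩

theorem map_perpA (g : X.stab F ℓ (ℓ + m)) :
    (X.perpA F ℓ m).map (g.1.1 : X.Space F (ℓ + m) →ₗ[F] X.Space F (ℓ + m)) = X.perpA F ℓ m := by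
  refine map_eq_of_mem_iff g.1.1 fun v => ?_
  rw [mem_perpA_iff, mem_perpA_iff]
  refine forall_congr' fun a => ?_
  conv_lhs => rw [← stab_apply g a, pairing_group]

/-- An element of the stabilizer of `a_1, …, a_ℓ` preserving the span of `b_1, …, b_ℓ` lies in
`1 × G_m`. -/
theorem mem_range_inclusion (g : X.stab F ℓ (ℓ + m)) (hg : (X.spanB F ℓ m).map
    (g.1.1 : X.Space F (ℓ + m) →ₗ[F] X.Space F (ℓ + m)) = X.spanB F ℓ m) :
    g ∈ (X.inclusion F ℓ m).range := by
  -- A vector of `spanB` is determined by its pairings with the `a_i`. These vectors are fixed by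
  -- `g`, and `g` preserves the pairing.
  have hB : ∀ b, g.1.1 (X.split F ℓ m ((0, b), 0)) = X.split F ℓ m ((0, b), 0) := by
    intro b
    have h1 : g.1.1 (X.split F ℓ m ((0, b), 0)) ∈ X.spanB F ℓ m := by
      rw [← hg]
      exact Submodule.mem_map_of_mem (split_mem_spanB.2 ⟨rfl, rfl⟩)
    obtain ⟨a, b', x, h2⟩ := exists_split (g.1.1 (X.split F ℓ m ((0, b), 0)))
    rw [← h2] at h1
    obtain ⟨rfl, rfl⟩ := split_mem_spanB.1 h1
    rw [← h2]
    congr 3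
    funext i
    have h3 := pairing_group g.1 (X.split F ℓ m ((Pi.single i 1, 0), 0))
      (X.split F ℓ m ((0, b), 0))
    rw [stab_apply, ← h2, pairing_split, pairing_split] at h3
    simpa [pairing_zero_right] using h3
  have hAB : ∀ u, g.1.1 (X.split F ℓ m (u, 0)) = X.split F ℓ m (u, 0) := by
    rintro ⟨a, b⟩
    have h1 : X.split F ℓ m ((a, b), 0)
        = X.split F ℓ m ((a, 0), 0) + X.split F ℓ m ((0, b), 0) := by
      rw [← map_add]; simp
    rw [h1, map_add, stab_apply, hB]
  -- The space for `m` is the orthogonal complement of the hyperbolic part. Since `g` fixes that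
  -- part pointwise, it preserves the complement.
  have hperp : ∀ v, v ∈ block (X.split F ℓ m) ⊥ ⊤ ↔
      ∀ u, pairing v (X.split F ℓ m (u, 0)) = 0 := by
    intro v
    obtain ⟨a, b, x, rfl⟩ := exists_split v
    rw [mem_block]
    simp only [pairing_split, pairing_zero_right, add_zero, Submodule.mem_top, and_true,
      Submodule.mem_bot]
    constructor
    · intro h u
      obtain ⟨rfl, rfl⟩ := Prod.mk_eq_zero.1 h
      simp
    · intro h
      refine Prod.mk_eq_zero.2 ⟨funext fun i => ?_, funext fun i => ?_⟩
      · simpa using h (0, Pi.single i 1)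
      · simpa [sgn_ne_zero] using h (Pi.single i 1, 0)
  obtain ⟨k, hk⟩ := exists_eq_blockHom g.1.1 hAB (map_eq_of_mem_iff g.1.1 fun v => by
    rw [hperp, hperp]
    refine forall_congr' fun u => ?_
    conv_lhs => rw [← hAB u, pairing_group])
  exact ⟨⟨k, mem_group_of_blockHom (ℓ := ℓ) (hk ▸ g.1.2)⟩, Subtype.ext (Subtype.ext hk.symm)⟩

end IsotropicFamily
end SteinbergStability

/-! ### The isotropic families: flags in general position. -/

namespace SteinbergStability
namespace IsotropicFamily

variable {X : IsotropicFamily} {F : Type u} [Field F] {ℓ m n : ℕ}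

theorem finrank_vertex (f : FlagOf (IsNonzeroIsotropic : Submodule F (X.Space F n) → Prop) n)
    {i : ℕ} (hi : i ≤ n) : Module.finrank F (vertex f.1 i) = i := by
  rcases Nat.eq_zero_or_pos i with rfl | h0
  · rw [vertex_zero, finrank_bot]
  · obtain ⟨j, rfl⟩ : ∃ j : Fin n, i = j + 1 := ⟨⟨i - 1, by omega⟩, by simp; omega⟩
    rw [vertex_succ]
    exact FlagOf.finrank_eq (fun _ h => h.1) (X.finrank_le_of_isotropic F n) f j

theorem vertex_lt (f : FlagOf (IsNonzeroIsotropic : Submodule F (X.Space F n) → Prop) n)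
    {i j : ℕ} (hij : i < j) (hj : j ≤ n) : vertex f.1 i < vertex f.1 j :=
  vertex_strict_of_ne_bot (fun _ h => h.1) f hij hj

theorem isotropic_vertex (f : FlagOf (IsNonzeroIsotropic : Submodule F (X.Space F n) → Prop) n)
    {i : ℕ} (hi : i ≤ n) : Isotropic (vertex f.1 i) := by
  rcases Nat.eq_zero_or_pos i with rfl | h0
  · rw [vertex_zero, isotropic_iff]
    constructor
    · intro x _ y hy
      rw [(Submodule.mem_bot F).1 hy, pairing_zero_right]
    · intro x hx
      rw [(Submodule.mem_bot F).1 hx]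
      simpa using quadPart_smul 0 (0 : X.Space F n)
  · obtain ⟨j, rfl⟩ : ∃ j : Fin n, i = j + 1 := ⟨⟨i - 1, by omega⟩, by simp; omega⟩
    rw [vertex_succ]
    exact (f.2.2 j).2

theorem finrank_le {W : Submodule F (X.Space F n)} (hW : Isotropic W) :
    Module.finrank F W ≤ n := by
  by_cases h : W = ⊥
  · rw [h, finrank_bot]; exact Nat.zero_le n
  · exact X.finrank_le_of_isotropic F n W ⟨h, hW⟩

/-- A maximal isotropic subspace contains every isotropic vector orthogonal to it. -/
theorem mem_of_isotropic {W : Submodule F (X.Space F n)} (hW : Isotropic W)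
    (hn : Module.finrank F W = n) {x : X.Space F n} (hx : quadPart x = 0) (hxx : pairing x x = 0)
    (h : ∀ y ∈ W, pairing x y = 0) : x ∈ W := by
  rw [isotropic_iff] at hW
  have h' : ∀ y ∈ W, pairing y x = 0 := fun y hy => by rw [pairing_comm, h y hy, mul_zero]
  -- Adjoining `x` keeps the subspace isotropic, and isotropic subspaces have dimension at most `n`,
  -- so nothing is gained.
  have hsup : Isotropic (W ⊔ Submodule.span F {x}) := by
    rw [isotropic_iff]
    constructor
    · intro u hu v hv
      obtain ⟨y, hy, _, hc, rfl⟩ := Submodule.mem_sup.1 hu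
      obtain ⟨c, rfl⟩ := Submodule.mem_span_singleton.1 hc
      obtain ⟨y', hy', _, hc', rfl⟩ := Submodule.mem_sup.1 hv
      obtain ⟨c', rfl⟩ := Submodule.mem_span_singleton.1 hc'
      simp only [pairing_add_left, pairing_add_right, pairing_smul_left, pairing_smul_right,
        hW.1 y hy y' hy', h y' hy', h' y hy, hxx]
      ring
    · intro u hu
      obtain ⟨y, hy, _, hc, rfl⟩ := Submodule.mem_sup.1 hu
      obtain ⟨c, rfl⟩ := Submodule.mem_span_singleton.1 hc
      rw [quadPart_add, quadPart_smul, pairing_smul_right, hW.2 y hy, h' y hy, hx]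
      ring
  have h1 := finrank_le hsup
  have h2 := Submodule.eq_of_le_of_finrank_le (le_sup_left : W ≤ W ⊔ Submodule.span F {x})
    (by omega)
  rw [h2]
  exact Submodule.mem_sup_right (Submodule.mem_span_singleton_self x)

theorem mem_spanA_iff {v : X.Space F (ℓ + m)} :
    v ∈ X.spanA F ℓ m ↔ ∃ a, X.split F ℓ m ((a, 0), 0) = v := by
  obtain ⟨a, b, x, rfl⟩ := exists_split v
  rw [split_mem_spanA]
  constructor
  · rintro ⟨rfl, rfl⟩
    exact ⟨a, rfl⟩
  · rintro ⟨a', h⟩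
    have h1 := (X.split F ℓ m).injective h
    simp only [Prod.mk.injEq] at h1
    exact ⟨h1.1.2.symm, h1.2.symm⟩

theorem pairing_spanA_perpA {x y : X.Space F (ℓ + m)} (hx : x ∈ X.spanA F ℓ m)
    (hy : y ∈ X.perpA F ℓ m) : pairing x y = 0 := by
  obtain ⟨a, rfl⟩ := mem_spanA_iff.1 hx
  rw [pairing_comm, mem_perpA_iff.1 hy, mul_zero]

theorem quadPart_spanA {x : X.Space F (ℓ + m)} (hx : x ∈ X.spanA F ℓ m) : quadPart x = 0 := by
  obtain ⟨a, rfl⟩ := mem_spanA_iff.1 hx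
  rw [quadPart_split, dotProduct_zero, mul_zero, zero_add]
  simpa using quadPart_smul 0 (0 : X.Space F m)

/-- An isotropic subspace of codimension one in a maximal one is contained in at most one maximal
isotropic subspace of larger intersection with `perpA`, provided that some vector of `spanA`
orthogonal to it is not in it. -/
theorem mem_of_inf_perpA_lt {P W : Submodule F (X.Space F (ℓ + m))} (hPW : P ≤ W)
    (hW : Isotropic W) (hP : Module.finrank F P + 1 = ℓ + m)
    (hn : Module.finrank F W = ℓ + m) {x : X.Space F (ℓ + m)} (hx : x ∈ X.spanA F ℓ m)
    (hxP : ∀ y ∈ P, pairing x y = 0) (h : P ⊓ X.perpA F ℓ m < W ⊓ X.perpA F ℓ m) : x ∈ W := by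
  -- Here `W` is spanned by `P` and a vector `y` of `perpA`. The vector `x` is orthogonal to `P` by
  -- assumption and to `y` because it lies in `spanA`, so maximality puts it into `W`.
  obtain ⟨y, ⟨hyW, hyE⟩, hy⟩ := SetLike.exists_of_lt h
  have hyP : y ∉ P := fun h => hy ⟨h, hyE⟩
  have hsup : W = P ⊔ Submodule.span F {y} := by
    symm
    refine Submodule.eq_of_le_of_finrank_le
      (sup_le hPW ((Submodule.span_singleton_le_iff_mem _ _).2 hyW)) ?_
    have h1 : P < P ⊔ Submodule.span F {y} := lt_of_le_of_ne le_sup_left fun h => hyP (by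
      rw [h]; exact Submodule.mem_sup_right (Submodule.mem_span_singleton_self y))
    have := Submodule.finrank_lt_finrank_of_lt h1
    omega
  refine mem_of_isotropic hW hn (quadPart_spanA hx) (pairing_spanA_perpA hx (spanA_le_perpA hx)) ?_
  intro w hw
  rw [hsup] at hw
  obtain ⟨p, hp, _, hc, rfl⟩ := Submodule.mem_sup.1 hw
  obtain ⟨c, rfl⟩ := Submodule.mem_span_singleton.1 hc
  rw [pairing_add_right, pairing_smul_right, hxP p hp, pairing_spanA_perpA hx hyE, mul_zero,
    add_zero]

/-- Either `P` projects onto the span of the `b_j`, or it has a nonzero orthogonal vector in the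
span of the `a_j`. -/
theorem finrank_inf_perpA_or (P : Submodule F (X.Space F (ℓ + m))) :
    ℓ + Module.finrank F (P ⊓ X.perpA F ℓ m : Submodule F (X.Space F (ℓ + m)))
      = Module.finrank F P ∨
    ∃ x ∈ X.spanA F ℓ m, x ≠ 0 ∧ ∀ y ∈ P, pairing x y = 0 := by
  let π : X.Space F (ℓ + m) →ₗ[F] (Fin ℓ → F) :=
    LinearMap.snd F _ _ ∘ₗ (X.splitB F ℓ m).symm.toLinearMap
  have hπ : ∀ a b x, π (X.split F ℓ m ((a, b), x)) = b := fun a b x => by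
    rw [← splitB_apply]
    simp [π]
  have hker : LinearMap.ker π = X.perpA F ℓ m := by
    ext v
    obtain ⟨a, b, x, rfl⟩ := exists_split v
    rw [LinearMap.mem_ker, hπ, split_mem_perpA]
  have h1 := finrank_map_add_finrank_inf_ker π P
  rw [hker] at h1
  have h2 := finrank_annihilator (P.map π)
  -- The kernel of `π` is `perpA`. If `π` maps `P` onto `F^ℓ`, rank-nullity gives the first
  -- alternative; otherwise a nonzero annihilator of the image supplies the coordinates of `x`.
  by_cases h : annihilator (P.map π) = ⊥
  · left
    rw [h, finrank_bot] at h2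
    omega
  · right
    obtain ⟨a, ha, ha0⟩ := Submodule.exists_mem_ne_zero_of_ne_bot h
    refine ⟨X.split F ℓ m ((a, 0), 0), mem_spanA_iff.2 ⟨a, rfl⟩, fun h0 => ha0 ?_, fun y hy => ?_⟩
    · rw [LinearEquiv.map_eq_zero_iff] at h0
      exact congrArg (fun v => v.1.1) h0
    · have h3 := ha _ (Submodule.mem_map_of_mem hy)
      obtain ⟨a', b, x, rfl⟩ := exists_split y
      rw [hπ] at h3
      rw [pairing_comm, pairing_split, pairing_zero_right]
      simp [h3]

variable (X F ℓ m)

/-- The flags in general position with respect to the span of `a_1, …, a_ℓ`. -/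
def Opposite
    (f : FlagOf (IsNonzeroIsotropic : Submodule F (X.Space F (ℓ + m)) → Prop) (ℓ + m)) : Prop :=
  vertex f.1 ℓ ⊓ X.perpA F ℓ m = ⊥

variable {X F ℓ m}

theorem eq_zero_of_opposite {R : Type u} [CommRing R] (hℓ : 1 ≤ ℓ)
    (z : Chain R (IsNonzeroIsotropic : Submodule F (X.Space F (ℓ + m)) → Prop) (ℓ + m))
    (hz : FacesVanish z) (h : ∀ f, X.Opposite F ℓ m f → z f = 0) : z = 0 := by
  by_contra h0
  set A := X.spanA F ℓ m with hA
  set E := X.perpA F ℓ m with hE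
  have hAE : A ≤ E := spanA_le_perpA
  -- General position concerns only `E`. The intersections with `A` are included to control the last
  -- vertex.
  obtain ⟨f, hf, hmin⟩ := hz.exists_minimal h0 fun W =>
    Module.finrank F (W ⊓ E : Submodule F (X.Space F (ℓ + m))) +
      Module.finrank F (W ⊓ A : Submodule F (X.Space F (ℓ + m)))
  apply hf
  apply h
  have hle : ∀ i < ℓ + m, vertex f.1 i ≤ vertex f.1 (i + 1) := fun i hi =>
    (vertex_lt f (by omega) (by omega)).le
  let d (D : Submodule F (X.Space F (ℓ + m))) (i : ℕ) : ℕ :=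
    Module.finrank F (vertex f.1 i ⊓ D : Submodule F (X.Space F (ℓ + m)))
  have hdesc : ∀ i, i + 2 ≤ ℓ + m → (d E (i + 1) = d E (i + 2) → d E (i + 1) = d E i) ∧
      (d A (i + 1) = d A (i + 2) → d A (i + 1) = d A i) := fun i hi => by
    obtain ⟨g, hne, heq, hw⟩ := hmin (i + 1) (by omega) (by omega)
    have hg1 : vertex g.1 i < vertex g.1 (i + 1) := vertex_lt g (by omega) (by omega)
    have hg2 : vertex g.1 (i + 1) < vertex g.1 (i + 2) := vertex_lt g (by omega) (by omega)
    rw [heq i (by omega)] at hg1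
    rw [heq (i + 2) (by omega)] at hg2
    exact finrank_inf_of_minimal (hle i (by omega)) (hle (i + 1) (by omega)) hg1.le hg2.le
      (by rw [finrank_vertex f (by omega), finrank_vertex f (by omega)])
      (by rw [finrank_vertex g (by omega), finrank_vertex f (by omega)]) hne hAE hw
  have hstep : ∀ (D : Submodule F (X.Space F (ℓ + m))), ∀ i < ℓ + m,
      d D (i + 1) ≤ d D i + 1 := by
    intro D i hi
    have h1 := finrank_inf_add_le (hle i hi) D
    rw [finrank_vertex f (show i + 1 ≤ ℓ + m from hi), finrank_vertex f hi.le] at h1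
    simp only [d]
    omega
  have hseq : ∀ D, (∀ i, i + 2 ≤ ℓ + m → d D (i + 1) = d D (i + 2) → d D (i + 1) = d D i) →
      ∀ i ≤ ℓ + m, d D i = 0 ∨ d D (ℓ + m) = d D i + (ℓ + m - i) := fun D hD i hi =>
    eq_zero_or_of_no_descent (by simp [vertex_zero])
      (fun i hi => finrank_inf_mono (hle i hi) D) (hstep D) hD hi
  have hEseq := hseq E fun i hi => (hdesc i hi).1
  have hAseq := hseq A fun i hi => (hdesc i hi).2
  simp only [d] at hEseq hAseq hstep
  rw [Opposite, ← hE, ← Submodule.finrank_eq_zero (R := F)]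
  obtain ⟨k, hk⟩ : ∃ k, ℓ + m = k + 1 := ⟨ℓ + m - 1, by omega⟩
  have hP := finrank_vertex f (show k ≤ ℓ + m by omega)
  have hL := finrank_vertex f (le_refl (ℓ + m))
  have hPL : vertex f.1 k ≤ vertex f.1 (ℓ + m) :=
    (vertex_lt f (by omega) le_rfl).le
  have hEmono : Module.finrank F (vertex f.1 ℓ ⊓ E : Submodule F (X.Space F (ℓ + m))) ≤
      Module.finrank F (vertex f.1 (ℓ + m) ⊓ E : Submodule F (X.Space F (ℓ + m))) := by
    rcases Nat.eq_zero_or_pos m with hm | hm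
    · subst hm; exact le_rfl
    · exact finrank_inf_mono (vertex_lt f (by omega) le_rfl).le E
  have hElast := finrank_inf_add_le hPL E
  rw [hP, hL] at hElast
  -- The exchange argument `hdesc` does not reach the maximal isotropic space, which has no
  -- successor. If the space below it projects onto `F^ℓ`, it meets `E` in dimension `m - 1`; the
  -- last intersection then has dimension at most `m`, and late jumping makes the one at position
  -- `ℓ` zero.
  rcases finrank_inf_perpA_or (vertex f.1 k) with h1 | ⟨x, hxA, hx0, hxP⟩
  · rw [hP, ← hE] at h1
    rcases hEseq ℓ (by omega) with h2 | h2
    · exact h2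
    · omega
  · have hEk := hEseq k (by omega)
    have hAk := hAseq k (by omega)
    -- If the last step is no jump for `E`, then no step is, and all intersections with `E` are
    -- zero.
    suffices hsuff : Module.finrank F (vertex f.1 (ℓ + m) ⊓ E : Submodule F (X.Space F (ℓ + m)))
        ≤ Module.finrank F (vertex f.1 k ⊓ E : Submodule F (X.Space F (ℓ + m))) by
      omega
    by_contra hlt
    -- In this case the last step is no jump for `A`, because vectors of the last space are
    -- orthogonal to the preceding one. Hence there is no jump for `A` at all, although the
    -- preceding space contains the nonzero vector `x` of `A`.
    by_cases hall : ∀ x ∈ A, (∀ y ∈ vertex f.1 k, pairing x y = 0) → x ∈ vertex f.1 k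
    · have h3 : vertex f.1 (ℓ + m) ⊓ A ≤ vertex f.1 k ⊓ A := fun y hy =>
        ⟨hall y hy.2 fun w hw => (isotropic_iff.1 (isotropic_vertex f le_rfl)).1 y hy.1 w
          (hPL hw), hy.2⟩
      have h4 := Submodule.finrank_mono h3
      have h5 : vertex f.1 k ⊓ A = ⊥ := by
        rw [← Submodule.finrank_eq_zero (R := F)]
        omega
      have h6 : x ∈ vertex f.1 k ⊓ A := ⟨hall x hxA hxP, hxA⟩
      rw [h5] at h6
      exact hx0 h6
    -- Now some `x` in `A` is orthogonal to the space at position `k` but not in it. A maximal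
    -- isotropic space above that one with a jump for `E` must contain `x`, so there is only one
    -- such space, the last vertex of `f`. Its replacement in `g` thus jumps neither for `E` nor for
    -- `A`, and has smaller weight.
    · push Not at hall
      obtain ⟨x, hxA, hxP, hxnot⟩ := hall
      obtain ⟨g, hne, heq, hw⟩ := hmin (ℓ + m) (by omega) le_rfl
      have hPg : vertex f.1 k ≤ vertex g.1 (ℓ + m) := by
        rw [← heq k (by omega)]
        exact (vertex_lt g (by omega) le_rfl).le
      have hxmem : ∀ (g : FlagOf (IsNonzeroIsotropic : Submodule F (X.Space F (ℓ + m)) → Prop)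
          (ℓ + m)), vertex f.1 k ≤ vertex g.1 (ℓ + m) →
          vertex f.1 k ⊓ E < vertex g.1 (ℓ + m) ⊓ E →
          vertex g.1 (ℓ + m) = vertex f.1 k ⊔ Submodule.span F {x} := by
        intro g hPg hlt
        have hx := mem_of_inf_perpA_lt hPg (isotropic_vertex g le_rfl) (by rw [hP, hk])
          (finrank_vertex g le_rfl) hxA hxP hlt
        symm
        refine Submodule.eq_of_le_of_finrank_le
          (sup_le hPg ((Submodule.span_singleton_le_iff_mem _ _).2 hx)) ?_
        have h1 : vertex f.1 k < vertex f.1 k ⊔ Submodule.span F {x} :=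
          lt_of_le_of_ne le_sup_left fun h => hxnot (by
            rw [h]; exact Submodule.mem_sup_right (Submodule.mem_span_singleton_self x))
        have := Submodule.finrank_lt_finrank_of_lt h1
        rw [finrank_vertex g le_rfl]
        omega
      have hfx := hxmem f hPL (lt_of_le_of_ne (inf_le_inf_right E hPL) fun h => hlt (by rw [h]))
      have hgE : vertex f.1 k ⊓ E = vertex g.1 (ℓ + m) ⊓ E := by
        by_contra hgE
        exact hne ((hxmem g hPg (lt_of_le_of_ne (inf_le_inf_right E hPg) hgE)).trans hfx.symm)
      have hgA : vertex g.1 (ℓ + m) ⊓ A ≤ vertex f.1 k ⊓ A := fun y hy =>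
        ⟨(hgE.ge ⟨hy.1, hAE hy.2⟩).1, hy.2⟩
      have h4 := Submodule.finrank_mono hgA
      have h5 := finrank_inf_mono hPL A
      rw [← hgE] at hw
      omega

end IsotropicFamily
end SteinbergStability

/-! ### The isotropic families: the Reeder product in general position. -/

namespace SteinbergStability

section Hyperbolic

variable {F : Type u} [Field F] {ℓ : ℕ}

theorem vertex_hypFlag (w : Fin ℓ → Bool)
    (f : FlagOf (IsProper : Submodule F (Fin ℓ → F) → Prop) (ℓ - 1)) {t : ℕ} (ht : t ≤ ℓ) :
    vertex (hypFlag w f).1 t = hypVertex w f.1 t := by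
  rcases Nat.eq_zero_or_pos t with rfl | h0
  · rw [vertex_zero, hypVertex, letterCount_zero, letterCount_zero, vertex_zero, Nat.sub_zero,
      vertex_of_proper, annihilator_top, Submodule.prod_bot]
  · obtain ⟨j, rfl⟩ : ∃ j : Fin ℓ, t = j + 1 := ⟨⟨t - 1, by omega⟩, by simp; omega⟩
    rw [vertex_succ]
    rfl

theorem letterCount_const_false {n : ℕ} (t : ℕ) :
    letterCount (fun _ : Fin n => false) true t = 0 := by
  simp [letterCount]

theorem hypVertex_const_false
    (f : FlagOf (IsProper : Submodule F (Fin ℓ → F) → Prop) (ℓ - 1)) {t : ℕ} (ht : t ≤ ℓ) :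
    hypVertex (fun _ : Fin ℓ => false) f.1 t
      = (⊥ : Submodule F (Fin ℓ → F)).prod (annihilator (vertex f.1 (ℓ - t))) := by
  have h := letterCount_add (fun _ : Fin ℓ => false) ht
  rw [letterCount_const_false, zero_add] at h
  rw [hypVertex, letterCount_const_false, h, vertex_zero]

theorem isUnit_hypSign {R : Type u} [CommRing R] (w : Fin ℓ → Bool) : IsUnit (hypSign R w) := by
  refine Finset.prod_induction _ IsUnit (fun _ _ => IsUnit.mul) isUnit_one fun i _ => ?_
  split_ifs
  · exact isUnit_one.neg.pow _
  · exact isUnit_one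

theorem finsuppTensorFinsupp'_mapDomain {R α α' β : Type u} [CommRing R] (φ : α → α') (z : α →₀ R)
    (y : β →₀ R) : finsuppTensorFinsupp' R α' β (Finsupp.mapDomain φ z ⊗ₜ y)
      = Finsupp.mapDomain (Prod.map φ id) (finsuppTensorFinsupp' R α β (z ⊗ₜ y)) := by
  induction z using Finsupp.induction_linear with
  | zero => simp
  | add z z' h1 h2 =>
    rw [Finsupp.mapDomain_add, TensorProduct.add_tmul, map_add, h1, h2, TensorProduct.add_tmul,
      map_add, Finsupp.mapDomain_add]
  | single a r =>
    induction y using Finsupp.induction_linear with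
    | zero => simp
    | add y y' h1 h2 =>
      rw [TensorProduct.tmul_add, map_add, h1, h2, TensorProduct.tmul_add, map_add,
        Finsupp.mapDomain_add]
    | single b s =>
      rw [Finsupp.mapDomain_single, finsuppTensorFinsupp'_single_tmul_single,
        finsuppTensorFinsupp'_single_tmul_single, Finsupp.mapDomain_single]
      rfl

end Hyperbolic

namespace IsotropicFamily

variable (X : IsotropicFamily) (F : Type u) [Field F] (ℓ m : ℕ)

/-- The term of the Reeder product for the words `w`. -/
def productFlag (w : Shuffle ℓ m × (Fin ℓ → Bool))
    (x : FlagOf (IsProper : Submodule F (Fin ℓ → F) → Prop) (ℓ - 1) ×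
      FlagOf (IsNonzeroIsotropic : Submodule F (X.Space F m) → Prop) m) :
    FlagOf (IsNonzeroIsotropic : Submodule F (X.Space F (ℓ + m)) → Prop) (ℓ + m) :=
  joinFlag (X.joinValid F ℓ m) w.1 (hypFlag w.2 x.1, x.2)

/-- The words giving a flag in general position. -/
def oppositeWords : Shuffle ℓ m × (Fin ℓ → Bool) := (Shuffle.first ℓ m, fun _ => false)

/-- Merges the suspension and the shuffles into a single signed sum over pairs of words, the shape
required by `FlagEmbedding.induced_bijective`. -/
theorem reederProduct_eq_sum (R : Type u) [CommRing R]
    (x : LinearFamily.SteinbergModule F R ℓ ⊗[R] X.SteinbergModule F R m) :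
    (X.reederProduct F R ℓ m x).1 = ∑ w : Shuffle ℓ m × (Fin ℓ → Bool),
      (w.1.sign R * hypSign R w.2) • Finsupp.mapDomain (X.productFlag F ℓ m w)
        (bicycle (cycles R (IsProper : Submodule F (Fin ℓ → F) → Prop) (ℓ - 1))
          (cycles R (IsNonzeroIsotropic : Submodule F (X.Space F m) → Prop) m) x) := by
  induction x using TensorProduct.induction_on with
  | zero => simp
  | add x y hx hy =>
    rw [map_add, Submodule.coe_add, hx, hy, ← Finset.sum_add_distrib]
    refine Finset.sum_congr rfl fun w _ => ?_
    rw [map_add, Finsupp.mapDomain_add, smul_add]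
  | tmul z y =>
    change (∑ w : Shuffle ℓ m, w.sign R • Finsupp.lmapDomain R R (joinFlag (X.joinValid F ℓ m) w))
      (finsuppTensorFinsupp' R _ _ (hypChain F R ℓ z.1 ⊗ₜ y.1)) = _
    have h : hypChain F R ℓ z.1
        = ∑ w : Fin ℓ → Bool, hypSign R w • Finsupp.mapDomain (hypFlag w) z.1 := by
      rw [hypChain, LinearMap.sum_apply]
      rfl
    rw [LinearMap.sum_apply, Fintype.sum_prod_type, h, TensorProduct.sum_tmul, map_sum]
    refine Finset.sum_congr rfl fun w _ => ?_
    rw [map_sum]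
    refine Finset.sum_congr rfl fun w' _ => ?_
    rw [← TensorProduct.smul_tmul', map_smul, map_smul, LinearMap.smul_apply, smul_smul,
      mul_comm, finsuppTensorFinsupp'_mapDomain, Finsupp.lmapDomain_apply,
      ← Finsupp.mapDomain_comp]
    rfl

variable {X F ℓ m}

theorem vertex_productFlag (w : Shuffle ℓ m × (Fin ℓ → Bool))
    (x : FlagOf (IsProper : Submodule F (Fin ℓ → F) → Prop) (ℓ - 1) ×
      FlagOf (IsNonzeroIsotropic : Submodule F (X.Space F m) → Prop) m) {t : ℕ} (ht : t ≤ ℓ + m) :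
    vertex (X.productFlag F ℓ m w x).1 t = block (X.split F ℓ m)
      (hypVertex w.2 x.1.1 (letterCount w.1.1 true t))
      (vertex x.2.1 (letterCount w.1.1 false t)) := by
  have h1 := letterCount_mono w.1.1 true ht
  rw [w.1.2] at h1
  rw [productFlag, vertex_joinFlag _ _ _ ht, vertex_hypFlag _ _ h1]

theorem productFlag_apply (w : Shuffle ℓ m × (Fin ℓ → Bool))
    (x : FlagOf (IsProper : Submodule F (Fin ℓ → F) → Prop) (ℓ - 1) ×
      FlagOf (IsNonzeroIsotropic : Submodule F (X.Space F m) → Prop) m) (t : Fin (ℓ + m)) :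
    (X.productFlag F ℓ m w x).1 t = block (X.split F ℓ m)
      (hypVertex w.2 x.1.1 (letterCount w.1.1 true (t + 1)))
      (vertex x.2.1 (letterCount w.1.1 false (t + 1))) := by
  rw [← vertex_productFlag w x t.2]
  exact (vertex_succ _ t).symm

theorem block_splitB_bot (U : Submodule F (Fin ℓ → F)) :
    block (X.splitB F ℓ m) ⊥ U = block (X.split F ℓ m) ((⊥ : Submodule F (Fin ℓ → F)).prod U) ⊥ := by
  ext v
  obtain ⟨a, b, x, rfl⟩ := exists_split v
  rw [← splitB_apply, mem_block, splitB_apply, mem_block]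
  simp only [Submodule.mem_prod, Submodule.mem_bot, Prod.mk_eq_zero]
  tauto

theorem block_splitB_top (W : Submodule F (X.Space F m)) :
    block (X.splitB F ℓ m) ((⊥ : Submodule F (Fin ℓ → F)).prod W) ⊤
      = block (X.split F ℓ m) ((⊥ : Submodule F (Fin ℓ → F)).prod ⊤) W := by
  ext v
  obtain ⟨a, b, x, rfl⟩ := exists_split v
  rw [← splitB_apply, mem_block, splitB_apply, mem_block]
  simp only [Submodule.mem_prod, Submodule.mem_bot, Submodule.mem_top, and_true]

/-- An isotropic subspace containing the span of `b_1, …, b_ℓ`. -/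
theorem exists_eq_block_of_isotropic {Y : Submodule F (X.Space F (ℓ + m))} (hY : Isotropic Y)
    (h : X.spanB F ℓ m ≤ Y) : ∃ W : Submodule F (X.Space F m), Isotropic W ∧
      Y = block (X.splitB F ℓ m) ((⊥ : Submodule F (Fin ℓ → F)).prod W) ⊤ := by
  obtain ⟨U, rfl⟩ := exists_eq_block_of_ge h
  rw [isotropic_iff] at hY
  -- Orthogonality to the vectors `b_i`, all of which lie in the subspace, kills the coordinates at
  -- the `a_i`.
  have hU : ∀ a x, (a, x) ∈ U → a = 0 := by
    intro a x hax
    funext i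
    have h1 := hY.1 (X.splitB F ℓ m ((a, x), 0)) (mem_block.2 ⟨hax, trivial⟩)
      (X.splitB F ℓ m ((0, 0), Pi.single i 1)) (mem_block.2 ⟨U.zero_mem, trivial⟩)
    rw [splitB_apply, splitB_apply, pairing_split, pairing_zero_right] at h1
    simpa using h1
  refine ⟨U.comap (LinearMap.inr F _ _), isotropic_iff.2 ⟨fun x hx y hy => ?_, fun x hx => ?_⟩, ?_⟩
  · have h1 := hY.1 (X.splitB F ℓ m ((0, x), 0)) (mem_block.2 ⟨hx, trivial⟩)
      (X.splitB F ℓ m ((0, y), 0)) (mem_block.2 ⟨hy, trivial⟩)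
    rw [splitB_apply, splitB_apply, pairing_split] at h1
    simpa using h1
  · have h1 := hY.2 (X.splitB F ℓ m ((0, x), 0)) (mem_block.2 ⟨hx, trivial⟩)
    rw [splitB_apply, quadPart_split] at h1
    simpa using h1
  · congr 1
    ext ⟨a, x⟩
    rw [Submodule.mem_prod, Submodule.mem_bot, Submodule.mem_comap]
    constructor
    · intro hax
      obtain rfl := hU a x hax
      exact ⟨rfl, hax⟩
    · rintro ⟨rfl, hx⟩
      exact hx

variable (X F ℓ m)

/-- These are the flags through `spanB`, which sits at index `ℓ - 1`. Above it, isotropic spaces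
correspond to isotropic subspaces of the space for `m`. Below it, annihilators reverse the flag of
`F^ℓ`: the subspace at index `i` has dimension `i + 1`, its annihilator has dimension `ℓ - 1 - i`
and so occupies index `ℓ - 2 - i`. -/
theorem flagEmbedding (hℓ : 1 ≤ ℓ) : FlagEmbedding (X.productFlag F ℓ m (oppositeWords ℓ m))
    (fun i => ⟨ℓ - 2 - i, by omega⟩) (fun j => ⟨ℓ + j, by omega⟩)
    (fun U => block (X.splitB F ℓ m) ⊥ (annihilator U))
    (fun W => block (X.splitB F ℓ m) ((⊥ : Submodule F (Fin ℓ → F)).prod W) ⊤)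
    (fun _ => X.spanB F ℓ m) := by
  have apply_left : ∀ x (i : Fin (ℓ - 1)), (X.productFlag F ℓ m (oppositeWords ℓ m) x).1
      ⟨ℓ - 2 - i, by omega⟩ = block (X.splitB F ℓ m) ⊥ (annihilator (x.1.1 i)) := by
    intro x i
    rw [productFlag_apply, oppositeWords, Shuffle.letterCount_first_true (by simp only; omega),
      Shuffle.letterCount_first_false (by simp only; omega),
      show min (ℓ - 2 - i + 1) ℓ = ℓ - (i + 1) by omega, show ℓ - 2 - i + 1 - ℓ = 0 by omega,
      hypVertex_const_false _ (by omega), vertex_zero, block_splitB_bot,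
      show ℓ - (ℓ - (i + 1)) = i + 1 by omega, vertex_succ]
  have apply_right : ∀ x (j : Fin m), (X.productFlag F ℓ m (oppositeWords ℓ m) x).1
      ⟨ℓ + j, by omega⟩ = block (X.splitB F ℓ m) ((⊥ : Submodule F (Fin ℓ → F)).prod (x.2.1 j)) ⊤ := by
    intro x j
    rw [productFlag_apply, oppositeWords, Shuffle.letterCount_first_true (by simp only; omega),
      Shuffle.letterCount_first_false (by simp only; omega),
      show min (ℓ + j + 1) ℓ = ℓ by omega, show ℓ + j + 1 - ℓ = j + 1 by omega,
      hypVertex_const_false _ le_rfl, Nat.sub_self, vertex_zero, vertex_succ, annihilator_bot,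
      block_splitB_top]
  have apply_const : ∀ x (t : Fin (ℓ + m)), (t : ℕ) + 1 = ℓ →
      (X.productFlag F ℓ m (oppositeWords ℓ m) x).1 t = X.spanB F ℓ m := by
    intro x t h
    rw [productFlag_apply, oppositeWords, Shuffle.letterCount_first_true (by omega),
      Shuffle.letterCount_first_false (by omega), h, min_self,
      hypVertex_const_false _ le_rfl, Nat.sub_self, vertex_zero, vertex_zero, annihilator_bot,
      spanB, block_splitB_bot]
  refine ⟨fun i j h => ?_, fun i j h => Fin.ext (by simpa using h), fun i j h => ?_,
    fun U U' h => annihilator_injective (block_inj.1 h).2, fun W W' h => ?_,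
    apply_left, apply_right, fun x t h1 h2 => ?_, fun f hf => ?_⟩
  · have := congrArg Fin.val h
    simp only at this
    omega
  · have := congrArg Fin.val h
    simp only at this
    omega
  · have h1 := (block_inj.1 h).1
    have h2 : ∀ x, ((0 : Fin ℓ → F), x) ∈ (⊥ : Submodule F (Fin ℓ → F)).prod W ↔
        ((0 : Fin ℓ → F), x) ∈ (⊥ : Submodule F (Fin ℓ → F)).prod W' := fun x => by rw [h1]
    ext x
    simpa using h2 x
  · have h3 : ¬ (t : ℕ) < ℓ - 1 := fun h =>
      h1 ⟨ℓ - 2 - t, by omega⟩ (Fin.ext (by simp only; omega))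
    have h4 : ¬ ℓ ≤ (t : ℕ) := fun h => h2 ⟨t - ℓ, by omega⟩ (Fin.ext (by simp only; omega))
    exact apply_const x t (by omega)
  · have hconst : ∀ t : Fin (ℓ + m), (t : ℕ) + 1 = ℓ → f.1 t = X.spanB F ℓ m := by
      intro t ht
      refine hf t (fun i hi => ?_) (fun i hi => ?_)
      · have := congrArg Fin.val hi; simp only at this; omega
      · have := congrArg Fin.val hi; simp only at this; omega
    have hm := hconst ⟨ℓ - 1, by omega⟩ (by simp only; omega)
    have hltA : ∀ i : Fin (ℓ - 1), f.1 ⟨ℓ - 2 - i, by omega⟩ < X.spanB F ℓ m := by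
      intro i
      rw [← hm]
      exact f.2.1 (Fin.mk_lt_mk.2 (by omega))
    have hltB : ∀ j : Fin m, X.spanB F ℓ m < f.1 ⟨ℓ + j, by omega⟩ := by
      intro i
      rw [← hm]
      exact f.2.1 (Fin.mk_lt_mk.2 (by omega))
    choose U hU using fun i => exists_eq_block_of_le (hltA i).le
    choose W hWi hW using fun i => exists_eq_block_of_isotropic (f.2.2 _).2 (hltB i).le
    have hWlt : ∀ W W' : Submodule F (X.Space F m),
        block (X.splitB F ℓ m) ((⊥ : Submodule F (Fin ℓ → F)).prod W) ⊤ <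
          block (X.splitB F ℓ m) ((⊥ : Submodule F (Fin ℓ → F)).prod W') ⊤ → W < W' := by
      intro W W' h
      rw [block_splitB_top, block_splitB_top] at h
      exact block_lt_block_right.1 h
    have hW0 : block (X.splitB F ℓ m) ((⊥ : Submodule F (Fin ℓ → F)).prod
        (⊥ : Submodule F (X.Space F m))) ⊤ = X.spanB F ℓ m := by
      rw [Submodule.prod_bot]
    let x1 : FlagOf (IsProper : Submodule F (Fin ℓ → F) → Prop) (ℓ - 1) :=
      ⟨fun i => annihilator (U i), fun i j h => annihilator_strictAnti (by
        rw [← block_lt_block_right (e := X.splitB F ℓ m) (U := ⊥), ← hU, ← hU]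
        exact f.2.1 (Fin.mk_lt_mk.2 (by have : (i : ℕ) < j := h; omega))), fun i => ⟨fun h => by
          have h1 : U i = ⊤ := by
            rw [← annihilator_annihilator (U i), show annihilator (U i) = ⊥ from h,
              annihilator_bot]
          have := hltA i
          rw [hU, h1] at this
          exact this.ne rfl, fun h => (f.2.2 ⟨ℓ - 2 - i, by omega⟩).1 (by
            rw [hU, ← annihilator_annihilator (U i), show annihilator (U i) = ⊤ from h,
              annihilator_top, block_bot])⟩⟩
    let x2 : FlagOf (IsNonzeroIsotropic : Submodule F (X.Space F m) → Prop) m :=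
      ⟨W, fun i j h => hWlt _ _ (by
        rw [← hW, ← hW]
        exact f.2.1 (Fin.mk_lt_mk.2 (by have : (i : ℕ) < j := h; omega))), fun i => ⟨fun h => by
          have := hltB i
          rw [hW, h, hW0] at this
          exact this.ne rfl, hWi i⟩⟩
    refine ⟨(x1, x2), Subtype.ext (funext fun t => ?_)⟩
    rcases lt_trichotomy ((t : ℕ) + 1) ℓ with h | h | h
    · have ht : t = ⟨ℓ - 2 - (⟨ℓ - 2 - t, by omega⟩ : Fin (ℓ - 1)), by simp only; omega⟩ :=
        Fin.ext (by simp only; omega)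
      rw [ht]
      refine (apply_left (x1, x2) ⟨ℓ - 2 - t, by omega⟩).trans ?_
      rw [hU]
      exact congrArg _ (annihilator_annihilator _)
    · rw [apply_const _ _ h, hconst t h]
    · have ht : t = ⟨ℓ + (⟨t - ℓ, by omega⟩ : Fin m), by simp only; omega⟩ :=
        Fin.ext (by simp only; omega)
      rw [ht]
      exact (apply_right (x1, x2) ⟨t - ℓ, by omega⟩).trans (hW ⟨t - ℓ, by omega⟩).symm

variable {X F ℓ m}

/-- In the `ℓ`-th space of a term, the part spanned by the `a_j` and the part from the space for `m`
both lie in `perpA`, so general position kills them. Hence the first `ℓ` letters of the shuffle are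
all `true`, and the second word has no letter `true`. -/
theorem eq_oppositeWords {w : Shuffle ℓ m × (Fin ℓ → Bool)}
    {x : FlagOf (IsProper : Submodule F (Fin ℓ → F) → Prop) (ℓ - 1) ×
      FlagOf (IsNonzeroIsotropic : Submodule F (X.Space F m) → Prop) m}
    (h : X.Opposite F ℓ m (X.productFlag F ℓ m w x)) : w = oppositeWords ℓ m := by
  rw [Opposite, vertex_productFlag _ _ (by omega)] at h
  have hbot : ∀ a y, a ∈ vertex x.1.1 (letterCount w.2 true (letterCount w.1.1 true ℓ)) →
      y ∈ vertex x.2.1 (letterCount w.1.1 false ℓ) → a = 0 ∧ y = 0 := by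
    intro a y ha hy
    have h1 : X.split F ℓ m ((a, 0), y) ∈ (⊥ : Submodule F (X.Space F (ℓ + m))) := by
      rw [← h]
      exact ⟨mem_block.2 ⟨⟨ha, Submodule.zero_mem _⟩, hy⟩, split_mem_perpA.2 rfl⟩
    rw [Submodule.mem_bot, LinearEquiv.map_eq_zero_iff] at h1
    exact ⟨congrArg (fun v => v.1.1) h1, congrArg Prod.snd h1⟩
  have h1 : letterCount w.1.1 false ℓ = 0 := by
    by_contra h0
    have h2 := letterCount_mono w.1.1 false (show ℓ ≤ ℓ + m by omega)
    rw [w.1.letterCount_false] at h2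
    have h3 := vertex_lt x.2 (Nat.pos_of_ne_zero h0) h2
    rw [vertex_zero] at h3
    obtain ⟨y, hy, hy0⟩ := SetLike.exists_of_lt h3
    exact hy0 (hbot 0 y (Submodule.zero_mem _) hy).2
  have h2 := letterCount_add w.1.1 (show ℓ ≤ ℓ + m by omega)
  rw [h1, add_zero] at h2
  rw [h2] at hbot
  have h3 : letterCount w.2 true ℓ = 0 := by
    by_contra h0
    have h4 := letterCount_add w.2 le_rfl
    have h5 := vertex_strict_of_proper x.1 (Nat.pos_of_ne_zero h0)
      (show letterCount w.2 true ℓ ≤ ℓ by omega)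
    rw [vertex_zero] at h5
    obtain ⟨a, ha, ha0⟩ := SetLike.exists_of_lt h5
    exact ha0 (hbot a 0 ha (Submodule.zero_mem _)).1
  refine Prod.ext (w.1.eq_first h2) (eq_of_letterCount_eq fun t ht => ?_)
  have := letterCount_mono w.2 true ht
  rw [oppositeWords, letterCount_const_false]
  omega

theorem vertex_productFlag_oppositeWords
    (x : FlagOf (IsProper : Submodule F (Fin ℓ → F) → Prop) (ℓ - 1) ×
      FlagOf (IsNonzeroIsotropic : Submodule F (X.Space F m) → Prop) m) :
    vertex (X.productFlag F ℓ m (oppositeWords ℓ m) x).1 ℓ = X.spanB F ℓ m := by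
  rw [vertex_productFlag _ _ (by omega), oppositeWords, Shuffle.letterCount_first_true (by omega),
    Shuffle.letterCount_first_false (by omega), min_self, hypVertex_const_false _ le_rfl,
    Nat.sub_self, vertex_zero, vertex_zero, annihilator_bot, spanB, block_splitB_bot]

theorem spanB_inf_perpA : X.spanB F ℓ m ⊓ X.perpA F ℓ m = ⊥ := by
  rw [eq_bot_iff]
  rintro v ⟨h1, h2⟩
  obtain ⟨a, b, x, rfl⟩ := exists_split v
  obtain ⟨rfl, rfl⟩ := split_mem_spanB.1 h1
  obtain rfl := split_mem_perpA.1 h2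
  exact map_zero (X.split F ℓ m)

theorem opposite_productFlag
    (x : FlagOf (IsProper : Submodule F (Fin ℓ → F) → Prop) (ℓ - 1) ×
      FlagOf (IsNonzeroIsotropic : Submodule F (X.Space F m) → Prop) m) :
    X.Opposite F ℓ m (X.productFlag F ℓ m (oppositeWords ℓ m) x) := by
  rw [Opposite, vertex_productFlag_oppositeWords, spanB_inf_perpA]

theorem exists_productFlag_eq (hℓ : 1 ≤ ℓ)
    {f : FlagOf (IsNonzeroIsotropic : Submodule F (X.Space F (ℓ + m)) → Prop) (ℓ + m)}
    (hf : vertex f.1 ℓ = X.spanB F ℓ m) :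
    ∃ x, X.productFlag F ℓ m (oppositeWords ℓ m) x = f := by
  refine (X.flagEmbedding F ℓ m hℓ).surj f fun t h1 h2 => ?_
  have h3 : ¬ (t : ℕ) < ℓ - 1 := fun h =>
    h1 ⟨ℓ - 2 - t, by omega⟩ (Fin.ext (by simp only; omega))
  have h4 : ¬ ℓ ≤ (t : ℕ) := fun h => h2 ⟨t - ℓ, by omega⟩ (Fin.ext (by simp only; omega))
  rw [← hf, ← vertex_succ f.1 t]
  congr 1
  omega

/-- The stabilizer of `a_1, …, a_ℓ` acts transitively on the isotropic complements of `perpA`. -/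
theorem exists_map_spanB_eq {Y : Submodule F (X.Space F (ℓ + m))} (hY : Isotropic Y)
    (h0 : Y ⊓ X.perpA F ℓ m = ⊥) (hfin : Module.finrank F Y = ℓ) :
    ∃ g : X.stab F ℓ (ℓ + m),
      (X.spanB F ℓ m).map (g.1.1 : X.Space F (ℓ + m) →ₗ[F] X.Space F (ℓ + m)) = Y := by
  -- `Y` is the graph of `η` over `spanB`, but the shear along `η` need not preserve the form. A
  -- second shear `τ`, which changes only the coordinates at the `a_j`, corrects this: it cancels
  -- the pairing of `x` with the component of `η` in the space for `m`.
  obtain ⟨η, hη⟩ := exists_map_shear_eq h0 (by rw [hfin, Module.finrank_fin_fun])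
  let τ : ((Fin ℓ → F) × X.Space F m) →ₗ[F] (Fin ℓ → F) :=
    { toFun := fun v j => -pairing v.2 (η (Pi.single j 1)).2
      map_add' := fun v w => by
        funext j
        simp only [Prod.snd_add, pairing_add_left, Pi.add_apply]
        ring
      map_smul' := fun c v => by
        funext j
        simp only [Prod.smul_snd, pairing_smul_left, Pi.smul_apply, smul_eq_mul,
          RingHom.id_apply]
        ring }
  have hτ : ∀ b' x b, τ (b', x) ⬝ᵥ b = -pairing x (η b).2 := by
    intro b' x b
    let L : (Fin ℓ → F) →ₗ[F] F :=
      { toFun := fun b => -pairing x (η b).2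
        map_add' := fun u v => by
          simp only [map_add, Prod.snd_add, pairing_add_right]
          ring
        map_smul' := fun c v => by
          simp only [map_smul, Prod.smul_snd, pairing_smul_right, smul_eq_mul, RingHom.id_apply]
          ring }
    change _ = L b
    rw [LinearMap.pi_apply_eq_sum_univ L b]
    refine Finset.sum_congr rfl fun j _ => ?_
    rw [smul_eq_mul, mul_comm, show (fun k => if j = k then (1 : F) else 0) = Pi.single j 1 by
      funext k
      simp [Pi.single_apply, eq_comm]]
    rfl
  let γ : X.Space F (ℓ + m) ≃ₗ[F] X.Space F (ℓ + m) :=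
    (shear (X.splitA F ℓ m) τ).trans (shear (X.splitB F ℓ m) η)
  have hγ : ∀ a b x, γ (X.split F ℓ m ((a, b), x))
      = X.split F ℓ m ((a + τ (b, x) + (η b).1, b), x + (η b).2) := by
    intro a b x
    change shear (X.splitB F ℓ m) η (shear (X.splitA F ℓ m) τ _) = _
    rw [← splitA_apply, shear_apply, splitA_apply, ← splitB_apply, shear_apply, ← splitB_apply]
    rfl
  have hdet : LinearEquiv.det γ = 1 := by
    change LinearEquiv.det (shear (X.splitB F ℓ m) η * shear (X.splitA F ℓ m) τ) = 1
    rw [map_mul, det_shear, det_shear, one_mul]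
  have hmem : ∀ b, X.split F ℓ m (((η b).1, b), (η b).2) ∈ Y := by
    intro b
    rw [← hη]
    refine ⟨X.split F ℓ m ((0, b), 0), split_mem_spanB.2 ⟨rfl, rfl⟩, ?_⟩
    rw [← splitB_apply, LinearEquiv.coe_coe, shear_apply, ← splitB_apply]
    congr 2
    exact zero_add (η b)
  rw [isotropic_iff] at hY
  have hpair : ∀ b b', (η b).1 ⬝ᵥ b' + X.sgn F * (b ⬝ᵥ (η b').1) + pairing (η b).2 (η b').2 = 0 := by
    intro b b'
    have := hY.1 _ (hmem b) _ (hmem b')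
    rwa [pairing_split] at this
  have hquad : ∀ b, X.quad F * ((η b).1 ⬝ᵥ b) + quadPart (η b).2 = 0 := by
    intro b
    have := hY.2 _ (hmem b)
    rwa [quadPart_split] at this
  -- After the cancellation by `τ`, the discrepancy in the forms involves only the coordinates at
  -- the `b_j`; it is zero because `Y` is isotropic (`hpair`, `hquad`).
  have hgroup : γ ∈ X.group F (ℓ + m) := by
    refine mem_group_iff.2 ⟨fun v w => ?_, fun v => ?_, Or.inr hdet⟩
    · obtain ⟨a, b, x, rfl⟩ := exists_split v
      obtain ⟨a', b', x', rfl⟩ := exists_split w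
      rw [hγ, hγ, pairing_split, pairing_split]
      simp only [add_dotProduct, dotProduct_add, hτ, pairing_add_left, pairing_add_right]
      have h1 := hτ b' x' b
      rw [dotProduct_comm] at h1
      rw [h1, pairing_comm (η b).2 x']
      linear_combination hpair b b'
    · obtain ⟨a, b, x, rfl⟩ := exists_split v
      rw [hγ, quadPart_split, quadPart_split]
      simp only [add_dotProduct, hτ, quadPart_add]
      linear_combination hquad b
  refine ⟨⟨⟨γ, hgroup⟩, mem_stab _ fun a => ?_⟩, ?_⟩
  · change γ _ = _
    rw [hγ, show ((0 : Fin ℓ → F), (0 : X.Space F m)) = 0 from rfl, map_zero, map_zero]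
    simp
  · change (X.spanB F ℓ m).map (γ : X.Space F (ℓ + m) →ₗ[F] X.Space F (ℓ + m)) = Y
    -- On `spanB` the correction `τ` vanishes, so `γ` maps it to `Y` just as the shear along `η`
    -- does.
    refine Eq.trans ?_ hη
    refine (Submodule.map_comp _ _ _).trans (congrArg _ (map_eq_self_of_forall_eq
      (shear (X.splitA F ℓ m) τ) fun v hv => ?_))
    obtain ⟨a, b, x, rfl⟩ := exists_split v
    obtain ⟨rfl, rfl⟩ := split_mem_spanB.1 hv
    rw [← splitA_apply, shear_apply]
    have h1 : τ (b, 0) = 0 := by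
      funext j
      change -pairing 0 _ = 0
      rw [pairing_comm, pairing_zero_right, mul_zero, neg_zero]
    rw [h1, add_zero]

theorem induced_bijective (X : IsotropicFamily) (F R : Type u) [Field F] [CommRing R] (ℓ m : ℕ)
    (hℓ : 1 ≤ ℓ) :
    Function.Bijective (Finsupp.lsum R
      fun c : X.stab F ℓ (ℓ + m) ⧸ (X.inclusion F ℓ m).range =>
        (X.stabRep F R ℓ (ℓ + m)).ρ c.out ∘ₗ X.reederProduct F R ℓ m :
      ((X.stab F ℓ (ℓ + m) ⧸ (X.inclusion F ℓ m).range) →₀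
        LinearFamily.SteinbergModule F R ℓ ⊗[R] X.SteinbergModule F R m) →ₗ[R]
        X.SteinbergModule F R (ℓ + m)) := by
  have hunit (w : Shuffle ℓ m × (Fin ℓ → Bool)) : IsUnit (w.1.sign R * hypSign R w.2) :=
    IsUnit.mul (Shuffle.isUnit_sign (R := R) w.1) (isUnit_hypSign w.2)
  refine (X.flagEmbedding F ℓ m hℓ).induced_bijective (fun _ h => h.1)
    (X.finrank_le_of_isotropic F (ℓ + m))
    ((Subgroup.inclusion (X.group_le_preserving F (ℓ + m))).comp (X.stab F ℓ (ℓ + m)).subtype)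
    (X.reederProduct F R ℓ m) (fun w => w.1.sign R * hypSign R w.2) (X.productFlag F ℓ m)
    ?_ (oppositeWords ℓ m) ?_ ?_ {f | X.Opposite F ℓ m f} ?_ ?_ ?_ ?_ ?_ _ ?_ ?_
  · exact X.reederProduct_eq_sum F ℓ m R
  · rfl
  · exact hunit _
  · exact fun w x h => eq_oppositeWords h
  · exact opposite_productFlag
  · exact eq_zero_of_opposite hℓ
  · intro g f hf
    change vertex (FlagOf.map _ f).1 ℓ ⊓ _ = ⊥
    rw [FlagOf.vertex_map]
    conv_lhs => rw [← map_perpA g]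
    refine (Submodule.map_inf _ g.1.1.injective).symm.trans ?_
    rw [show vertex f.1 ℓ ⊓ X.perpA F ℓ m = ⊥ from hf, Submodule.map_bot]
  · intro f hf
    obtain ⟨γ, hγ⟩ := exists_map_spanB_eq (isotropic_vertex f (by omega)) hf
      (finrank_vertex f (by omega))
    set σ := (Subgroup.inclusion (X.group_le_preserving F (ℓ + m))).comp
      (X.stab F ℓ (ℓ + m)).subtype
    have h1 : vertex (FlagOf.map (σ γ⁻¹) f).1 ℓ = X.spanB F ℓ m := by
      rw [FlagOf.vertex_map, ← hγ, ← Submodule.map_comp]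
      refine Eq.trans ?_ (Submodule.map_id _)
      exact congrArg (fun L => (X.spanB F ℓ m).map L)
        (LinearMap.ext fun v => γ.1.1.symm_apply_apply v)
    obtain ⟨x, hx⟩ := exists_productFlag_eq hℓ h1
    refine ⟨γ, x, ?_⟩
    rw [hx, ← FlagOf.map_mul, ← map_mul, mul_inv_cancel, map_one, FlagOf.map_one]
  · intro g x y h
    have h1 := congrArg (fun f => vertex f.1 ℓ) h
    simp only [FlagOf.vertex_map, vertex_productFlag_oppositeWords] at h1
    exact mem_range_inclusion g h1
  · rintro _ ⟨g, rfl⟩ x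
    exact ⟨(x.1, FlagOf.map (Subgroup.inclusion (X.group_le_preserving F m) g) x.2),
      (map_joinFlag (X.joinValid F ℓ m) _ (Subgroup.inclusion (X.group_le_preserving F m) g) _ rfl
        (hypFlag _ x.1, x.2)).symm⟩

theorem isIso_homologyMap (X : IsotropicFamily) (F R : Type u) [Field F] [CommRing R] (ℓ m : ℕ)
    (hℓ : 1 ≤ ℓ) (i : ℕ) : CategoryTheory.IsIso (X.homologyMap F R ℓ m i) := by
  refine Shapiro.isIso_map_of_bijective (X.inclusion F ℓ m) ?_ (X.reederHom F R ℓ m)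
    (fun c : X.stab F ℓ (ℓ + m) ⧸ (X.inclusion F ℓ m).range => c.out) (fun g => ?_)
    (X.induced_bijective F R ℓ m hℓ) i
  · intro g h hgh
    exact Subtype.ext (blockHom_injective (congrArg (fun k => k.1.1) hgh))
  · obtain ⟨⟨_, h, rfl⟩, hk⟩ := QuotientGroup.mk_out_eq_mul (X.inclusion F ℓ m).range g
    refine ⟨g, h⁻¹, ?_⟩
    rw [hk, map_inv, mul_inv_cancel_right]

theorem nonempty_homologyEquiv (X : IsotropicFamily) (F R : Type u) [Field F] [CommRing R]
    (ℓ m : ℕ) (hℓ : 1 ≤ ℓ) (i : ℕ) : Nonempty (LinearFamily.SteinbergModule F R ℓ ⊗[R]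
      groupHomology (X.steinberg F R m) i ≃ₗ[R] groupHomology (X.stabRep F R ℓ (ℓ + m)) i) := by
  have := X.isIso_homologyMap F R ℓ m hℓ i
  exact ⟨(Shapiro.tensorHomologyEquiv (LinearFamily.SteinbergModule F R ℓ)
    (X.steinbergAction F R m) i).trans
    (CategoryTheory.asIso (X.homologyMap F R ℓ m i)).toLinearEquiv⟩

end IsotropicFamily
end SteinbergStability

theorem lemma4p1 (F R : Type u) [Field F] [CommRing R] (ℓ m : ℕ) (hℓ : 1 ≤ ℓ) (i : ℕ) :
    (∀ X : SteinbergStability.LinearFamily,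
      CategoryTheory.IsIso (X.homologyMap F R ℓ m i) ∧
      Nonempty (SteinbergStability.LinearFamily.SteinbergModule F R ℓ ⊗[R]
          groupHomology (X.steinberg F R m) i ≃ₗ[R]
        groupHomology (X.stabRep F R ℓ (ℓ + m)) i)) ∧
    (∀ X : SteinbergStability.IsotropicFamily,
      CategoryTheory.IsIso (X.homologyMap F R ℓ m i) ∧
      Nonempty (SteinbergStability.LinearFamily.SteinbergModule F R ℓ ⊗[R]
          groupHomology (X.steinberg F R m) i ≃ₗ[R]
        groupHomology (X.stabRep F R ℓ (ℓ + m)) i)) :=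
  ⟨fun X => ⟨X.isIso_homologyMap F R ℓ m hℓ i, X.nonempty_homologyEquiv F R ℓ m hℓ i⟩,
    fun X => ⟨X.isIso_homologyMap F R ℓ m hℓ i, X.nonempty_homologyEquiv F R ℓ m hℓ i⟩⟩
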